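/- For integers $p,q\ge 3$ with $(p-2)(q-2)>4$, a $\{p,q\}$-polyform is a non-empty finite set $A$ of tiles of the hyperbolic $\{p,q\}$-tessellation (regular $p$-gons, $q$ at each vertex) that is connected through shared edges. Its holes are the bounded connected components of the complement of the union of its tiles. Its (outer) perimeter is the number of its edges that border the unbounded component of the complement, and $A$ is extremal if its perimeter is minimal among all $\{p,q\}$-polyforms with the same number of tiles. Let $g_{p,q}(h)$ be the minimum number of tiles of a $\{p,q\}$-polyform with exactly $h$ holes, and let $P_{\min}^{p,q}(n)$ and $v_{\min}^{p,q}(n)$ be the minimum perimeter and the minimum number of vertices of a $\{p,q\}$-polyform with $n$ tiles. **Theorem.** Let $k>3$ and $h\ge 1$ be integers. Then $$g_{2k,3}(h)\le \frac{P_{\min}^{2k,k}(h)+(2k-2)h}{2}+1 .$$ Moreover $$v_{\min}^{2k,k}(h)=\frac{P_{\min}^{2k,k}(h)+(2k-2)h}{2}+1,$$ so that, equivalently, $g_{2k,3}(h)\le v_{\min}^{2k,k}(h)$. The bound is realized by puncturing: join a new vertex at the center of each tile of the $\{2k,k\}$-tessellation to all the vertices of that tile. The resulting graph, on the old vertices and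 the centers, is isomorphic to the adjacency graph of the tiles of the $\{2k,3\}$-tessellation (two tiles being adjacent if they share an edge). For some such isomorphism there is an extremal $\{2k,k\}$-polyform $A$ with $h$ tiles and $v_{\min}^{2k,k}(h)$ vertices such that the set of tiles of the $\{2k,3\}$-tessellation that correspond to the vertices of $A$ is a $\{2k,3\}$-polyform with exactly $h$ holes and $v_{\min}^{2k,k}(h)$ tiles. -/

import Mathlib

noncomputable section

namespace Tessellation

/-- The Coxeter matrix of the group `[p,q]`: three generators `s₀, s₁, s₂` with
`(s₀ s₁)^p = (s₁ s₂)^q = (s₀ s₂)^2 = 1`. For `(p - 2)(q - 2) > 4` this is the full symmetry group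
of the hyperbolic `{p,q}`-tessellation, generated by the reflections in the sides of a triangle
with angles `π/p, π/q, π/2`. -/
def schlafli (p q : ℕ) (hp : p ≠ 1) (hq : q ≠ 1) : CoxeterMatrix (Fin 3) where
  M := !![1, p, 2; p, 1, q; 2, q, 1]
  isSymm := by
    ext i j
    fin_cases i <;> fin_cases j <;> rfl
  diagonal := by
    intro i
    fin_cases i <;> rfl
  off_diagonal := by
    intro i j hij
    fin_cases i <;> fin_cases j <;> simp_all

/-- The stabilizer of the `i`-dimensional face of the base flag: the subgroup generated by the
simple reflections other than `s_i`. -/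
def faceStabilizer (M : CoxeterMatrix (Fin 3)) (i : Fin 3) : Subgroup M.Group :=
  Subgroup.closure {x | ∃ j, j ≠ i ∧ x = M.simple j}

/-- The `i`-dimensional faces of the tessellation. The symmetry group acts simply transitively on
flags (vertex, edge, tile), so its elements `w` are the flags; `w` and `w * s_i` are the two flags
that differ at most in their `i`-dimensional face. A face is a left coset of its stabilizer, and
the elements of the coset are the flags that contain it. -/
abbrev Face (M : CoxeterMatrix (Fin 3)) (i : Fin 3) : Type :=
  M.Group ⧸ faceStabilizer M i

/-- Vertices of the tessellation; `q` tiles meet at each of them. -/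
abbrev Vertex (M : CoxeterMatrix (Fin 3)) : Type := Face M 0

/-- Edges of the tessellation. -/
abbrev Edge (M : CoxeterMatrix (Fin 3)) : Type := Face M 1

/-- Tiles (`p`-gons) of the tessellation. -/
abbrev Tile (M : CoxeterMatrix (Fin 3)) : Type := Face M 2

/-- Two faces are incident if some flag contains both. -/
def Incident {M : CoxeterMatrix (Fin 3)} {i j : Fin 3} (F : Face M i) (G : Face M j) : Prop :=
  ∃ w : M.Group, (QuotientGroup.mk w : Face M i) = F ∧ (QuotientGroup.mk w : Face M j) = G

/-- Two tiles are adjacent if they are distinct and share an edge. -/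
def tileGraph (M : CoxeterMatrix (Fin 3)) : SimpleGraph (Tile M) where
  Adj X Y := X ≠ Y ∧ ∃ e : Edge M, Incident X e ∧ Incident Y e
  symm := ⟨fun _ _ ⟨hne, e, hX, hY⟩ => ⟨hne.symm, e, hY, hX⟩⟩
  loopless := ⟨fun _ h => h.1 rfl⟩

/-- A polyform: a (non-empty) finite set of tiles, connected through shared edges; equivalently,
the union of the tiles has connected interior. -/
def IsPolyform {M : CoxeterMatrix (Fin 3)} (A : Set (Tile M)) : Prop :=
  A.Finite ∧ ((tileGraph M).induce A).Connected

/-- The connected components of the complement of `A`. Two tiles outside `A` lie in the same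
component of the complement of the closed region covered by `A` iff they are joined by a chain of
tiles outside `A`, consecutive ones sharing an edge: a point where two such tiles meet only in a
corner belongs to `A`, unless all the tiles around that corner are outside `A`. -/
abbrev ComplComponent {M : CoxeterMatrix (Fin 3)} (A : Set (Tile M)) : Type :=
  ((tileGraph M).induce Aᶜ).ConnectedComponent

/-- The holes of `A`: the bounded components of its complement, i.e. those with finitely many
tiles. -/
def holes {M : CoxeterMatrix (Fin 3)} (A : Set (Tile M)) : Set (ComplComponent A) :=
  {C | C.supp.Finite}

/-- The number of holes of `A`. -/
def holeCount {M : CoxeterMatrix (Fin 3)} (A : Set (Tile M)) : ℕ := (holes A).ncard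

/-- The edges of `A` that border the unbounded region of the complement. -/
def outerEdges {M : CoxeterMatrix (Fin 3)} (A : Set (Tile M)) : Set (Edge M) :=
  {e | (∃ X ∈ A, Incident X e) ∧
    ∃ Y : (Aᶜ : Set (Tile M)), Incident (Y : Tile M) e ∧
      (((tileGraph M).induce Aᶜ).connectedComponentMk Y).supp.Infinite}

/-- The outer perimeter of `A`. -/
def outerPerimeter {M : CoxeterMatrix (Fin 3)} (A : Set (Tile M)) : ℕ := (outerEdges A).ncard

/-- The vertices of the tiles of `A`. -/
def vertexSet {M : CoxeterMatrix (Fin 3)} (A : Set (Tile M)) : Set (Vertex M) :=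
  {v | ∃ X ∈ A, Incident X v}

/-- The number of vertices of `A`. -/
def vertexCount {M : CoxeterMatrix (Fin 3)} (A : Set (Tile M)) : ℕ := (vertexSet A).ncard

/-- `g(h)`: the minimum number of tiles of a polyform with `h` holes. -/
def minTiles (M : CoxeterMatrix (Fin 3)) (h : ℕ) : ℕ :=
  sInf {n | ∃ A : Set (Tile M), IsPolyform A ∧ holeCount A = h ∧ A.ncard = n}

/-- `P_min(n)`: the minimum perimeter of a polyform with `n` tiles. -/
def minPerimeter (M : CoxeterMatrix (Fin 3)) (n : ℕ) : ℕ :=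
  sInf {m | ∃ A : Set (Tile M), IsPolyform A ∧ A.ncard = n ∧ outerPerimeter A = m}

/-- `v_min(n)`: the minimum number of vertices of a polyform with `n` tiles. -/
def minVertices (M : CoxeterMatrix (Fin 3)) (n : ℕ) : ℕ :=
  sInf {m | ∃ A : Set (Tile M), IsPolyform A ∧ A.ncard = n ∧ vertexCount A = m}

/-- A polyform is extremal if it attains the minimum perimeter among the polyforms with the same
number of tiles. -/
def IsExtremal {M : CoxeterMatrix (Fin 3)} (A : Set (Tile M)) : Prop :=
  IsPolyform A ∧
    ∀ B : Set (Tile M), IsPolyform B → B.ncard = A.ncard → outerPerimeter A ≤ outerPerimeter B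

/-- The adjacency relation of the graph obtained from the vertices and edges of the tessellation by
adding the center of each tile as a new vertex, joined to all the vertices of that tile. -/
def CenteredAdj (M : CoxeterMatrix (Fin 3)) : Tile M ⊕ Vertex M → Tile M ⊕ Vertex M → Prop
  | Sum.inl _, Sum.inl _ => False
  | Sum.inl X, Sum.inr v => Incident X v
  | Sum.inr v, Sum.inl X => Incident X v
  | Sum.inr u, Sum.inr v => u ≠ v ∧ ∃ e : Edge M, Incident u e ∧ Incident v e

/-- The graph of the vertices of the tessellation and the centers of its tiles. For the
`{2k,k}`-tessellation it is the graph of the `{3,2k}`-tessellation, the dual of `{2k,3}`. -/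
def centeredGraph (M : CoxeterMatrix (Fin 3)) : SimpleGraph (Tile M ⊕ Vertex M) where
  Adj := CenteredAdj M
  symm := ⟨by
    rintro (X | u) (Y | v) h
    · exact h
    · exact h
    · exact h
    · obtain ⟨hne, e, hu, hv⟩ := h
      exact ⟨hne.symm, e, hv, hu⟩⟩
  loopless := ⟨by
    rintro (X | u) h
    · exact h
    · exact h.1 rfl⟩

/-- The punctured polyform of `A` under a duality `φ`, which sends tile centers and vertices of the
first tessellation to tiles of the second: the tiles that correspond to the vertices of `A`. -/
def puncture {M N : CoxeterMatrix (Fin 3)} (φ : centeredGraph M ≃g tileGraph N)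
    (A : Set (Tile M)) : Set (Tile N) :=
  (fun v : Vertex M => φ (Sum.inr v)) '' vertexSet A

end Tessellation

end

/-!
Flags of a tessellation are the elements `x` of its Coxeter group, `x * s_i` is the flag across the
`i`-dimensional face, and `face i x` is the `i`-dimensional face of `x`. The proof has three
components.

**Shelling.** By the cocycle description of descents (`CoxeterSystem.reflSign`), the elements of a
coset of a dihedral parabolic subgroup, listed from its shortest element, have the expected lengths
(`CoxeterSystem.length_mul_alt`). For `[2k,k]` with `k > 3` this shows that in order of distance
from a root tile every other tile has one or two old edges, consecutive ones, and that its vertices on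
new edges only are new (`RootedRank`, `IsTess.exists_rootedRank`). Removing tiles in reverse order
shows that a finite set of edges that is even at each vertex bounds a finite set of tiles
(`IsTess.exists_boundary`), which serves as the Jordan curve theorem. As a consequence, a connected
set of tiles without holes can be peeled: some tile, not a prescribed one, shares a path of one or
two edges with the rest, and the rest is again connected without holes (`IsTess.exists_peel`).

**Counting.** Peeling gives Euler's formula for connected sets without holes (`IsTess.euler`), hence
a linear relation between vertices, tiles and boundary edges (`IsTess.two_mul_vertices`), and shows
that each further tile costs at least `2k - 3` vertices (`IsTess.minVertices_add_le`). On the other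
hand, a finite set `S` of tiles outside `A` is cheap if it surrounds its vertices that are not on
`A`: as `k` tiles with `2k` vertices meet at each of them, it adds at most two vertices per tile
(`IsTess.vertexCount_union_le`). So if `A` has as few vertices as possible there is no such set
(`IsTess.not_surrounded`). In particular `A` has no holes, its perimeter is given by the linear
relation, and comparison with filled competitors shows that `A` is extremal
(`IsTess.isExtremal_of_minimal`).

**Puncturing.** The triangles of the centered tessellation have flags on which `[2k,3]` acts, simply
transitively, and this identifies the centered graph with the graph of tiles of the
`{2k,3}`-tessellation (`IsTess.exists_duality`). The punctured polyform of `A` is connected because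
the edges of `A` join its vertices. In its complement the center of each tile of `A` is isolated,
and any other bounded component would yield a surrounded set of tiles outside `A`; so there is one
hole for each tile of `A` (`holeCount_puncture`).
-/

noncomputable section

/-! ### Inversions in Coxeter groups and cosets of dihedral subgroups -/

namespace CoxeterSystem

variable {B W : Type*} [Group W] {M : CoxeterMatrix B} (cs : CoxeterSystem M W)

open Classical in
/-- The action of a simple reflection on reflections with a sign: conjugation, with a change of sign
at the simple reflection itself. The formula makes sense on all of `W`, so
no subtype of reflections is needed. -/
def reflStep (i : B) : Equiv.Perm (W × ZMod 2) where
  toFun p := (cs.simple i * p.1 * cs.simple i, p.2 + if p.1 = cs.simple i then 1 else 0)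
  invFun p := (cs.simple i * p.1 * cs.simple i, p.2 + if p.1 = cs.simple i then 1 else 0)
  left_inv := by
    rintro ⟨t, ε⟩
    have h : cs.simple i * t * cs.simple i = cs.simple i ↔ t = cs.simple i := by
      constructor
      · intro h
        have := congrArg (fun z => cs.simple i * z * cs.simple i) h
        simpa [mul_assoc] using this
      · rintro rfl; simp
    ext
    · simp [mul_assoc]
    · simp only [h]
      split_ifs
      · rw [add_assoc, CharTwo.add_self_eq_zero, add_zero]
      · simp
  right_inv := by
    rintro ⟨t, ε⟩
    have h : cs.simple i * t * cs.simple i = cs.simple i ↔ t = cs.simple i := by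
      constructor
      · intro h
        have := congrArg (fun z => cs.simple i * z * cs.simple i) h
        simpa [mul_assoc] using this
      · rintro rfl; simp
    ext
    · simp [mul_assoc]
    · simp only [h]
      split_ifs
      · rw [add_assoc, CharTwo.add_self_eq_zero, add_zero]
      · simp

theorem simple_mul_pow_comm (i j : B) (n : ℕ) :
    ((cs.simple i * cs.simple j) ^ n)⁻¹ * cs.simple j =
      cs.simple j * (cs.simple i * cs.simple j) ^ n := by
  induction n with
  | zero => simp
  | succ n ih =>
    have h : (cs.simple i * cs.simple j)⁻¹ * cs.simple j =
        cs.simple j * (cs.simple i * cs.simple j) := by simp [mul_assoc]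
    rw [pow_succ, mul_inv_rev, mul_assoc, ih, ← mul_assoc, h, mul_assoc, ← pow_succ', ← pow_succ]

open Classical in
theorem reflStep_mul_pow (i j : B) (n : ℕ) (t : W) (ε : ZMod 2) :
    ((cs.reflStep i * cs.reflStep j) ^ n) (t, ε) =
      ((cs.simple i * cs.simple j) ^ n * t * ((cs.simple i * cs.simple j) ^ n)⁻¹,
        ε + ∑ l ∈ Finset.range (2 * n),
          if t = cs.simple j * (cs.simple i * cs.simple j) ^ l then 1 else 0) := by
  induction n with
  | zero => simp
  | succ n ih =>
    set r := cs.simple i * cs.simple j with hr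
    rw [pow_succ', Equiv.Perm.mul_apply, ih, Equiv.Perm.mul_apply]
    have hcomm := cs.simple_mul_pow_comm i j n
    rw [← hr] at hcomm
    have h1 : r ^ n * t * (r ^ n)⁻¹ = cs.simple j ↔ t = cs.simple j * r ^ (2 * n) := by
      rw [two_mul, pow_add, ← mul_assoc, ← hcomm]
      constructor
      · intro h; rw [← h]; group
      · intro h; rw [h]; group
    have h2 : cs.simple j * (r ^ n * t * (r ^ n)⁻¹) * cs.simple j = cs.simple i ↔
        t = cs.simple j * r ^ (2 * n + 1) := by
      have e : cs.simple j * r ^ (2 * n + 1) =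
          (r ^ n)⁻¹ * (cs.simple j * cs.simple i * cs.simple j) * r ^ n := by
        rw [show 2 * n + 1 = n + 1 + n by ring, pow_add, pow_add, pow_one, ← mul_assoc,
          ← mul_assoc, ← hcomm]
        simp only [hr, mul_assoc]
      rw [e]
      constructor
      · intro h; rw [← h]; simp [mul_assoc]
      · intro h; rw [h]; simp [mul_assoc]
    ext
    · simp only [reflStep, Equiv.coe_fn_mk]
      rw [pow_succ', mul_inv_rev, hr]
      simp [mul_assoc]
    · simp only [reflStep, Equiv.coe_fn_mk, h1, h2]
      rw [show 2 * (n + 1) = 2 * n + 1 + 1 by ring, Finset.sum_range_succ, Finset.sum_range_succ]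
      ring

/-- The steps satisfy the Coxeter relations: along a full braid relation each reflection changes
sign an even number of times. -/
theorem isLiftable_reflStep : M.IsLiftable cs.reflStep := by
  classical
  intro i j
  ext ⟨t, ε⟩
  · simp [reflStep_mul_pow]
  · rw [reflStep_mul_pow, two_mul, Finset.sum_range_add]
    simp only [pow_add, simple_mul_simple_pow, one_mul, CharTwo.add_self_eq_zero, add_zero]
    rfl

/-- The reflection cocycle: `cs.reflSign w t = 1` when the reflection `t` is a right inversion of
`w`, and `0` otherwise. It is read off the action of `w` on reflections with a sign. -/
def reflSign (w t : W) : ZMod 2 := (cs.lift ⟨cs.reflStep, cs.isLiftable_reflStep⟩ w (t, 0)).2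

theorem lift_reflStep (w t : W) (ε : ZMod 2) :
    cs.lift ⟨cs.reflStep, cs.isLiftable_reflStep⟩ w (t, ε) =
      (w * t * w⁻¹, ε + cs.reflSign w t) := by
  induction w using cs.simple_induction_left generalizing t ε with
  | one => simp [reflSign]
  | mul_simple_left w i ih =>
    have h := ih t 0
    simp only [zero_add] at h
    have e : ∀ ε, cs.lift ⟨cs.reflStep, cs.isLiftable_reflStep⟩ (cs.simple i * w) (t, ε) =
        cs.reflStep i (w * t * w⁻¹, ε + cs.reflSign w t) := by
      intro ε
      rw [map_mul, lift_apply_simple, Equiv.Perm.mul_apply, ih]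
    rw [reflSign, e, e]
    simp [reflStep, mul_assoc, add_assoc]

theorem reflSign_mul (u w t : W) :
    cs.reflSign (u * w) t = cs.reflSign u (w * t * w⁻¹) + cs.reflSign w t := by
  rw [reflSign, map_mul, Equiv.Perm.mul_apply, lift_reflStep, lift_reflStep, zero_add, add_comm]

open Classical in
theorem reflSign_simple (i : B) (t : W) :
    cs.reflSign (cs.simple i) t = if t = cs.simple i then 1 else 0 := by
  rw [reflSign, lift_apply_simple]
  simp [reflStep]

open Classical in
theorem reflSign_mul_pow (i j : B) (n : ℕ) (t : W) :
    cs.reflSign ((cs.simple i * cs.simple j) ^ n) t = ∑ l ∈ Finset.range (2 * n),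
      if t = cs.simple j * (cs.simple i * cs.simple j) ^ l then 1 else 0 := by
  rw [reflSign, map_pow, map_mul, lift_apply_simple, lift_apply_simple]
  rw [reflStep_mul_pow, zero_add]

theorem reflSign_wordProd (ω : List B) (t : W) (h : cs.reflSign (cs.wordProd ω) t ≠ 0) :
    t ∈ cs.rightInvSeq ω := by
  classical
  induction ω with
  | nil => simp [reflSign] at h
  | cons i ω ih =>
    rw [wordProd_cons, reflSign_mul, reflSign_simple] at h
    rw [rightInvSeq, List.mem_cons]
    by_cases h1 : cs.wordProd ω * t * (cs.wordProd ω)⁻¹ = cs.simple i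
    · left; rw [← h1]; group
    · right; apply ih; simpa [h1] using h

theorem length_mul_lt_of_reflSign {w t : W} (h : cs.reflSign w t ≠ 0) :
    cs.length (w * t) < cs.length w := by
  obtain ⟨ω, hω, rfl⟩ := cs.exists_isReduced w
  exact (cs.isRightInversion_of_mem_rightInvSeq hω (cs.reflSign_wordProd ω t h)).2

/-- Descents are visible in the cocycle, hence can be computed in a product. -/
theorem isRightDescent_iff_reflSign {w : W} {i : B} :
    cs.IsRightDescent w i ↔ cs.reflSign w (cs.simple i) ≠ 0 := by
  constructor
  · intro h h0
    have h1 : cs.reflSign (w * cs.simple i) (cs.simple i) ≠ 0 := by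
      rw [reflSign_mul, reflSign_simple]
      simp [h0]
    have := cs.length_mul_lt_of_reflSign h1
    rw [IsRightDescent] at h
    simp at this
    omega
  · exact fun h => cs.length_mul_lt_of_reflSign h

/-- The alternating product of `n` simple reflections `s_i`, `s_j` whose last factor is `s_i`. -/
def alt (i j : B) : ℕ → W
  | 0 => 1
  | n + 1 => alt j i n * cs.simple i

@[simp] theorem alt_zero (i j : B) : cs.alt i j 0 = 1 := by rw [alt]

theorem alt_succ (i j : B) (n : ℕ) : cs.alt i j (n + 1) = cs.alt j i n * cs.simple i := by rw [alt]

theorem alt_eq_wordProd (i j : B) (n : ℕ) :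
    cs.alt i j n = cs.wordProd (alternatingWord j i n) := by
  induction n generalizing i j with
  | zero => simp [alternatingWord]
  | succ n ih => rw [alt_succ, ih, alternatingWord_succ, wordProd_concat]

theorem alt_braid (i j : B) : cs.alt i j (M i j) = cs.alt j i (M i j) := by
  rw [alt_eq_wordProd, alt_eq_wordProd]
  have := cs.wordProd_braidWord_eq j i
  rwa [braidWord, braidWord, M.symmetric j i] at this

theorem alt_mem (i j : B) (n : ℕ) :
    cs.alt i j n ∈ Subgroup.closure {cs.simple i, cs.simple j} := by
  induction n generalizing i j with
  | zero => exact one_mem _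
  | succ n ih =>
    rw [alt_succ]
    refine mul_mem ?_ (Subgroup.subset_closure (by simp))
    rw [Set.pair_comm]
    exact ih j i

/-- The elements of a finite dihedral parabolic subgroup are alternating products. -/
theorem exists_alt_of_mem {i j : B} (hM : M i j ≠ 0) {u : W}
    (hu : u ∈ Subgroup.closure {cs.simple i, cs.simple j}) :
    ∃ n ≤ M i j, u = cs.alt i j n ∨ u = cs.alt j i n := by
  -- right multiplication by either generator moves one step along the cycle of `2 * M i j` elements
  have step : ∀ u : W, (∃ n ≤ M i j, u = cs.alt i j n ∨ u = cs.alt j i n) →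
      (∃ n ≤ M i j, u * cs.simple i = cs.alt i j n ∨ u * cs.simple i = cs.alt j i n) ∧
      (∃ n ≤ M i j, u * cs.simple j = cs.alt i j n ∨ u * cs.simple j = cs.alt j i n) := by
    rintro u ⟨n, hn, h⟩
    rcases n with _ | n
    · simp only [alt_zero, or_self] at h
      subst h
      refine ⟨⟨1, by omega, Or.inl ?_⟩, ⟨1, by omega, Or.inr ?_⟩⟩ <;> simp [alt_succ]
    · rcases h with rfl | rfl
      · refine ⟨⟨n, by omega, Or.inr (by simp [alt_succ])⟩, ?_⟩
        rcases hn.lt_or_eq with h | h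
        · exact ⟨n + 2, h, Or.inr (cs.alt_succ j i _).symm⟩
        · refine ⟨n, by omega, Or.inl ?_⟩
          rw [h, alt_braid, ← h]
          simp [alt_succ]
      · refine ⟨?_, ⟨n, by omega, Or.inl (by simp [alt_succ])⟩⟩
        rcases hn.lt_or_eq with h | h
        · exact ⟨n + 2, h, Or.inl (cs.alt_succ i j _).symm⟩
        · refine ⟨n, by omega, Or.inr ?_⟩
          rw [h, ← alt_braid, ← h]
          simp [alt_succ]
  induction hu using Subgroup.closure_induction_right with
  | one => exact ⟨0, Nat.zero_le _, by simp⟩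
  | mul_right x hx y hy ih =>
    rcases hy with rfl | rfl
    · exact (step x ih).1
    · exact (step x ih).2
  | mul_inv_cancel x hx y hy ih =>
    rcases hy with rfl | rfl
    · simpa using (step x ih).1
    · simpa using (step x ih).2

/-- The elements of a coset of a dihedral parabolic subgroup, listed by alternating products from
the shortest element `y`, have the expected lengths. -/
theorem length_mul_alt {i j : B} (hord : orderOf (cs.simple i * cs.simple j) = M i j) {y : W}
    (hy : ∀ u ∈ Subgroup.closure {cs.simple i, cs.simple j}, cs.length y ≤ cs.length (y * u))
    {n : ℕ} (hn : n ≤ M i j) : cs.length (y * cs.alt i j n) = cs.length y + n := by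
  classical
  -- the inductive claim, symmetric in the two generators
  suffices key : ∀ (n : ℕ) (i j : B), orderOf (cs.simple i * cs.simple j) = M i j →
      (∀ u ∈ Subgroup.closure {cs.simple i, cs.simple j}, cs.length y ≤ cs.length (y * u)) →
      n ≤ M i j → cs.length (y * cs.alt i j n) = cs.length y + n from key n i j hord hy hn
  clear hn hy hord n i j
  intro n
  induction n with
  | zero => simp
  | succ n ih =>
    intro i j hord hy hn
    have hord' : orderOf (cs.simple j * cs.simple i) = M j i := by
      rw [← M.symmetric i j, ← hord, ← orderOf_inv]
      simp
    have hy' : ∀ u ∈ Subgroup.closure {cs.simple j, cs.simple i},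
        cs.length y ≤ cs.length (y * u) := by rwa [Set.pair_comm]
    have h1 := ih j i hord' hy' (by rw [M.symmetric j i]; omega)
    rw [alt_succ, ← mul_assoc]
    -- the next letter is not a descent because its reflection is not an inversion
    have hasc : ¬ cs.IsRightDescent (y * cs.alt j i n) i := by
      rw [isRightDescent_iff_reflSign, not_not, reflSign_mul]
      -- a reflection in the subgroup is not an inversion of the shortest element of the coset
      have hy0 : cs.reflSign y (cs.alt j i n * cs.simple i * (cs.alt j i n)⁻¹) = 0 := by
        by_contra hne
        have := cs.length_mul_lt_of_reflSign hne
        have hm : cs.alt j i n ∈ Subgroup.closure {cs.simple i, cs.simple j} := by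
          rw [Set.pair_comm]; exact cs.alt_mem j i n
        have := hy _ (mul_mem (mul_mem hm
          (Subgroup.subset_closure (Set.mem_insert (cs.simple i) _))) (inv_mem hm))
        omega
      -- the alternating product is a power of a rotation, up to a simple reflection
      have hr : ∀ a, 0 < a → a < M i j → (cs.simple i * cs.simple j) ^ a ≠ 1 := by
        intro a h0 ha h
        have := orderOf_dvd_of_pow_eq_one h
        rw [hord] at this
        exact absurd (Nat.le_of_dvd h0 this) (by omega)
      have hpow : ∀ a, 2 * a < M i j →
          cs.reflSign ((cs.simple i * cs.simple j) ^ a) (cs.simple i) = 0 := by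
        intro a ha
        -- `s_i = s_j r ^ l` with `r = s_i s_j` would mean `r ^ (l + 1) = 1`
        rw [reflSign_mul_pow]
        refine Finset.sum_eq_zero fun l hl => if_neg fun h => ?_
        rw [Finset.mem_range] at hl
        refine hr (l + 1) (by omega) (by omega) ?_
        rw [pow_succ', mul_assoc, ← h]
        simp
      rw [hy0, zero_add, alt_eq_wordProd, prod_alternatingWord_eq_mul_pow]
      rcases Nat.even_or_odd n with he | ho
      · rw [if_pos he, one_mul]
        exact hpow _ (by omega)
      · rw [if_neg (Nat.not_even_iff_odd.mpr ho), reflSign_mul, hpow _ (by omega), add_zero,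
          reflSign_simple, if_neg]
        intro h
        obtain ⟨a, rfl⟩ := ho
        have ha : (2 * a + 1) / 2 = a := by omega
        rw [ha] at h
        refine hr (2 * a + 1) (by omega) (by omega) ?_
        have hc := cs.simple_mul_pow_comm j i a
        have hinv : (cs.simple j * cs.simple i) ^ a = ((cs.simple i * cs.simple j) ^ a)⁻¹ := by
          rw [← inv_pow]; simp
        rw [hinv, inv_inv] at hc
        rw [hc, mul_assoc] at h
        have h2 : ((cs.simple i * cs.simple j) ^ a)⁻¹ * ((cs.simple i * cs.simple j) ^ a)⁻¹ =
            cs.simple i * cs.simple j := by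
          conv_rhs => rw [← h]
          simp
        have h3 : ∀ p q : W, p⁻¹ * p⁻¹ = q → p * q * p = 1 := by rintro p q rfl; group
        rw [show 2 * a + 1 = a + 1 + a by ring, pow_add, pow_add, pow_one]
        exact h3 _ _ h2
    rw [not_isRightDescent_iff] at hasc
    omega

/-- Every coset of a subgroup has a shortest element. -/
theorem exists_min_coset (H : Subgroup W) (x : W) :
    ∃ u ∈ H, ∀ u' ∈ H, cs.length (x * u) ≤ cs.length (x * u * u') := by
  have hne : {u | u ∈ H}.Nonempty := ⟨1, one_mem H⟩
  obtain ⟨u, hu, hmin⟩ := WellFounded.has_min (measure fun u => cs.length (x * u)).wf _ hne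
  refine ⟨u, hu, fun u' hu' => ?_⟩
  have : ¬ cs.length (x * (u * u')) < cs.length (x * u) := hmin (u * u') (mul_mem hu hu')
  rw [← mul_assoc] at this
  exact not_lt.mp this

/-- An element with two right descents `i` and `j` is the longest element of its coset of the
parabolic subgroup generated by `s_i` and `s_j`. -/
theorem length_mul_alt_of_descents {i j : B} (hM : M i j ≠ 0)
    (hord : orderOf (cs.simple i * cs.simple j) = M i j) {x : W}
    (hi : cs.IsRightDescent x i) (hj : cs.IsRightDescent x j) :
    ∃ y : W, x = y * cs.alt i j (M i j) ∧ ∀ n ≤ M i j,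
      cs.length (y * cs.alt i j n) = cs.length y + n ∧
      cs.length (y * cs.alt j i n) = cs.length y + n := by
  obtain ⟨u, hu, hmin⟩ := cs.exists_min_coset (Subgroup.closure {cs.simple i, cs.simple j}) x
  set y := x * u with hy
  have hord' : orderOf (cs.simple j * cs.simple i) = M j i := by
    rw [← M.symmetric i j, ← hord, ← orderOf_inv]
    simp
  have hmin' : ∀ u ∈ Subgroup.closure {cs.simple j, cs.simple i},
        cs.length y ≤ cs.length (y * u) := by rwa [Set.pair_comm]
  have hlen : ∀ n ≤ M i j, cs.length (y * cs.alt i j n) = cs.length y + n ∧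
      cs.length (y * cs.alt j i n) = cs.length y + n := fun n hn =>
    ⟨cs.length_mul_alt hord hmin hn,
      cs.length_mul_alt hord' hmin' (by rwa [M.symmetric j i])⟩
  refine ⟨y, ?_, hlen⟩
  obtain ⟨n, hn, h⟩ := cs.exists_alt_of_mem hM (inv_mem hu)
  have hx : x = y * u⁻¹ := by simp [hy]
  rcases hn.lt_or_eq with hlt | rfl
  · exfalso
    rw [IsRightDescent] at hi hj
    rcases h with h | h
    · rw [hx, h, mul_assoc, ← alt_succ, (hlen _ hlt).2, (hlen _ hn).1] at hj
      omega
    · rw [hx, h, mul_assoc, ← alt_succ, (hlen _ hlt).1, (hlen _ hn).2] at hi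
      omega
  · rcases h with h | h
    · rw [hx, h]
    · rw [hx, h, alt_braid]

end CoxeterSystem

/-! ### Flags, their lengths, and the rank of a tile -/

namespace Tessellation

open CoxeterSystem

/-- The Coxeter matrices of the groups `[2k, k]` with `k > 3`. -/
structure IsTess (M : CoxeterMatrix (Fin 3)) (k : ℕ) : Prop where
  m01 : M 0 1 = 2 * k
  m12 : M 1 2 = k
  m02 : M 0 2 = 2
  hk : 3 < k

theorem isTess_schlafli {k : ℕ} (hk : 3 < k) (h1 : 2 * k ≠ 1) (h2 : k ≠ 1) :
    IsTess (schlafli (2 * k) k h1 h2) k :=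
  ⟨rfl, rfl, rfl, hk⟩

section Group

variable {M : CoxeterMatrix (Fin 3)} {k : ℕ}

/-- The length of a flag: its distance from the base flag in the graph of adjacent flags. -/
abbrev len (x : M.Group) : ℕ := M.toCoxeterSystem.length x

@[simp] theorem simple_mul_self (i : Fin 3) : M.simple i * M.simple i = 1 :=
  M.toCoxeterSystem.simple_mul_simple_self i

@[simp] theorem mul_simple_cancel (x : M.Group) (i : Fin 3) :
    x * M.simple i * M.simple i = x :=
  M.toCoxeterSystem.simple_mul_simple_cancel_right i

@[simp] theorem simple_inv (i : Fin 3) : (M.simple i)⁻¹ = M.simple i :=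
  M.toCoxeterSystem.inv_simple i

/-- `Desc x i` says that crossing the flag `x` in direction `i` leads closer to the base flag. -/
abbrev Desc (x : M.Group) (i : Fin 3) : Prop := len (x * M.simple i) < len x

theorem len_step (x : M.Group) (i : Fin 3) :
    len (x * M.simple i) = len x + 1 ∨ len (x * M.simple i) + 1 = len x :=
  M.toCoxeterSystem.length_mul_simple x i

theorem desc_mul_self {x : M.Group} {i : Fin 3} :
    Desc (x * M.simple i) i ↔ ¬ Desc x i := by
  unfold Desc
  rw [mul_simple_cancel]
  rcases len_step x i with h | h <;> omega

theorem simple_comm_of_eq_two (h : M 0 2 = 2) :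
    M.simple 0 * M.simple 2 = M.simple 2 * M.simple 0 := by
  have h' := M.toCoxeterSystem.simple_mul_simple_pow 0 2
  rw [h, pow_two] at h'
  have h'' := eq_inv_of_mul_eq_one_left h'
  rwa [mul_inv_rev, M.toCoxeterSystem.inv_simple, M.toCoxeterSystem.inv_simple] at h''

/-- Homomorphisms out of a rank 3 Coxeter group, from three involutions. -/
theorem exists_lift {G : Type*} [Group G] (f : Fin 3 → G) (h : ∀ i, f i * f i = 1)
    (h01 : (f 0 * f 1) ^ M 0 1 = 1) (h12 : (f 1 * f 2) ^ M 1 2 = 1)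
    (h02 : (f 0 * f 2) ^ M 0 2 = 1) : ∃ φ : M.Group →* G, ∀ i, φ (M.simple i) = f i := by
  have hinv : ∀ i, (f i)⁻¹ = f i := fun i => inv_eq_of_mul_eq_one_right (h i)
  have hsymm : ∀ i j, (f i * f j) ^ M i j = 1 → (f j * f i) ^ M j i = 1 := by
    intro i j hij
    rw [M.symmetric j i, ← inv_inj, ← inv_pow, mul_inv_rev, hinv, hinv, hij, inv_one]
  have hlift : M.IsLiftable f := by
    intro i j
    fin_cases i <;> fin_cases j
    · simp [h]
    · exact h01
    · exact h02
    · exact hsymm 0 1 h01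
    · simp [h]
    · exact h12
    · exact hsymm 0 2 h02
    · exact hsymm 1 2 h12
    · simp [h]
  exact ⟨M.toCoxeterSystem.lift ⟨f, hlift⟩, fun i =>
    M.toCoxeterSystem.lift_apply_simple hlift i⟩

namespace IsTess

variable (hM : IsTess M k)
include hM

/-- A homomorphism to the dihedral group of order `4k` that is faithful on the tile stabilizer. It
shows that the stabilizer does not collapse, that is, tiles have `2k` edges. -/
theorem exists_hom_tile : ∃ φ : M.Group →* DihedralGroup (2 * k),
    φ (M.simple 0) = .sr 0 ∧ φ (M.simple 1) = .sr 1 := by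
  rcases Nat.even_or_odd k with he | ho
  · obtain ⟨a, rfl⟩ := he
    obtain ⟨φ, hφ⟩ := exists_lift (M := M)
      (![.sr 0, .sr 1, 1] : Fin 3 → DihedralGroup (2 * (a + a)))
      (by intro i; fin_cases i <;> simp) (by
        rw [hM.m01]; simp [DihedralGroup.r_pow]) (by
        rw [hM.m12]
        simp [← two_mul, pow_mul, pow_two]) (by rw [hM.m02]; simp [pow_two])
    exact ⟨φ, hφ 0, hφ 1⟩
  · -- for odd `k` the third reflection goes to the product of the first one with the central
    -- element
    obtain ⟨φ, hφ⟩ := exists_lift (M := M)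
      (![.sr 0, .sr 1, .sr (k : ZMod (2 * k))] : Fin 3 → DihedralGroup (2 * k))
      (by intro i; fin_cases i <;> simp) (by
        rw [hM.m01]; simp [DihedralGroup.r_pow]) (by
        rw [hM.m12]
        obtain ⟨a, rfl⟩ := ho
        simp only [Matrix.cons_val_one, Matrix.cons_val_zero, Matrix.cons_val,
          DihedralGroup.sr_mul_sr, DihedralGroup.r_pow, DihedralGroup.one_def]
        congr 1
        have : ((2 * (2 * a + 1) : ℕ) : ZMod (2 * (2 * a + 1))) = 0 := ZMod.natCast_self _
        have h2 : (((2 * a + 1 : ℕ) : ZMod (2 * (2 * a + 1))) - 1) * ((2 * a + 1 : ℕ) : ZMod _) =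
            (a : ZMod (2 * (2 * a + 1))) * ((2 * (2 * a + 1) : ℕ) : ZMod (2 * (2 * a + 1))) := by
          push_cast; ring
        rw [h2, this, mul_zero]) (by
        rw [hM.m02]
        simp only [Matrix.cons_val_zero, Matrix.cons_val,
          DihedralGroup.sr_mul_sr, DihedralGroup.r_pow, DihedralGroup.one_def]
        congr 1
        have : ((2 * k : ℕ) : ZMod (2 * k)) = 0 := ZMod.natCast_self _
        push_cast at this ⊢
        rw [sub_zero, mul_comm _ (2 : ZMod (2 * k)), this])
    exact ⟨φ, hφ 0, hφ 1⟩

/-- A homomorphism to the dihedral group of order `2k` that is faithful on the vertex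
stabilizer. -/
theorem exists_hom_vertex : ∃ φ : M.Group →* DihedralGroup k,
    φ (M.simple 0) = 1 ∧ φ (M.simple 1) = .sr 0 ∧ φ (M.simple 2) = .sr 1 := by
  obtain ⟨φ, hφ⟩ := exists_lift (M := M)
    (![1, .sr 0, .sr 1] : Fin 3 → DihedralGroup k)
    (by intro i; fin_cases i <;> simp) (by
      rw [hM.m01]; simp [pow_mul, pow_two]) (by
      rw [hM.m12]; simp [DihedralGroup.r_pow]) (by
      rw [hM.m02]; simp [pow_two])
  exact ⟨φ, hφ 0, hφ 1, hφ 2⟩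

/-- The sign of a flag that changes exactly when its vertex changes across an edge. -/
theorem exists_hom_edge : ∃ φ : M.Group →* ℤˣ,
    φ (M.simple 0) = -1 ∧ φ (M.simple 1) = 1 ∧ φ (M.simple 2) = 1 := by
  obtain ⟨φ, hφ⟩ := exists_lift (M := M) (![-1, 1, 1] : Fin 3 → ℤˣ)
    (by intro i; fin_cases i <;> simp) (by rw [hM.m01]; simp [pow_mul]) (by simp)
    (by rw [hM.m02]; simp)
  exact ⟨φ, hφ 0, hφ 1, hφ 2⟩

theorem orderOf_tile : orderOf (M.simple 0 * M.simple 1) = M 0 1 := by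
  refine Nat.dvd_antisymm (orderOf_dvd_of_pow_eq_one
    (M.toCoxeterSystem.simple_mul_simple_pow 0 1)) ?_
  obtain ⟨φ, h0, h1⟩ := hM.exists_hom_tile
  have h := orderOf_map_dvd φ (M.simple 0 * M.simple 1)
  rw [map_mul, h0, h1, DihedralGroup.sr_mul_sr, sub_zero, DihedralGroup.orderOf_r_one] at h
  rwa [hM.m01]

theorem orderOf_vertex : orderOf (M.simple 1 * M.simple 2) = M 1 2 := by
  refine Nat.dvd_antisymm (orderOf_dvd_of_pow_eq_one
    (M.toCoxeterSystem.simple_mul_simple_pow 1 2)) ?_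
  obtain ⟨φ, -, h0, h1⟩ := hM.exists_hom_vertex
  have h := orderOf_map_dvd φ (M.simple 1 * M.simple 2)
  rw [map_mul, h0, h1, DihedralGroup.sr_mul_sr, sub_zero, DihedralGroup.orderOf_r_one] at h
  rwa [hM.m12]

theorem orderOf_edge : orderOf (M.simple 0 * M.simple 2) = M 0 2 := by
  rw [hM.m02]
  refine orderOf_eq_prime ?_ ?_
  · have := M.toCoxeterSystem.simple_mul_simple_pow 0 2
    rwa [hM.m02] at this
  · intro h
    obtain ⟨φ, h0, -, h2⟩ := hM.exists_hom_edge
    have := congrArg φ h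
    rw [map_mul, h0, h2, map_one] at this
    exact absurd this (by decide)

theorem simple_comm : M.simple 0 * M.simple 2 = M.simple 2 * M.simple 0 :=
  simple_comm_of_eq_two hM.m02

theorem mul_comm02 (x : M.Group) :
    x * M.simple 0 * M.simple 2 = x * M.simple 2 * M.simple 0 := by
  rw [mul_assoc, hM.simple_comm, mul_assoc]

end IsTess

theorem orderOf_swap {i j : Fin 3} (h : orderOf (M.simple i * M.simple j) = M i j) :
    orderOf (M.simple j * M.simple i) = M j i := by
  rw [M.symmetric j i, ← h, ← orderOf_inv]
  simp

/-- Two descents generate a chain of descents, alternating between the two directions. -/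
theorem desc_chain {i j : Fin 3} (hord : orderOf (M.simple i * M.simple j) = M i j)
    (h4 : M i j ≠ 0) {x : M.Group} (hi : Desc x i) (hj : Desc x j) :
    (2 ≤ M i j → Desc (x * M.simple i) j) ∧
    (3 ≤ M i j → Desc (x * M.simple i * M.simple j) i) ∧
    (4 ≤ M i j → Desc (x * M.simple i * M.simple j * M.simple i) j) := by
  obtain ⟨y, hx, hlen⟩ := M.toCoxeterSystem.length_mul_alt_of_descents h4 hord hi hj
  have hs : ∀ (i j : Fin 3) (n : ℕ), y * M.toCoxeterSystem.alt i j (n + 1) * M.simple i =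
      y * M.toCoxeterSystem.alt j i n := by
    intro i j n
    rw [alt_succ]
    exact (by rw [mul_assoc, mul_assoc, M.toCoxeterSystem_simple, simple_mul_self, mul_one])
  have e : ∀ n, M i j = n + 1 → x * M.simple i = y * M.toCoxeterSystem.alt j i n := by
    intro n hn
    rw [hx, hn, hs]
  have hd : ∀ n, n + 1 ≤ M i j → Desc (y * M.toCoxeterSystem.alt i j (n + 1)) i ∧
      Desc (y * M.toCoxeterSystem.alt j i (n + 1)) j := by
    intro n hn
    have h1 := hlen n (by omega)
    have h2 := hlen (n + 1) hn
    constructor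
    · unfold Desc len; rw [hs]; omega
    · unfold Desc len; rw [hs]; omega
  refine ⟨fun h => ?_, fun h => ?_, fun h => ?_⟩
  · obtain ⟨n, hn⟩ : ∃ n, M i j = n + 1 + 1 := ⟨M i j - 2, by omega⟩
    rw [e _ hn]
    exact (hd n (by omega)).2
  · obtain ⟨n, hn⟩ : ∃ n, M i j = n + 1 + 1 + 1 := ⟨M i j - 3, by omega⟩
    rw [e _ hn, hs]
    exact (hd n (by omega)).1
  · obtain ⟨n, hn⟩ : ∃ n, M i j = n + 1 + 1 + 1 + 1 := ⟨M i j - 4, by omega⟩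
    rw [e _ hn, hs, hs]
    exact (hd n (by omega)).2

namespace IsTess

variable (hM : IsTess M k)
include hM

theorem desc02 {x : M.Group} (h0 : Desc x 0) (h2 : Desc x 2) : Desc (x * M.simple 0) 2 :=
  (desc_chain hM.orderOf_edge (by rw [hM.m02]; omega) h0 h2).1 (by rw [hM.m02])

/-- The directions `0` and `2` commute, so a step in direction `0` does not affect descents in
direction `2`. -/
theorem desc2_iff (x : M.Group) : Desc (x * M.simple 0) 2 ↔ Desc x 2 := by
  have key : ∀ x : M.Group, Desc x 2 → Desc (x * M.simple 0) 2 := by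
    intro x h
    by_cases h0 : Desc x 0
    · exact hM.desc02 h0 h
    · unfold Desc at *
      rw [hM.mul_comm02]
      rcases len_step x 0 with h1 | h1
      · rcases len_step (x * M.simple 2) 0 with h2 | h2 <;> omega
      · omega
  refine ⟨fun h => ?_, key x⟩
  simpa using key _ h

/-- No flag has descents `2` and `1` with a descent `0` after crossing in direction `1`: from
such a flag, the angles at a vertex and inside a tile would lead to a shorter such flag. -/
theorem no_three_old_edges (x : M.Group) (h2 : Desc x 2) (h1 : Desc x 1)
    (h0 : Desc (x * M.simple 1) 0) : False := by
  have hk := hM.hk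
  induction hn : len x using Nat.strong_induction_on generalizing x with
  | _ n ih =>
    have n12 : M 1 2 ≠ 0 := by rw [hM.m12]; omega
    obtain ⟨a1, a2, a3⟩ := desc_chain hM.orderOf_vertex n12 h1 h2
    replace a1 := a1 (by rw [hM.m12]; omega)
    replace a2 := a2 (by rw [hM.m12]; omega)
    replace a3 := a3 (by rw [hM.m12]; omega)
    -- the neighbouring flag `y = x s₁ s₂` has descents `0` and `1`
    have hy0 : Desc (x * M.simple 1 * M.simple 2) 0 :=
      (desc_chain (orderOf_swap hM.orderOf_edge) (by rw [M.symmetric, hM.m02]; omega) a1 h0).1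
        (by rw [M.symmetric, hM.m02])
    have n10 : M 1 0 = 2 * k := by rw [M.symmetric, hM.m01]
    obtain ⟨b1, b2, b3⟩ := desc_chain (orderOf_swap hM.orderOf_tile)
      (by rw [n10]; omega) a2 hy0
    replace b1 := b1 (by rw [n10]; omega)
    replace b2 := b2 (by rw [n10]; omega)
    replace b3 := b3 (by rw [n10]; omega)
    refine ih _ ?_ (x * M.simple 1 * M.simple 2 * M.simple 1 * M.simple 0)
      (hM.desc02 b1 a3) b2 b3 rfl
    unfold Desc at *
    omega

end IsTess

theorem stab_vertex : faceStabilizer M 0 = Subgroup.closure {M.simple 1, M.simple 2} := by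
  unfold faceStabilizer
  congr 1
  ext x
  simp only [Set.mem_ofPred_eq, Set.mem_insert_iff, Set.mem_singleton_iff]
  constructor
  · rintro ⟨j, hj, rfl⟩; fin_cases j <;> simp_all
  · rintro (rfl | rfl)
    · exact ⟨1, by decide, rfl⟩
    · exact ⟨2, by decide, rfl⟩

theorem stab_edge : faceStabilizer M 1 = Subgroup.closure {M.simple 0, M.simple 2} := by
  unfold faceStabilizer
  congr 1
  ext x
  simp only [Set.mem_ofPred_eq, Set.mem_insert_iff, Set.mem_singleton_iff]
  constructor
  · rintro ⟨j, hj, rfl⟩; fin_cases j <;> simp_all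
  · rintro (rfl | rfl)
    · exact ⟨0, by decide, rfl⟩
    · exact ⟨2, by decide, rfl⟩

theorem stab_tile : faceStabilizer M 2 = Subgroup.closure {M.simple 0, M.simple 1} := by
  unfold faceStabilizer
  congr 1
  ext x
  simp only [Set.mem_ofPred_eq, Set.mem_insert_iff, Set.mem_singleton_iff]
  constructor
  · rintro ⟨j, hj, rfl⟩; fin_cases j <;> simp_all
  · rintro (rfl | rfl)
    · exact ⟨0, by decide, rfl⟩
    · exact ⟨1, by decide, rfl⟩

/-- The face of dimension `i` of a flag. -/
abbrev face (i : Fin 3) (x : M.Group) : Face M i := QuotientGroup.mk x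

theorem face_mul_simple {i j : Fin 3} (h : j ≠ i) (x : M.Group) :
    face i (x * M.simple j) = face i x := by
  rw [QuotientGroup.eq]
  refine Subgroup.subset_closure ⟨j, h, ?_⟩
  simp

@[simp] theorem tile_mul0 (x : M.Group) : face 2 (x * M.simple 0) = face 2 x :=
  face_mul_simple (by decide) x
@[simp] theorem tile_mul1 (x : M.Group) : face 2 (x * M.simple 1) = face 2 x :=
  face_mul_simple (by decide) x
@[simp] theorem edge_mul0 (x : M.Group) : face 1 (x * M.simple 0) = face 1 x :=
  face_mul_simple (by decide) x
@[simp] theorem edge_mul2 (x : M.Group) : face 1 (x * M.simple 2) = face 1 x :=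
  face_mul_simple (by decide) x
@[simp] theorem vertex_mul1 (x : M.Group) : face 0 (x * M.simple 1) = face 0 x :=
  face_mul_simple (by decide) x
@[simp] theorem vertex_mul2 (x : M.Group) : face 0 (x * M.simple 2) = face 0 x :=
  face_mul_simple (by decide) x

/-- The distance of a tile from the base flag: the least length of a flag of the tile. -/
def rank (X : Tile M) : ℕ := sInf {n | ∃ x : M.Group, face 2 x = X ∧ len x = n}

theorem rank_le (x : M.Group) : rank (face 2 x) ≤ len x := Nat.sInf_le ⟨x, rfl, rfl⟩

/-- The gate of a tile: a flag of the tile closest to the base flag. -/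
theorem exists_gate (X : Tile M) : ∃ w : M.Group, face 2 w = X ∧ len w = rank X := by
  have : {n | ∃ x : M.Group, face 2 x = X ∧ len x = n}.Nonempty := by
    obtain ⟨x, rfl⟩ := QuotientGroup.mk_surjective X
    exact ⟨_, x, rfl, rfl⟩
  exact Nat.sInf_mem this

namespace IsTess

variable (hM : IsTess M k)
include hM

/-- The flags of a tile, listed in both directions from the flag `w`. -/
theorem tile_flags {w x : M.Group}
    (hx : face 2 x = face 2 w) : ∃ n ≤ 2 * k,
      x = w * M.toCoxeterSystem.alt 0 1 n ∨ x = w * M.toCoxeterSystem.alt 1 0 n := by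
  have h : w⁻¹ * x ∈ faceStabilizer M 2 := QuotientGroup.eq.mp hx.symm
  rw [stab_tile] at h
  have := M.toCoxeterSystem.exists_alt_of_mem (i := 0) (j := 1)
    (by have := hM.m01; have := hM.hk; omega) h
  obtain ⟨n, hn, h⟩ := this
  rw [hM.m01] at hn
  refine ⟨n, hn, ?_⟩
  rcases h with h | h
  · left; rw [← h]; group
  · right; rw [← h]; group

theorem len_tile_flag {w : M.Group} (hw : len w = rank (face 2 w)) {n : ℕ} (hn : n ≤ 2 * k) :
    len (w * M.toCoxeterSystem.alt 0 1 n) = len w + n ∧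
    len (w * M.toCoxeterSystem.alt 1 0 n) = len w + n := by
  have hmin : ∀ u ∈ faceStabilizer M 2, len w ≤ len (w * u) := by
    intro u hu
    rw [hw]
    have : face 2 w = face 2 (w * u) := by rw [QuotientGroup.eq]; simpa using hu
    rw [this]
    exact rank_le _
  rw [stab_tile] at hmin
  refine ⟨M.toCoxeterSystem.length_mul_alt hM.orderOf_tile hmin (by rwa [hM.m01]),
    M.toCoxeterSystem.length_mul_alt (orderOf_swap hM.orderOf_tile) ?_
      (by rwa [M.symmetric, hM.m01])⟩
  have e : ({M.simple 1, M.simple 0} : Set M.Group) = {M.simple 0, M.simple 1} :=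
    Set.pair_comm _ _
  intro u hu
  apply hmin
  rw [← e]
  exact hu

/-- The old edges of a tile, those across which one gets closer to the base flag, are the edge of
the closest flag `w` and possibly the next edge. -/
theorem old_edges {w : M.Group} (hw : len w = rank (face 2 w)) {x : M.Group}
    (hx : face 2 x = face 2 w) (h2 : Desc x 2) :
    x = w ∨ x = w * M.simple 0 ∨ x = w * M.simple 1 ∨ x = w * M.simple 1 * M.simple 0 := by
  obtain ⟨n, hn, h⟩ := hM.tile_flags hx
  have e0 : ∀ n, M.toCoxeterSystem.alt 0 1 (n + 1) =
    M.toCoxeterSystem.alt 1 0 n * M.simple 0 := fun n => rfl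
  have e1 : ∀ n, M.toCoxeterSystem.alt 1 0 (n + 1) =
    M.toCoxeterSystem.alt 0 1 n * M.simple 1 := fun n => rfl
  -- a flag at distance at least two that ends with a step in direction `1` is not old
  have key : ∀ n, n + 2 ≤ 2 * k → ¬ Desc (w * M.toCoxeterSystem.alt 1 0 (n + 2)) 2 := by
    intro n hn hd
    have l0 := hM.len_tile_flag hw (n := n) (by omega)
    have l1 := hM.len_tile_flag hw (n := n + 1) (by omega)
    have l2 := hM.len_tile_flag hw (n := n + 2) (by omega)
    refine hM.no_three_old_edges _ hd ?_ ?_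
    · unfold Desc
      rw [e1 (n + 1), ← mul_assoc, mul_simple_cancel]
      rw [e1 (n + 1), ← mul_assoc] at l2
      omega
    · unfold Desc
      rw [e1 (n + 1), ← mul_assoc, mul_simple_cancel, e0 n, ← mul_assoc, mul_simple_cancel]
      rw [e0 n, ← mul_assoc] at l1
      omega
  rcases h with rfl | rfl
  · rcases n with _ | _ | _ | n
    · left; simp
    · right; left; rw [e0]; simp
    · right; right; right; rw [e0, e1]; simp [mul_assoc]
    · exfalso
      rw [e0, ← mul_assoc, hM.desc2_iff] at h2
      exact key n (by omega) h2
  · rcases n with _ | _ | n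
    · left; simp
    · right; right; left; rw [e1]; simp
    · exact absurd h2 (key n hn)

/-- Crossing an old edge leads to a tile of smaller rank, not only to a shorter flag. -/
theorem rank_lt_of_desc {x : M.Group} (h2 : Desc x 2) :
    rank (face 2 (x * M.simple 2)) < rank (face 2 x) := by
  obtain ⟨w, hw, hl⟩ := exists_gate (face 2 x)
  have hx : face 2 x = face 2 w := hw.symm
  rw [← hw] at hl
  have h1 := hM.len_tile_flag hl (n := 1) (by have := hM.hk; omega)
  have hw1 : len (w * M.simple 1) = len w + 1 := by
    have := h1.2
    rwa [alt_succ, alt_zero, one_mul] at this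
  have caseW : Desc w 2 → rank (face 2 (w * M.simple 2)) < rank (face 2 w) := fun h =>
    lt_of_le_of_lt (rank_le _) (by rw [← hl]; exact h)
  have case1 : Desc (w * M.simple 1) 2 →
      rank (face 2 (w * M.simple 1 * M.simple 2)) < rank (face 2 w) := by
    intro h
    have d1 : Desc (w * M.simple 1) 1 := by unfold Desc; rw [mul_simple_cancel]; omega
    rw [← tile_mul1]
    refine lt_of_le_of_lt (rank_le _) ?_
    rw [← hl]
    have d2 := (desc_chain (orderOf_swap hM.orderOf_vertex)
      (by rw [M.symmetric, hM.m12]; have := hM.hk; omega) h d1).1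
      (by rw [M.symmetric, hM.m12]; have := hM.hk; omega)
    unfold Desc at *
    omega
  rw [hx]
  rcases hM.old_edges hl hx h2 with rfl | rfl | rfl | rfl
  · exact caseW h2
  · rw [hM.mul_comm02, tile_mul0]
    exact caseW ((hM.desc2_iff _).mp h2)
  · exact case1 h2
  · rw [hM.mul_comm02, tile_mul0]
    exact case1 ((hM.desc2_iff _).mp h2)

theorem desc_iff_rank (x : M.Group) :
    Desc x 2 ↔ rank (face 2 (x * M.simple 2)) < rank (face 2 x) := by
  refine ⟨hM.rank_lt_of_desc, fun h => ?_⟩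
  by_contra hd
  have := hM.rank_lt_of_desc (desc_mul_self.mpr hd)
  rw [mul_simple_cancel] at this
  omega

theorem rank_ne (x : M.Group) : rank (face 2 (x * M.simple 2)) ≠ rank (face 2 x) := by
  by_cases hd : Desc x 2
  · exact (hM.rank_lt_of_desc hd).ne
  · have := hM.rank_lt_of_desc (desc_mul_self.mpr hd)
    rw [mul_simple_cancel] at this
    exact this.ne'

/-- The flags of a vertex, listed in both directions from its shortest flag `x`. -/
theorem vertex_flags {x : M.Group} (h1 : ¬ Desc x 1) (h2 : ¬ Desc x 2) {y : M.Group}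
    (hy : face 0 y = face 0 x) : ∃ n ≤ k,
      (y = x * M.toCoxeterSystem.alt 1 2 n ∨ y = x * M.toCoxeterSystem.alt 2 1 n) ∧
      ∀ n ≤ k, len (x * M.toCoxeterSystem.alt 1 2 n) = len x + n ∧
        len (x * M.toCoxeterSystem.alt 2 1 n) = len x + n := by
  have hk := hM.hk
  have n12 : M 1 2 ≠ 0 := by rw [hM.m12]; omega
  obtain ⟨u, hu, hmin⟩ := M.toCoxeterSystem.exists_min_coset
    (Subgroup.closure {M.simple 1, M.simple 2}) x
  set z := x * u with hz
  have hlen : ∀ n ≤ k, len (z * M.toCoxeterSystem.alt 1 2 n) = len z + n ∧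
        len (z * M.toCoxeterSystem.alt 2 1 n) = len z + n := by
    intro n hn
    refine ⟨M.toCoxeterSystem.length_mul_alt hM.orderOf_vertex hmin (by rwa [hM.m12]),
      M.toCoxeterSystem.length_mul_alt (orderOf_swap hM.orderOf_vertex) ?_
      (by rwa [M.symmetric, hM.m12])⟩
    have e : ({M.simple 2, M.simple 1} : Set M.Group) = {M.simple 1, M.simple 2} :=
      Set.pair_comm _ _
    intro u hu
    apply hmin
    rw [← e]
    exact hu
  -- the shortest flag of the vertex is the only one without descents `1`, `2`
  have hxz : x = z := by
    obtain ⟨n, hn, h⟩ := M.toCoxeterSystem.exists_alt_of_mem n12 (inv_mem hu)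
    have hx : x = z * u⁻¹ := by simp [hz]
    rcases n with _ | n
    · have hu1 : u⁻¹ = 1 := by simpa using h
      rw [hx, hu1, mul_one]
    · exfalso
      rw [hM.m12] at hn
      have l0 := hlen n (by omega)
      have l1 := hlen _ hn
      rcases h with h | h
      · apply h1
        unfold Desc
        rw [h] at hx
        rw [hx, l1.1]
        have e : z * M.toCoxeterSystem.alt 1 2 (n + 1) * M.simple 1 =
          z * M.toCoxeterSystem.alt 2 1 n := by
            rw [alt_succ, M.toCoxeterSystem_simple, ← mul_assoc, mul_simple_cancel]
        rw [e]
        omega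
      · apply h2
        unfold Desc
        rw [h] at hx
        rw [hx, l1.2]
        have e : z * M.toCoxeterSystem.alt 2 1 (n + 1) * M.simple 2 =
          z * M.toCoxeterSystem.alt 1 2 n := by
            rw [alt_succ, M.toCoxeterSystem_simple, ← mul_assoc, mul_simple_cancel]
        rw [e]
        omega
  rw [← hxz] at hlen
  have h : x⁻¹ * y ∈ faceStabilizer M 0 := QuotientGroup.eq.mp hy.symm
  rw [stab_vertex] at h
  obtain ⟨n, hn, h⟩ := M.toCoxeterSystem.exists_alt_of_mem n12 h
  rw [hM.m12] at hn
  refine ⟨n, hn, ?_, hlen⟩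
  rcases h with h | h
  · left; rw [← h]; group
  · right; rw [← h]; group

/-- At a vertex whose two edges on a tile are both new, all other tiles are further away. -/
theorem rank_lt_at_vertex {x : M.Group} (h2 : ¬ Desc x 2) (h2' : ¬ Desc (x * M.simple 1) 2)
    {y : M.Group} (hy : face 0 y = face 0 x) (hne : y ≠ x) (hne1 : y ≠ x * M.simple 1) :
    rank (face 2 x) < rank (face 2 y) := by
  wlog h1 : ¬ Desc x 1 generalizing x
  · have := this (x := x * M.simple 1) h2' (by simpa using h2) (by simpa using hy) hne1
      (by simpa using hne) (by rw [desc_mul_self, not_not]; simpa using h1)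
    simpa using this
  induction hn : len y using Nat.strong_induction_on generalizing y with
  | _ n ih =>
    obtain ⟨m, hm, h, hlen⟩ := hM.vertex_flags h1 h2 hy
    rcases m with _ | m
    · simp at h; exact absurd h hne
    have l0 := hlen m (by omega)
    have l1 := hlen _ hm
    rcases h with h | h
    · have e : y * M.simple 1 = x * M.toCoxeterSystem.alt 2 1 m := by
        rw [h, alt_succ, M.toCoxeterSystem_simple, ← mul_assoc, mul_simple_cancel]
      have := ih (len (y * M.simple 1)) (by rw [← hn, e, h]; omega) (y := y * M.simple 1)
        (by simpa using hy) (fun h => hne1 (by rw [← h]; simp))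
        (fun h => hne (by simpa using congrArg (· * M.simple 1) h)) rfl
      simpa using this
    · have e : y * M.simple 2 = x * M.toCoxeterSystem.alt 1 2 m := by
        rw [h, alt_succ, M.toCoxeterSystem_simple, ← mul_assoc, mul_simple_cancel]
      have hd : Desc y 2 := by unfold Desc; rw [e, h]; omega
      refine lt_of_le_of_lt ?_ (hM.rank_lt_of_desc hd)
      by_cases c0 : y * M.simple 2 = x
      · rw [c0]
      by_cases c1 : y * M.simple 2 = x * M.simple 1
      · rw [c1, tile_mul1]
      exact (ih (len (y * M.simple 2)) (by rw [← hn]; exact hd) (y := y * M.simple 2)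
        (by simpa using hy) c0 c1 rfl).le

/-- The new edges of a tile form a chain of edges around it, consecutive ones meeting at new
vertices. -/
theorem new_edges_connected {P : M.Group → Prop} (h0 : ∀ x, P x ↔ P (x * M.simple 0))
    (h1 : ∀ x, ¬ Desc x 2 → ¬ Desc (x * M.simple 1) 2 → (P x ↔ P (x * M.simple 1)))
    {x y : M.Group} (hxy : face 2 x = face 2 y) (hx : ¬ Desc x 2) (hy : ¬ Desc y 2) :
    P x ↔ P y := by
  obtain ⟨w, hw, hl⟩ := exists_gate (face 2 x)
  rw [← hw] at hl
  have hk := hM.hk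
  have e0 : ∀ n, w * M.toCoxeterSystem.alt 0 1 (n + 1) =
    w * M.toCoxeterSystem.alt 1 0 n * M.simple 0 := fun n => by
      rw [alt_succ, M.toCoxeterSystem_simple, mul_assoc]
  have e1 : ∀ n, w * M.toCoxeterSystem.alt 1 0 (n + 1) =
    w * M.toCoxeterSystem.alt 0 1 n * M.simple 1 := fun n => by
      rw [alt_succ, M.toCoxeterSystem_simple, mul_assoc]
  have hend : M.toCoxeterSystem.alt 0 1 (2 * k) = M.toCoxeterSystem.alt 1 0 (2 * k) := by
    rw [← hM.m01, alt_braid]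
  -- walk from each new flag away from `w`, to the opposite flag
  have walk : ∀ d n, n + d = 2 * k →
      (¬ Desc (w * M.toCoxeterSystem.alt 0 1 n) 2 → (P (w * M.toCoxeterSystem.alt 0 1 n) ↔
        P (w * M.toCoxeterSystem.alt 0 1 (2 * k)))) ∧
      (¬ Desc (w * M.toCoxeterSystem.alt 1 0 n) 2 → (P (w * M.toCoxeterSystem.alt 1 0 n) ↔
        P (w * M.toCoxeterSystem.alt 0 1 (2 * k)))) := by
    intro d
    induction d with
    | zero =>
      intro n hn
      obtain rfl : n = 2 * k := by omega
      rw [hend]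
      exact ⟨fun _ => Iff.rfl, fun _ => Iff.rfl⟩
    | succ d ih =>
      intro n hn
      obtain ⟨i0, i1⟩ := ih (n + 1) (by omega)
      have l0 := hM.len_tile_flag hl (n := n) (by omega)
      have l1 := hM.len_tile_flag hl (n := n + 1) (by omega)
      constructor
      · intro hd
        have hd' : ¬ Desc (w * M.toCoxeterSystem.alt 0 1 n * M.simple 1) 2 := by
          intro h
          apply hd
          have d1 : Desc (w * M.toCoxeterSystem.alt 0 1 n * M.simple 1) 1 := by
            unfold Desc
            rw [mul_simple_cancel, ← e1]
            omega
          have := (desc_chain hM.orderOf_vertex (by rw [hM.m12]; omega) d1 h).1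
            (by rw [hM.m12]; omega)
          rwa [mul_simple_cancel] at this
        rw [h1 _ hd hd', ← e1]
        rw [← e1] at hd'
        exact i1 hd'
      · intro hd
        rw [h0, ← e0]
        apply i0
        rw [e0, hM.desc2_iff]
        exact hd
  have all : ∀ z, face 2 z = face 2 x → ¬ Desc z 2 →
      (P z ↔ P (w * M.toCoxeterSystem.alt 0 1 (2 * k))) := by
    intro z hz hd
    obtain ⟨n, hn, h⟩ := hM.tile_flags (hz.trans hw.symm)
    obtain ⟨i0, i1⟩ := walk (2 * k - n) n (by omega)
    rcases h with rfl | rfl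
    · exact i0 hd
    · exact i1 hd
  rw [all x rfl hx, all y hxy.symm hy]

end IsTess

theorem finite_rank_le (n : ℕ) : {X : Tile M | rank X ≤ n}.Finite := by
  have h1 : {l : List (Fin 3) | l.length ≤ n}.Finite := List.finite_length_le _ _
  refine (h1.image fun l => face 2 (M.toCoxeterSystem.wordProd l)).subset ?_
  intro X hX
  obtain ⟨w, rfl, hw⟩ := exists_gate X
  obtain ⟨l, hl, rfl⟩ := M.toCoxeterSystem.exists_isReduced w
  refine ⟨l, ?_, rfl⟩
  have : rank (face 2 (M.toCoxeterSystem.wordProd l)) ≤ n := hX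
  rw [← hw] at this
  rw [Set.mem_ofPred_eq, ← hl.eq]
  exact this

theorem gate_desc {w : M.Group} (hl : len w = rank (face 2 w)) (hne : face 2 w ≠ face 2 1) :
    Desc w 2 := by
  have hw1 : w ≠ 1 := by rintro rfl; exact hne rfl
  obtain ⟨i, hi⟩ := M.toCoxeterSystem.exists_rightDescent_of_ne_one hw1
  have h : ∀ i, i ≠ 2 → ¬ Desc w i := by
    intro i hi h
    have h3 : face 2 (w * M.simple i) = face 2 w := face_mul_simple hi w
    have := rank_le (w * M.simple i)
    rw [h3, ← hl] at this
    unfold Desc at h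
    omega
  by_cases h2 : i = 2
  · subst h2; exact hi
  · exact absurd hi (h i h2)

theorem rank_eq_zero_iff (X : Tile M) : rank X = 0 ↔ X = face 2 1 := by
  constructor
  · intro h
    obtain ⟨w, rfl, hl⟩ := exists_gate X
    rw [h] at hl
    rw [M.toCoxeterSystem.length_eq_zero_iff.mp hl]
  · rintro rfl
    have := rank_le (1 : M.Group)
    rw [len, length_one] at this
    omega

end Group

end Tessellation

/-! ### Incidence of vertices, edges and tiles -/

namespace Tessellation

open CoxeterSystem

variable {M : CoxeterMatrix (Fin 3)} {k : ℕ}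

theorem exists_zpow_of_mem {i j : Fin 3} {u : M.Group}
    (hu : u ∈ Subgroup.closure {M.simple i, M.simple j}) :
    ∃ n : ℤ, u = (M.simple i * M.simple j) ^ n ∨ u = (M.simple i * M.simple j) ^ n * M.simple i := by
  have step : ∀ u : M.Group, (∃ n : ℤ, u = (M.simple i * M.simple j) ^ n ∨
        u = (M.simple i * M.simple j) ^ n * M.simple i) →
      (∃ n : ℤ, u * M.simple i = (M.simple i * M.simple j) ^ n ∨
        u * M.simple i = (M.simple i * M.simple j) ^ n * M.simple i) ∧
      (∃ n : ℤ, u * M.simple j = (M.simple i * M.simple j) ^ n ∨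
        u * M.simple j = (M.simple i * M.simple j) ^ n * M.simple i) := by
    rintro u ⟨n, rfl | rfl⟩
    · refine ⟨⟨n, Or.inr rfl⟩, ⟨n - 1, Or.inr ?_⟩⟩
      rw [zpow_sub_one, mul_inv_rev]
      simp [mul_assoc]
    · refine ⟨⟨n, Or.inl (by simp)⟩, ⟨n + 1, Or.inl ?_⟩⟩
      rw [zpow_add_one, mul_assoc]
  induction hu using Subgroup.closure_induction_right with
  | one => exact ⟨0, by simp⟩
  | mul_right x hx y hy ih =>
    rcases hy with rfl | rfl
    · exact (step x ih).1
    · exact (step x ih).2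
  | mul_inv_cancel x hx y hy ih =>
    rcases hy with rfl | rfl
    · simpa using (step x ih).1
    · simpa using (step x ih).2

theorem exists_nat_pow {G : Type*} [Group G] {r : G} (h : 0 < orderOf r) (n : ℤ) :
    ∃ m < orderOf r, r ^ n = r ^ m := by
  refine ⟨(n % (orderOf r : ℤ)).toNat, ?_, ?_⟩
  · have := Int.emod_lt_of_pos n (b := (orderOf r : ℤ)) (by exact_mod_cast h)
    have := Int.emod_nonneg n (b := (orderOf r : ℤ)) (by omega)
    omega
  · rw [← zpow_natCast, Int.toNat_of_nonneg (Int.emod_nonneg n (by omega)), zpow_mod_orderOf]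

/-- The rotation by one step around a tile. -/
abbrev rotTile (M : CoxeterMatrix (Fin 3)) : M.Group := M.simple 0 * M.simple 1

/-- The rotation by one step around a vertex. -/
abbrev rotVertex (M : CoxeterMatrix (Fin 3)) : M.Group := M.simple 1 * M.simple 2

namespace IsTess

variable (hM : IsTess M k)
include hM

theorem pos : 0 < k := by have := hM.hk; omega

theorem orderOf_rotTile : orderOf (rotTile M) = 2 * k := by rw [hM.orderOf_tile, hM.m01]

theorem orderOf_rotVertex : orderOf (rotVertex M) = k := by rw [hM.orderOf_vertex, hM.m12]

theorem same_tile {x y : M.Group} (h : face 2 y = face 2 x) :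
    ∃ n < 2 * k, y = x * rotTile M ^ n ∨ y = x * rotTile M ^ n * M.simple 0 := by
  have h : x⁻¹ * y ∈ faceStabilizer M 2 := QuotientGroup.eq.mp h.symm
  rw [stab_tile] at h
  obtain ⟨n, hn⟩ := exists_zpow_of_mem h
  obtain ⟨m, hm, he⟩ := exists_nat_pow (r := rotTile M)
    (by rw [hM.orderOf_rotTile]; have := hM.pos; omega) n
  rw [hM.orderOf_rotTile] at hm
  rw [he] at hn
  refine ⟨m, hm, ?_⟩
  rcases hn with hn | hn
  · left; rw [← hn]; group
  · right; rw [mul_assoc, ← hn]; group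

theorem same_vertex {x y : M.Group} (h : face 0 y = face 0 x) :
    ∃ n < k, y = x * rotVertex M ^ n ∨ y = x * rotVertex M ^ n * M.simple 1 := by
  have h : x⁻¹ * y ∈ faceStabilizer M 0 := QuotientGroup.eq.mp h.symm
  rw [stab_vertex] at h
  obtain ⟨n, hn⟩ := exists_zpow_of_mem h
  obtain ⟨m, hm, he⟩ := exists_nat_pow (r := rotVertex M)
    (by rw [hM.orderOf_rotVertex]; exact hM.pos) n
  rw [hM.orderOf_rotVertex] at hm
  rw [he] at hn
  refine ⟨m, hm, ?_⟩
  rcases hn with hn | hn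
  · left; rw [← hn]; group
  · right; rw [mul_assoc, ← hn]; group

theorem same_edge {x y : M.Group} (h : face 1 y = face 1 x) :
    y = x ∨ y = x * M.simple 0 ∨ y = x * M.simple 2 ∨ y = x * M.simple 0 * M.simple 2 := by
  have h : x⁻¹ * y ∈ faceStabilizer M 1 := QuotientGroup.eq.mp h.symm
  rw [stab_edge] at h
  obtain ⟨n, hn⟩ := exists_zpow_of_mem h
  have ho : orderOf (M.simple 0 * M.simple 2) = 2 := by rw [hM.orderOf_edge, hM.m02]
  obtain ⟨m, hm, he⟩ := exists_nat_pow (r := M.simple 0 * M.simple 2) (by rw [ho]; omega) n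
  rw [ho] at hm
  rw [he] at hn
  have e : ∀ z, x⁻¹ * y = z → y = x * z := by rintro z rfl; group
  rcases hn with hn | hn
  · interval_cases m
    · left; simpa using e _ hn
    · right; right; right; simpa [mul_assoc] using e _ hn
  · interval_cases m
    · right; left; simpa using e _ hn
    · right; right; left
      rw [e _ hn, pow_one, hM.simple_comm, mul_simple_cancel]

theorem rotVertex_pow_ne (n : ℕ) : rotVertex M ^ n ≠ M.simple 1 := by
  intro h
  obtain ⟨φ, -, h1, h2⟩ := hM.exists_hom_vertex
  have := congrArg φ h
  rw [map_pow, map_mul, h1, h2, DihedralGroup.sr_mul_sr, DihedralGroup.r_pow] at this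
  exact absurd this (by simp)

theorem rotTile_pow_ne (n : ℕ) : rotTile M ^ n ≠ M.simple 0 ∧ rotTile M ^ n ≠ M.simple 1 := by
  obtain ⟨φ, h0, h1⟩ := hM.exists_hom_tile
  constructor <;>
  · intro h
    have := congrArg φ h
    rw [map_pow, map_mul, h0, h1, DihedralGroup.sr_mul_sr, DihedralGroup.r_pow] at this
    exact absurd this (by simp)

/-- The two sides of an edge are different tiles. -/
theorem tile_ne (x : M.Group) : face 2 (x * M.simple 2) ≠ face 2 x := fun h =>
  hM.rank_ne x (congrArg rank h)

/-- The two ends of an edge are different vertices. -/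
theorem vertex_ne (x : M.Group) : face 0 (x * M.simple 0) ≠ face 0 x := by
  intro h
  have h : x⁻¹ * (x * M.simple 0) ∈ faceStabilizer M 0 := QuotientGroup.eq.mp h.symm
  rw [stab_vertex, inv_mul_cancel_left] at h
  obtain ⟨φ, h0, h1, h2⟩ := hM.exists_hom_edge
  have key : ∀ u ∈ Subgroup.closure {M.simple 1, M.simple 2}, φ u = 1 := by
    intro u hu
    have : Subgroup.closure {M.simple 1, M.simple 2} ≤ φ.ker := by
      rw [Subgroup.closure_le]
      rintro z (rfl | rfl)
      · exact h1
      · exact h2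
    exact this hu
  have := key _ h
  rw [h0] at this
  exact absurd this (by decide)

/-- Two flags with the same vertex and tile differ at most in their edge. -/
theorem same_vertex_tile {x y : M.Group} (hv : face 0 y = face 0 x) (ht : face 2 y = face 2 x) :
    y = x ∨ y = x * M.simple 1 := by
  obtain ⟨φ, h0, h1, h2⟩ := hM.exists_hom_vertex
  have hφ : φ (x⁻¹ * y) = 1 ∨ φ (x⁻¹ * y) = .sr 0 := by
    have h : x⁻¹ * y ∈ faceStabilizer M 2 := QuotientGroup.eq.mp ht.symm
    rw [stab_tile] at h
    generalize x⁻¹ * y = u at h ⊢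
    induction h using Subgroup.closure_induction_right with
    | one => left; simp
    | mul_right x hx y hy ih =>
      rcases hy with rfl | rfl
      · simpa [h0] using ih
      · rw [map_mul, h1]; rcases ih with ih | ih <;> rw [ih] <;> simp
    | mul_inv_cancel x hx y hy ih =>
      rcases hy with rfl | rfl
      · simpa [h0] using ih
      · rw [map_mul, simple_inv, h1]
        rcases ih with ih | ih <;> rw [ih] <;> simp
  obtain ⟨n, hn, h⟩ := hM.same_vertex hv
  have hz : φ (rotVertex M ^ n) = .r n := by
    rw [map_pow, map_mul, h1, h2, DihedralGroup.sr_mul_sr, DihedralGroup.r_pow]; simp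
  have hn0 : ((n : ℕ) : ZMod k) = 0 → n = 0 := by
    intro h
    rw [ZMod.natCast_eq_zero_iff] at h
    exact Nat.eq_zero_of_dvd_of_lt h hn
  rcases h with rfl | rfl
  · left
    rw [inv_mul_cancel_left, hz] at hφ
    rcases hφ with h | h
    · rw [DihedralGroup.one_def] at h
      rw [hn0 (DihedralGroup.r.inj h)]; simp
    · exact absurd h (by simp)
  · right
    rw [mul_assoc, inv_mul_cancel_left, map_mul, hz, h1] at hφ
    rcases hφ with h | h
    · rw [DihedralGroup.one_def, DihedralGroup.r_mul_sr] at h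
      cases h
    · rw [DihedralGroup.r_mul_sr, zero_sub] at h
      have := DihedralGroup.sr.inj h
      rw [hn0 (neg_eq_zero.mp this)]; simp

/-- Two flags with the same edge and tile differ at most in their vertex. -/
theorem same_edge_tile {x y : M.Group} (he : face 1 y = face 1 x) (ht : face 2 y = face 2 x) :
    y = x ∨ y = x * M.simple 0 := by
  rcases hM.same_edge he with h | h | h | h
  · exact Or.inl h
  · exact Or.inr h
  · rw [h] at ht; exact absurd ht (hM.tile_ne x)
  · rw [h] at ht
    have := hM.tile_ne (x * M.simple 0)
    rw [tile_mul0] at this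
    exact absurd ht this

theorem adj_iff {X Y : Tile M} :
    (tileGraph M).Adj X Y ↔ ∃ x : M.Group, face 2 x = X ∧ face 2 (x * M.simple 2) = Y := by
  constructor
  · rintro ⟨hne, e, ⟨x, hx, hxe⟩, ⟨y, hy, hye⟩⟩
    refine ⟨x, hx, ?_⟩
    rcases hM.same_edge (hye.trans hxe.symm) with h | h | h | h
    · subst h; exact absurd (hx.symm.trans hy) hne
    · subst h; rw [← hy] at hne; exact absurd (hx.symm.trans (tile_mul0 x).symm) hne
    · rw [← hy, h]
    · rw [← hy, h, hM.mul_comm02]; exact (tile_mul0 _).symm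
  · rintro ⟨x, rfl, rfl⟩
    exact ⟨(hM.tile_ne x).symm, face 1 x, ⟨x, rfl, rfl⟩, ⟨x * M.simple 2, rfl, edge_mul2 x⟩⟩

theorem adj_cross (x : M.Group) : (tileGraph M).Adj (face 2 x) (face 2 (x * M.simple 2)) :=
  hM.adj_iff.mpr ⟨x, rfl, rfl⟩

end IsTess

/-- The vertices of a tile. -/
def verts (X : Tile M) : Set (Vertex M) := {v | Incident X v}

/-- The edges of a tile. -/
def edges (X : Tile M) : Set (Edge M) := {e | Incident X e}

theorem mem_verts {X : Tile M} {v : Vertex M} :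
    v ∈ verts X ↔ ∃ x : M.Group, face 2 x = X ∧ face 0 x = v := Iff.rfl

theorem mem_edges {X : Tile M} {e : Edge M} :
    e ∈ edges X ↔ ∃ x : M.Group, face 2 x = X ∧ face 1 x = e := Iff.rfl

theorem ncard_of_range {α : Type*} {n : ℕ} {f : ℕ → α} {S : Set α}
    (hS : ∀ a, a ∈ S ↔ ∃ i < n, f i = a) (hf : ∀ i < n, ∀ j < n, f i = f j → i = j) :
    S.ncard = n := by
  have : S = f '' (Finset.range n : Set ℕ) := by
    ext a
    rw [hS]
    simp
  rw [this, Set.InjOn.ncard_image, Set.ncard_coe_finset, Finset.card_range]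
  intro i hi j hj h
  exact hf i (by simpa using hi) j (by simpa using hj) h

theorem vertex_rot (x : M.Group) (n : ℕ) : face 0 (x * rotVertex M ^ n) = face 0 x := by
  induction n with
  | zero => simp
  | succ n ih => rw [pow_succ, ← mul_assoc, ← mul_assoc, vertex_mul2, vertex_mul1, ih]

namespace IsTess

variable (hM : IsTess M k)
include hM

theorem ncard_verts (X : Tile M) : (verts X).ncard = 2 * k := by
  obtain ⟨x, rfl⟩ := QuotientGroup.mk_surjective X
  have hrot : ∀ n, face 2 (x * rotTile M ^ n) = face 2 x := by
    intro n
    induction n with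
    | zero => simp
    | succ n ih => rw [pow_succ, ← mul_assoc, ← mul_assoc, tile_mul1, tile_mul0, ih]
  refine ncard_of_range (f := fun n => face 0 (x * rotTile M ^ n)) ?_ ?_
  · intro v
    rw [mem_verts]
    constructor
    · rintro ⟨y, hy, rfl⟩
      obtain ⟨n, hn, rfl | rfl⟩ := hM.same_tile hy
      · exact ⟨n, hn, rfl⟩
      · have e : face 0 (x * rotTile M ^ n * M.simple 0) = face 0 (x * rotTile M ^ (n + 1)) := by
          rw [pow_succ, ← mul_assoc, ← mul_assoc, vertex_mul1]
        rw [e]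
        rcases Nat.lt_or_ge (n + 1) (2 * k) with h | h
        · exact ⟨n + 1, h, rfl⟩
        · refine ⟨0, by have := hM.pos; omega, ?_⟩
          obtain h : n + 1 = 2 * k := by omega
          have h2 : rotTile M ^ (2 * k) = 1 := by rw [← hM.orderOf_rotTile, pow_orderOf_eq_one]
          simp only [h, h2, pow_zero]
    · rintro ⟨n, hn, rfl⟩
      exact ⟨_, hrot n, rfl⟩
  · have key : ∀ i j, i ≤ j → j < 2 * k →
        face 0 (x * rotTile M ^ i) = face 0 (x * rotTile M ^ j) → i = j := by
      intro i j hij hj h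
      have := hM.same_vertex_tile h.symm ((hrot j).trans (hrot i).symm)
      obtain ⟨d, rfl⟩ := Nat.exists_eq_add_of_le hij
      rw [pow_add, ← mul_assoc] at this
      rcases this with h | h
      · have h1 : rotTile M ^ d = 1 := by simpa using h
        have := orderOf_dvd_of_pow_eq_one h1
        rw [hM.orderOf_rotTile] at this
        have := Nat.eq_zero_of_dvd_of_lt this (by omega)
        omega
      · exact absurd (mul_left_cancel h) (hM.rotTile_pow_ne d).2
    intro i hi j hj h
    rcases le_total i j with hij | hij
    · exact key i j hij hj h
    · exact (key j i hij hi h.symm).symm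

theorem ncard_edges (X : Tile M) : (edges X).ncard = 2 * k := by
  obtain ⟨x, rfl⟩ := QuotientGroup.mk_surjective X
  have hrot : ∀ n, face 2 (x * rotTile M ^ n) = face 2 x := by
    intro n
    induction n with
    | zero => simp
    | succ n ih => rw [pow_succ, ← mul_assoc, ← mul_assoc, tile_mul1, tile_mul0, ih]
  refine ncard_of_range (f := fun n => face 1 (x * rotTile M ^ n)) ?_ ?_
  · intro v
    rw [mem_edges]
    constructor
    · rintro ⟨y, hy, rfl⟩
      obtain ⟨n, hn, rfl | rfl⟩ := hM.same_tile hy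
      · exact ⟨n, hn, rfl⟩
      · exact ⟨n, hn, (edge_mul0 _).symm⟩
    · rintro ⟨n, hn, rfl⟩
      exact ⟨_, hrot n, rfl⟩
  · have key : ∀ i j, i ≤ j → j < 2 * k →
        face 1 (x * rotTile M ^ i) = face 1 (x * rotTile M ^ j) → i = j := by
      intro i j hij hj h
      have := hM.same_edge_tile h.symm ((hrot j).trans (hrot i).symm)
      obtain ⟨d, rfl⟩ := Nat.exists_eq_add_of_le hij
      rw [pow_add, ← mul_assoc] at this
      rcases this with h | h
      · have h1 : rotTile M ^ d = 1 := by simpa using h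
        have := orderOf_dvd_of_pow_eq_one h1
        rw [hM.orderOf_rotTile] at this
        have := Nat.eq_zero_of_dvd_of_lt this (by omega)
        omega
      · exact absurd (mul_left_cancel h) (hM.rotTile_pow_ne d).1
    intro i hi j hj h
    rcases le_total i j with hij | hij
    · exact key i j hij hj h
    · exact (key j i hij hi h.symm).symm

theorem rot_inj (x : M.Group) {i j : ℕ} (hi : i < k) (hj : j < k)
    (h : face 2 (x * rotVertex M ^ i) = face 2 (x * rotVertex M ^ j)) : i = j := by
  have key : ∀ i j, i ≤ j → j < k →
      face 2 (x * rotVertex M ^ i) = face 2 (x * rotVertex M ^ j) → i = j := by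
    intro i j hij hj h
    have := hM.same_vertex_tile ((vertex_rot x j).trans (vertex_rot x i).symm) h.symm
    obtain ⟨d, rfl⟩ := Nat.exists_eq_add_of_le hij
    rw [pow_add, ← mul_assoc] at this
    rcases this with h | h
    · have h1 : rotVertex M ^ d = 1 := by simpa using h
      have := orderOf_dvd_of_pow_eq_one h1
      rw [hM.orderOf_rotVertex] at this
      have := Nat.eq_zero_of_dvd_of_lt this (by omega)
      omega
    · exact absurd (mul_left_cancel h) (hM.rotVertex_pow_ne d)
  rcases le_total i j with hij | hij
  · exact key i j hij hj h
  · exact (key j i hij hi h.symm).symm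

/-- The tiles at a vertex are obtained by rotating a flag around it. -/
theorem mem_verts_iff_rot {x : M.Group} {X : Tile M} :
    face 0 x ∈ verts X ↔ ∃ n < k, face 2 (x * rotVertex M ^ n) = X := by
  constructor
  · rintro ⟨y, rfl, hy⟩
    obtain ⟨n, hn, rfl | rfl⟩ := hM.same_vertex hy
    · exact ⟨n, hn, rfl⟩
    · exact ⟨n, hn, (tile_mul1 _).symm⟩
  · rintro ⟨n, hn, rfl⟩
    exact ⟨_, rfl, vertex_rot x n⟩

theorem ncard_tiles_at (v : Vertex M) : {X : Tile M | v ∈ verts X}.ncard = k := by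
  obtain ⟨x, rfl⟩ := QuotientGroup.mk_surjective v
  exact ncard_of_range (f := fun n => face 2 (x * rotVertex M ^ n))
    (fun X => hM.mem_verts_iff_rot) (fun i hi j hj h => hM.rot_inj x hi hj h)

theorem finite_verts (X : Tile M) : (verts X).Finite :=
  Set.finite_of_ncard_pos (by rw [hM.ncard_verts]; have := hM.pos; omega)

theorem finite_edges (X : Tile M) : (edges X).Finite :=
  Set.finite_of_ncard_pos (by rw [hM.ncard_edges]; have := hM.pos; omega)

/-- The two tiles of an edge. -/
theorem mem_edges_iff {x : M.Group} {X : Tile M} :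
    face 1 x ∈ edges X ↔ X = face 2 x ∨ X = face 2 (x * M.simple 2) := by
  constructor
  · rintro ⟨y, rfl, hy⟩
    rcases hM.same_edge hy with rfl | rfl | rfl | rfl
    · exact Or.inl rfl
    · exact Or.inl (tile_mul0 x)
    · exact Or.inr rfl
    · rw [hM.mul_comm02]; exact Or.inr (tile_mul0 _)
  · rintro (rfl | rfl)
    · exact ⟨x, rfl, rfl⟩
    · exact ⟨_, rfl, edge_mul2 x⟩

end IsTess

/-- A rank function on the tiles that shells the tessellation from the root tile `X₀`: ranks
increase across new edges, a tile other than the root has one or two consecutive old edges, and a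
vertex that lies on no old edge of a tile is new. -/
structure RootedRank (τ : Tile M → ℕ) (X₀ : Tile M) : Prop where
  zero_iff : ∀ X, τ X = 0 ↔ X = X₀
  ne : ∀ x : M.Group, τ (face 2 (x * M.simple 2)) ≠ τ (face 2 x)
  gate : ∀ X, X ≠ X₀ → ∃ w, face 2 w = X ∧ τ (face 2 (w * M.simple 2)) < τ X ∧
    ∀ x, face 2 x = X → τ (face 2 (x * M.simple 2)) < τ X →
      x = w ∨ x = w * M.simple 0 ∨ x = w * M.simple 1 ∨ x = w * M.simple 1 * M.simple 0
  new_vertex : ∀ x y : M.Group, τ (face 2 x) < τ (face 2 (x * M.simple 2)) →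
    τ (face 2 x) < τ (face 2 (x * M.simple 1 * M.simple 2)) → face 0 y = face 0 x →
    y ≠ x → y ≠ x * M.simple 1 → τ (face 2 x) < τ (face 2 y)
  finite_le : ∀ n, {X | τ X ≤ n}.Finite
  new_connected : ∀ P : M.Group → Prop, (∀ x, P x ↔ P (x * M.simple 0)) →
    (∀ x, τ (face 2 x) < τ (face 2 (x * M.simple 2)) →
      τ (face 2 x) < τ (face 2 (x * M.simple 1 * M.simple 2)) → (P x ↔ P (x * M.simple 1))) →
    ∀ x y, face 2 x = face 2 y → τ (face 2 x) < τ (face 2 (x * M.simple 2)) →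
      τ (face 2 y) < τ (face 2 (y * M.simple 2)) → (P x ↔ P y)

theorem IsTess.rootedRank_rank (hM : IsTess M k) :
    RootedRank (rank (M := M)) (face 2 1) := by
  have hnew : ∀ x : M.Group, rank (face 2 x) < rank (face 2 (x * M.simple 2)) ↔ ¬ Desc x 2 := by
    intro x
    rw [hM.desc_iff_rank, not_lt]
    have := hM.rank_ne x
    omega
  have hnew1 : ∀ x : M.Group, rank (face 2 x) < rank (face 2 (x * M.simple 1 * M.simple 2)) ↔
      ¬ Desc (x * M.simple 1) 2 := by
    intro x
    rw [← hnew, tile_mul1]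
  refine ⟨rank_eq_zero_iff, hM.rank_ne, ?_, ?_, finite_rank_le, ?_⟩
  · intro X hX
    obtain ⟨w, rfl, hl⟩ := exists_gate X
    refine ⟨w, rfl, hM.rank_lt_of_desc (gate_desc hl hX), ?_⟩
    intro x hx h
    rw [← hx, ← hM.desc_iff_rank] at h
    exact hM.old_edges hl hx h
  · intro x y h1 h2 hy hne hne1
    exact hM.rank_lt_at_vertex ((hnew x).mp h1) ((hnew1 x).mp h2) hy hne hne1
  · intro P h0 h1 x y hxy hx hy
    exact hM.new_edges_connected h0
      (fun x hx hx1 => h1 x ((hnew x).mpr hx) ((hnew1 x).mpr hx1)) hxy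
      ((hnew x).mp hx) ((hnew y).mp hy)

/-- The symmetry group is transitive on tiles, so any tile can be taken as the root. -/
theorem IsTess.exists_rootedRank (hM : IsTess M k) (X₀ : Tile M) :
    ∃ τ : Tile M → ℕ, RootedRank τ X₀ := by
  obtain ⟨g, rfl⟩ := QuotientGroup.mk_surjective X₀
  have R := hM.rootedRank_rank
  have hs : ∀ (i : Fin 3) (x : M.Group), g⁻¹ • face i x = face i (g⁻¹ * x) := fun _ _ => rfl
  have hinj : ∀ {x y : M.Group} {i : Fin 3}, face i x = face i y →
      face i (g⁻¹ * x) = face i (g⁻¹ * y) := fun h => by rw [← hs, h]; rfl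
  refine ⟨fun X => rank (g⁻¹ • X), ?_, ?_, ?_, ?_, ?_, ?_⟩
  · intro X
    rw [R.zero_iff, inv_smul_eq_iff]
    change X = face 2 (g * 1) ↔ X = face 2 g
    rw [mul_one]
  · intro x
    simp only [hs, ← mul_assoc]
    exact R.ne _
  · intro X hX
    obtain ⟨w, hw, h1, h2⟩ := R.gate (g⁻¹ • X) (by
      rw [Ne, inv_smul_eq_iff]
      change ¬ X = face 2 (g * 1)
      rwa [mul_one])
    refine ⟨g * w, ?_, ?_, ?_⟩
    · have h : g • face 2 w = X := by rw [hw, smul_inv_smul]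
      exact h
    · simpa [hs, mul_assoc] using h1
    · intro x hx h
      have := h2 (g⁻¹ * x) (by rw [← hs, hx]) (by simpa [hs, mul_assoc] using h)
      simpa [inv_mul_eq_iff_eq_mul, mul_assoc] using this
  · intro x y h1 h2 hy hne hne1
    simp only [hs, ← mul_assoc] at h1 h2 ⊢
    refine R.new_vertex _ _ h1 h2 (hinj hy) (by simpa using hne) ?_
    intro h
    apply hne1
    rw [mul_assoc] at h
    exact mul_left_cancel h
  · intro n
    refine ((R.finite_le n).image fun X => g • X).subset ?_
    intro X hX
    exact ⟨g⁻¹ • X, hX, by simp⟩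
  · intro P h0 h1 x y hxy hx hy
    simp only [hs, ← mul_assoc] at hx hy
    have := R.new_connected (fun x => P (g * x)) (fun x => by rw [h0, mul_assoc])
      (fun x hx hx1 => by
        rw [← mul_assoc]
        exact h1 (g * x) (by simpa [hs, mul_assoc] using hx)
          (by simpa [hs, mul_assoc] using hx1))
      (g⁻¹ * x) (g⁻¹ * y) (hinj hxy) hx hy
    simpa using this

end Tessellation

/-! ### Even sets of edges are boundaries -/

namespace Tessellation

open CoxeterSystem

variable {M : CoxeterMatrix (Fin 3)} {k : ℕ}

theorem zmod_two_eq_one {a : ZMod 2} (h : a ≠ 0) : a = 1 := by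
  revert a; decide

theorem tile_rot_succ (x : M.Group) (i : ℕ) :
    face 2 (x * rotVertex M ^ (i + 1) * M.simple 2) = face 2 (x * rotVertex M ^ i) := by
  rw [pow_succ, ← mul_assoc, ← mul_assoc, mul_simple_cancel, tile_mul1]

namespace IsTess

variable (hM : IsTess M k)
include hM

/-- The boundary of a chain of tiles has even degree at every vertex. -/
theorem boundary_even (f : Tile M → ZMod 2) (x : M.Group) :
    ∑ i ∈ Finset.range k, (f (face 2 (x * rotVertex M ^ i)) +
      f (face 2 (x * rotVertex M ^ i * M.simple 2))) = 0 := by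
  rw [Finset.sum_add_distrib]
  have hk : rotVertex M ^ k = 1 := by rw [← hM.orderOf_rotVertex, pow_orderOf_eq_one]
  have h1 : ∑ i ∈ Finset.range k, f (face 2 (x * rotVertex M ^ i * M.simple 2)) =
      ∑ i ∈ Finset.range k, f (face 2 (x * rotVertex M ^ (i + 1) * M.simple 2)) := by
    have e1 := Finset.sum_range_succ (fun i => f (face 2 (x * rotVertex M ^ i * M.simple 2))) k
    have e2 := Finset.sum_range_succ' (fun i => f (face 2 (x * rotVertex M ^ i * M.simple 2))) k
    rw [e1, hk, pow_zero] at e2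
    exact add_right_cancel e2
  rw [h1]
  simp only [tile_rot_succ]
  exact CharTwo.add_self_eq_zero _

theorem edge_indicator (X : Tile M) [DecidablePred (· ∈ edges X)] [DecidableEq (Tile M)]
    (x : M.Group) : (if face 1 x ∈ edges X then 1 else 0 : ZMod 2) =
      (if face 2 x = X then 1 else 0) + if face 2 (x * M.simple 2) = X then 1 else 0 := by
  have := hM.tile_ne x
  rw [if_congr hM.mem_edges_iff rfl rfl]
  by_cases h1 : face 2 x = X
  · subst h1; simp [this]
  · by_cases h2 : face 2 (x * M.simple 2) = X
    · subst h2; simp [this.symm]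
    · simp [h1, h2, Ne.symm h1, Ne.symm h2]

/-- The tessellation has no one-dimensional homology: an even finite set of edges is the boundary
of a finite set of tiles (modulo 2). Tiles are removed in the reverse order of a shelling. -/
theorem exists_boundary {γ : Edge M → ZMod 2} (hfin : (Function.support γ).Finite)
    (heven : ∀ x : M.Group, ∑ i ∈ Finset.range k, γ (face 1 (x * rotVertex M ^ i)) = 0) :
    ∃ f : Tile M → ZMod 2, (Function.support f).Finite ∧
      ∀ x : M.Group, f (face 2 x) + f (face 2 (x * M.simple 2)) = γ (face 1 x) := by
  classical
  obtain ⟨τ, R⟩ := hM.exists_rootedRank (face 2 1)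
  have new_or : ∀ x : M.Group, τ (face 2 x) < τ (face 2 (x * M.simple 2)) ∨
      τ (face 2 (x * M.simple 2)) < τ (face 2 (x * M.simple 2 * M.simple 2)) := by
    intro x
    rw [mul_simple_cancel]
    exact lt_or_gt_of_ne (R.ne x).symm
  -- the edges of `γ` are attached to a finite set `S` of tiles that is closed under old neighbours
  suffices key : ∀ (n : ℕ) (S : Finset (Tile M)) (γ : Edge M → ZMod 2), S.card = n →
      (∀ x : M.Group, ∑ i ∈ Finset.range k, γ (face 1 (x * rotVertex M ^ i)) = 0) →
      (∀ x : M.Group, face 2 x ∈ S → τ (face 2 (x * M.simple 2)) < τ (face 2 x) →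
        face 2 (x * M.simple 2) ∈ S) →
      (∀ x : M.Group, γ (face 1 x) ≠ 0 → τ (face 2 x) < τ (face 2 (x * M.simple 2)) →
        face 2 x ∈ S) →
      ∃ f : Tile M → ZMod 2, (∀ X, f X ≠ 0 → X ∈ S) ∧
        ∀ x : M.Group, f (face 2 x) + f (face 2 (x * M.simple 2)) = γ (face 1 x) by
    -- choose a ball that contains the finite support
    have hball : ∃ n, ∀ x : M.Group, γ (face 1 x) ≠ 0 → τ (face 2 x) ≤ n := by
      have h1 : {X : Tile M | ∃ e ∈ Function.support γ, e ∈ edges X}.Finite := by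
        have : {X : Tile M | ∃ e ∈ Function.support γ, e ∈ edges X} =
            ⋃ e ∈ Function.support γ, {X | e ∈ edges X} := by ext; simp
        rw [this]
        refine hfin.biUnion fun e he => ?_
        obtain ⟨x, rfl⟩ := QuotientGroup.mk_surjective e
        refine (Set.toFinite {face 2 x, face 2 (x * M.simple 2)}).subset ?_
        intro X hX
        exact hM.mem_edges_iff.mp hX
      obtain ⟨n, hn⟩ := (h1.image τ).bddAbove
      exact ⟨n, fun x hx => hn ⟨face 2 x, ⟨face 1 x, hx, x, rfl, rfl⟩, rfl⟩⟩
    obtain ⟨n, hn⟩ := hball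
    obtain ⟨f, hf, h⟩ := key _ (R.finite_le n).toFinset γ rfl heven
      (by
        intro x hx hlt
        rw [Set.Finite.mem_toFinset] at *
        exact hlt.le.trans hx)
      (by
        intro x hx _
        rw [Set.Finite.mem_toFinset]
        exact hn x hx)
    exact ⟨f, (Finset.finite_toSet _).subset fun X hX => hf X hX, h⟩
  clear hfin heven γ
  intro n
  induction n with
  | zero =>
    intro S γ hS _ _ hsupp
    rw [Finset.card_eq_zero] at hS
    subst hS
    refine ⟨0, by simp, fun x => ?_⟩
    by_contra h
    have h : γ (face 1 x) ≠ 0 := fun h' => h (by simp [h'])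
    rcases new_or x with h1 | h1
    · exact absurd (hsupp x h h1) (by simp)
    · exact absurd (hsupp (x * M.simple 2) (by rwa [edge_mul2]) h1) (by simp)
  | succ n ih =>
    intro S γ hS heven hdown hsupp
    obtain ⟨X, hXS, hmax⟩ := S.exists_max_image τ (Finset.card_pos.mp (by omega))
    have hcard : (S.erase X).card = n := by rw [Finset.card_erase_of_mem hXS]; omega
    have hdown' : ∀ x : M.Group, face 2 x ∈ S.erase X →
        τ (face 2 (x * M.simple 2)) < τ (face 2 x) → face 2 (x * M.simple 2) ∈ S.erase X := by
      intro x hx hlt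
      rw [Finset.mem_erase] at *
      refine ⟨?_, hdown x hx.2 hlt⟩
      intro h
      rw [h] at hlt
      exact absurd (hmax _ hx.2) (by omega)
    by_cases hA : ∀ x, face 2 x = X → τ (face 2 x) < τ (face 2 (x * M.simple 2)) →
        γ (face 1 x) = 0
    · obtain ⟨f, hf, h⟩ := ih (S.erase X) γ hcard heven hdown' (by
        intro x hx hlt
        rw [Finset.mem_erase]
        exact ⟨fun h => hx (hA x h hlt), hsupp x hx hlt⟩)
      exact ⟨f, fun Y hY => Finset.mem_of_mem_erase (hf Y hY), h⟩
    · push Not at hA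
      obtain ⟨x₀, hx₀, hnew₀, hne₀⟩ := hA
      -- evenness at the new vertices of `X` spreads the chain to all new edges of `X`
      have hall : ∀ x, face 2 x = X → τ (face 2 x) < τ (face 2 (x * M.simple 2)) →
          γ (face 1 x) = 1 := by
        intro x hx hnew
        have := R.new_connected (fun x => face 2 x = X → γ (face 1 x) ≠ 0)
          (fun x => by rw [tile_mul0, edge_mul0]) ?_ x₀ x (hx₀.trans hx.symm) hnew₀ hnew
        · exact zmod_two_eq_one (this.mp (fun _ => hne₀) hx)
        · intro x h1 h2
          rw [tile_mul1]
          refine imp_congr_right fun hx => ?_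
          have hs := heven x
          obtain ⟨k', rfl⟩ : ∃ k', k = k' + 2 := ⟨k - 2, by have := hM.hk; omega⟩
          have hpow : ∀ j, 0 < j → j < k' + 2 → rotVertex M ^ j ≠ 1 := by
            intro j h0 hj h
            have := orderOf_dvd_of_pow_eq_one h
            rw [hM.orderOf_rotVertex] at this
            exact absurd (Nat.le_of_dvd h0 this) (by omega)
          rw [Finset.sum_range_succ', Finset.sum_range_succ', Finset.sum_eq_zero] at hs
          · simp only [zero_add, pow_zero, mul_one, pow_one] at hs
            rw [← mul_assoc, edge_mul2] at hs
            rw [CharTwo.add_eq_zero] at hs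
            rw [hs]
          · intro i hi
            rw [Finset.mem_range] at hi
            by_contra hne
            have far : ∀ z, face 0 z = face 0 x → z ≠ x → z ≠ x * M.simple 1 →
                γ (face 1 z) ≠ 0 → τ (face 2 z) < τ (face 2 (z * M.simple 2)) → False := by
              intro z hv hz hz1 hγ hnew
              have a := R.new_vertex x z h1 h2 hv hz hz1
              have b := hmax _ (hsupp z hγ hnew)
              rw [hx] at a
              omega
            rcases new_or (x * rotVertex M ^ (i + 1 + 1)) with hn | hn
            · refine far _ (vertex_rot x _) ?_ ?_ hne hn
              · intro h
                exact hpow (i + 1 + 1) (by omega) (by omega) (by simpa using h)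
              · intro h
                exact hM.rotVertex_pow_ne _ (mul_left_cancel h)
            · have e : x * rotVertex M ^ (i + 1 + 1) * M.simple 2 =
                  x * rotVertex M ^ (i + 1) * M.simple 1 := by
                rw [pow_succ, ← mul_assoc, ← mul_assoc, mul_simple_cancel]
              refine far _ (by rw [vertex_mul2, vertex_rot]) ?_ ?_ (by rwa [edge_mul2]) hn
              · intro h
                rw [e] at h
                refine hM.rotVertex_pow_ne (i + 1) ?_
                have h' := congrArg (fun z => x⁻¹ * z * M.simple 1) h
                simpa [mul_assoc] using h'
              · intro h
                rw [e] at h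
                refine hpow (i + 1) (by omega) (by omega) ?_
                have h' := congrArg (fun z => x⁻¹ * z * M.simple 1) h
                simpa [mul_assoc] using h'
      -- adding the boundary of `X` removes its new edges from the chain
      obtain ⟨f, hf, h⟩ := ih (S.erase X) (fun e => γ e + if e ∈ edges X then 1 else 0) hcard
        (by
          intro x
          rw [Finset.sum_add_distrib, heven, zero_add]
          simp only [hM.edge_indicator]
          exact hM.boundary_even (fun Y => if Y = X then 1 else 0) x)
        hdown' (by
          intro x hx hlt
          rw [hM.edge_indicator] at hx
          rw [Finset.mem_erase]
          by_cases h1 : face 2 x = X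
          · exfalso
            have h2 : face 2 (x * M.simple 2) ≠ X := by
              rw [← h1]; exact hM.tile_ne x
            rw [hall x h1 hlt, if_pos h1, if_neg h2] at hx
            exact hx (by decide)
          · refine ⟨h1, ?_⟩
            by_cases h2 : face 2 (x * M.simple 2) = X
            · have := hdown (x * M.simple 2) (by rw [h2]; exact hXS) (by simpa using hlt)
              simpa using this
            · rw [if_neg h1, if_neg h2] at hx
              exact hsupp x (by simpa using hx) hlt)
      refine ⟨fun Y => f Y + if Y = X then 1 else 0, ?_, ?_⟩
      · intro Y hY
        by_cases hYX : Y = X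
        · rw [hYX]; exact hXS
        · simp only [if_neg hYX, add_zero] at hY
          exact Finset.mem_of_mem_erase (hf Y hY)
      · intro x
        have h' := h x
        rw [hM.edge_indicator] at h'
        rw [add_add_add_comm, h', add_assoc, CharTwo.add_self_eq_zero, add_zero]

end IsTess

end Tessellation

/-! ### Connected sets of tiles without holes -/

namespace Tessellation

open CoxeterSystem

variable {M : CoxeterMatrix (Fin 3)} {k : ℕ}

/-- A set of tiles is connected through shared edges. -/
def Conn (D : Set (Tile M)) : Prop :=
  ∀ S ⊆ D, S.Nonempty → (∀ X ∈ S, ∀ Y ∈ D, (tileGraph M).Adj X Y → Y ∈ S) → S = D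

/-- A set of tiles without holes: no finite non-empty set of tiles outside `D` is a union of
components of the complement. -/
def HoleFree (D : Set (Tile M)) : Prop :=
  ∀ S : Set (Tile M), S.Finite → (∀ X ∈ S, X ∉ D) →
    (∀ X ∈ S, ∀ Y ∉ D, (tileGraph M).Adj X Y → Y ∈ S) → S = ∅

open Classical in
/-- The indicator function of a face, modulo 2. -/
def point {i : Fin 3} (F G : Face M i) : ZMod 2 := if G = F then 1 else 0

theorem point_self {i : Fin 3} (F : Face M i) : point F F = 1 := if_pos rfl

theorem point_ne {i : Fin 3} {F G : Face M i} (h : G ≠ F) : point F G = 0 := if_neg h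

theorem finite_support_point {i : Fin 3} (F : Face M i) :
    (Function.support (point F)).Finite := by
  refine (Set.finite_singleton F).subset ?_
  intro G hG
  by_contra h
  exact hG (point_ne h)

/-- Two flags of the tiles of `B` are joined if there is a finite chain of edges of `B` (modulo 2)
whose boundary consists of their vertices. -/
def Joined (k : ℕ) (B : Set (Tile M)) (x y : M.Group) : Prop :=
  ∃ γ : Edge M → ZMod 2, (Function.support γ).Finite ∧
    (∀ z : M.Group, γ (face 1 z) ≠ 0 → face 2 z ∈ B ∨ face 2 (z * M.simple 2) ∈ B) ∧
    ∀ z : M.Group, ∑ i ∈ Finset.range k, γ (face 1 (z * rotVertex M ^ i)) =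
      point (face 0 x) (face 0 z) + point (face 0 y) (face 0 z)

theorem Joined.of_vertex_eq {B : Set (Tile M)} {x y : M.Group} (h : face 0 x = face 0 y) :
    Joined k B x y := by
  refine ⟨0, by simp, by simp, ?_⟩
  intro z
  rw [h, CharTwo.add_self_eq_zero]
  simp

theorem Joined.trans {B : Set (Tile M)} {x y z : M.Group} (h₁ : Joined k B x y)
    (h₂ : Joined k B y z) : Joined k B x z := by
  obtain ⟨γ₁, f₁, s₁, b₁⟩ := h₁
  obtain ⟨γ₂, f₂, s₂, b₂⟩ := h₂
  refine ⟨γ₁ + γ₂, (f₁.union f₂).subset (Function.support_add _ _), ?_, ?_⟩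
  · intro w hw
    by_cases h : γ₁ (face 1 w) = 0
    · exact s₂ w (by simpa [h] using hw)
    · exact s₁ w h
  · intro w
    simp only [Pi.add_apply]
    rw [Finset.sum_add_distrib, b₁ w, b₂ w, add_assoc, ← add_assoc (point (face 0 y) _),
      CharTwo.add_self_eq_zero, zero_add]

theorem HoleFree.eq_zero (hM : IsTess M k) {D : Set (Tile M)} (hD : HoleFree D)
    {f : Tile M → ZMod 2} (hf : (Function.support f).Finite)
    (h : ∀ x : M.Group, face 2 x ∉ D → face 2 (x * M.simple 2) ∉ D →
      f (face 2 x) = f (face 2 (x * M.simple 2))) {X : Tile M} (hX : X ∉ D) : f X = 0 := by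
  have := hD {X | X ∉ D ∧ f X ≠ 0} (hf.subset fun X hX => hX.2) (fun X hX => hX.1) (by
    rintro X ⟨hX, hfX⟩ Y hY hadj
    obtain ⟨x, rfl, rfl⟩ := hM.adj_iff.mp hadj
    exact ⟨hY, by rwa [← h x hX hY]⟩)
  by_contra hne
  have hmem : X ∈ {X | X ∉ D ∧ f X ≠ 0} := ⟨hX, hne⟩
  rw [this] at hmem
  exact hmem

namespace IsTess

variable (hM : IsTess M k)
include hM

theorem rot_edge_inj (z : M.Group) {i j : ℕ} (hi : i < k) (hj : j < k)
    (h : face 1 (z * rotVertex M ^ i) = face 1 (z * rotVertex M ^ j)) : i = j := by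
  have hv := (vertex_rot z i).trans (vertex_rot z j).symm
  rcases hM.same_edge h with e | e | e | e
  · exact hM.rot_inj z hi hj (congrArg (face 2) e)
  · rw [e] at hv; exact absurd hv (hM.vertex_ne _)
  · exfalso
    obtain ⟨φ, -, h1, h2⟩ := hM.exists_hom_vertex
    rw [mul_assoc] at e
    have := congrArg φ (mul_left_cancel e)
    rw [map_mul, map_pow, map_pow, map_mul, h1, h2, DihedralGroup.sr_mul_sr,
      DihedralGroup.r_pow, DihedralGroup.r_pow, DihedralGroup.r_mul_sr] at this
    cases this
  · rw [e, vertex_mul2] at hv; exact absurd hv (hM.vertex_ne _)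

/-- The boundary of an edge consists of its two ends. -/
theorem edge_boundary (x z : M.Group) :
    ∑ i ∈ Finset.range k, point (face 1 x) (face 1 (z * rotVertex M ^ i)) =
      point (face 0 x) (face 0 z) + point (face 0 (x * M.simple 0)) (face 0 z) := by
  have key : ∀ x : M.Group, face 0 z = face 0 x →
      ∑ i ∈ Finset.range k,
        point (face 1 x) (face 1 (z * rotVertex M ^ i)) = 1 := by
    intro x h
    have hex : ∃ i < k, face 1 (z * rotVertex M ^ i) = face 1 x := by
      obtain ⟨n, hn, rfl | rfl⟩ := hM.same_vertex h.symm
      · exact ⟨n, hn, rfl⟩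
      · have e : face 1 (z * rotVertex M ^ n * M.simple 1) =
            face 1 (z * rotVertex M ^ (n + 1)) := by
          rw [pow_succ, ← mul_assoc, ← mul_assoc, edge_mul2]
        rcases Nat.lt_or_ge (n + 1) k with h | h
        · exact ⟨n + 1, h, e.symm⟩
        · refine ⟨0, hM.pos, ?_⟩
          obtain h : n + 1 = k := by omega
          have h2 : rotVertex M ^ k = 1 := by rw [← hM.orderOf_rotVertex, pow_orderOf_eq_one]
          rw [e, h, h2, pow_zero]
    obtain ⟨i, hi, he⟩ := hex
    rw [Finset.sum_eq_single i]
    · rw [he, point_self]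
    · intro j hj hne
      refine point_ne fun h => ?_
      exact hne (hM.rot_edge_inj z (Finset.mem_range.mp hj) hi (h.trans he.symm))
    · intro h; exact absurd (Finset.mem_range.mpr hi) h
  by_cases h1 : face 0 z = face 0 x
  · have h2 : face 0 z ≠ face 0 (x * M.simple 0) := by
      rw [h1]; exact (hM.vertex_ne x).symm
    rw [key x h1, point_ne h2, h1, point_self, add_zero]
  · by_cases h2 : face 0 z = face 0 (x * M.simple 0)
    · have := key _ h2
      rw [edge_mul0] at this
      rw [this, point_ne h1, h2, point_self, zero_add]
    · rw [point_ne h1, point_ne h2, add_zero]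
      refine Finset.sum_eq_zero fun i _ => point_ne fun h => ?_
      have hv := vertex_rot z i
      rcases hM.same_edge h with e | e | e | e
      · rw [e] at hv; exact h1 hv.symm
      · rw [e] at hv; exact h2 hv.symm
      · rw [e, vertex_mul2] at hv; exact h1 hv.symm
      · rw [e, vertex_mul2] at hv; exact h2 hv.symm

theorem joined_edge {B : Set (Tile M)} {x : M.Group} (hx : face 2 x ∈ B) :
    Joined k B x (x * M.simple 0) := by
  refine ⟨point (face 1 x), finite_support_point _, ?_, hM.edge_boundary x⟩
  intro z hz
  have h : face 1 z = face 1 x := by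
    by_contra h
    exact hz (point_ne h)
  rcases hM.mem_edges_iff.mp (show face 1 z ∈ edges (face 2 x) from ⟨x, rfl, h.symm⟩) with h | h
  · left; rwa [← h]
  · right; rwa [← h]

theorem joined_tile {B : Set (Tile M)} {x y : M.Group} (hx : face 2 x ∈ B)
    (h : face 2 y = face 2 x) : Joined k B x y := by
  have hu : x⁻¹ * y ∈ faceStabilizer M 2 := QuotientGroup.eq.mp h.symm
  have hy : y = x * (x⁻¹ * y) := by group
  rw [hy]
  rw [stab_tile] at hu
  generalize x⁻¹ * y = u at hu
  suffices face 2 (x * u) ∈ B ∧ Joined k B x (x * u) from this.2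
  induction hu using Subgroup.closure_induction_right with
  | one => rw [mul_one]; exact ⟨hx, .of_vertex_eq rfl⟩
  | mul_right u hu z hz ih =>
    rcases hz with rfl | rfl
    · rw [← mul_assoc, tile_mul0]
      exact ⟨ih.1, ih.2.trans (hM.joined_edge ih.1)⟩
    · rw [← mul_assoc, tile_mul1]
      exact ⟨ih.1, ih.2.trans (.of_vertex_eq (vertex_mul1 _).symm)⟩
  | mul_inv_cancel u hu z hz ih =>
    rcases hz with rfl | rfl
    · rw [simple_inv, ← mul_assoc, tile_mul0]
      exact ⟨ih.1, ih.2.trans (hM.joined_edge ih.1)⟩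
    · rw [simple_inv, ← mul_assoc, tile_mul1]
      exact ⟨ih.1, ih.2.trans (.of_vertex_eq (vertex_mul1 _).symm)⟩

theorem joined_of_conn {B : Set (Tile M)} (hB : Conn B) {x y : M.Group} (hx : face 2 x ∈ B)
    (hy : face 2 y ∈ B) : Joined k B x y := by
  have := hB {T | T ∈ B ∧ ∀ z, face 2 z = T → Joined k B x z} (fun T hT => hT.1)
    ⟨face 2 x, hx, fun z hz => hM.joined_tile hx hz⟩ (by
      rintro X ⟨hX, h⟩ Y hY hadj
      obtain ⟨z, rfl, rfl⟩ := hM.adj_iff.mp hadj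
      refine ⟨hY, fun w hw => ?_⟩
      exact ((h z rfl).trans (.of_vertex_eq (vertex_mul2 z).symm)).trans (hM.joined_tile hY hw))
  rw [← this] at hy
  exact hy.2 y rfl

/-- Two parts of a set without holes that are connected, and do not share an edge, meet in at most
one vertex: a closed curve through both parts would separate two regions of the complement. -/
theorem shared_vertex_unique {B₁ B₂ : Set (Tile M)} (h₁ : Conn B₁) (h₂ : Conn B₂)
    (hhole : HoleFree (B₁ ∪ B₂)) (hdisj : ∀ X ∈ B₁, X ∉ B₂)
    (hadj : ∀ X ∈ B₁, ∀ Y ∈ B₂, ¬ (tileGraph M).Adj X Y) {v w : Vertex M}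
    (hv₁ : ∃ X ∈ B₁, v ∈ verts X) (hv₂ : ∃ X ∈ B₂, v ∈ verts X)
    (hw₁ : ∃ X ∈ B₁, w ∈ verts X) (hw₂ : ∃ X ∈ B₂, w ∈ verts X) : v = w := by
  classical
  obtain ⟨_, hx₁, x₁, rfl, hx₁v⟩ := hv₁
  obtain ⟨_, hx₂, x₂, rfl, hx₂v⟩ := hv₂
  obtain ⟨_, hy₁, y₁, rfl, hy₁w⟩ := hw₁
  obtain ⟨_, hy₂, y₂, rfl, hy₂w⟩ := hw₂
  by_contra hne
  obtain ⟨γ₁, f₁, s₁, b₁⟩ := hM.joined_of_conn h₁ hx₁ hy₁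
  obtain ⟨γ₂, f₂, s₂, b₂⟩ := hM.joined_of_conn h₂ hx₂ hy₂
  have hcross : ∀ x : M.Group, face 2 x ∈ B₁ → face 2 (x * M.simple 2) ∉ B₂ :=
    fun x hx hx' => hadj _ hx _ hx' (hM.adj_cross x)
  have hcross' : ∀ x : M.Group, face 2 (x * M.simple 2) ∈ B₁ → face 2 x ∉ B₂ :=
    fun x hx hx' => hadj _ hx _ hx' (hM.adj_cross x).symm
  obtain ⟨f, hf, hb⟩ := hM.exists_boundary (γ := γ₁ + γ₂)
    ((f₁.union f₂).subset (Function.support_add _ _)) (by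
      intro z
      simp only [Pi.add_apply]
      rw [Finset.sum_add_distrib, b₁ z, b₂ z]
      have e1 : face 0 x₁ = face 0 x₂ := hx₁v.trans hx₂v.symm
      have e2 : face 0 y₁ = face 0 y₂ := hy₁w.trans hy₂w.symm
      rw [e1, e2, CharTwo.add_self_eq_zero])
  have hzero : ∀ {X}, X ∉ B₁ ∪ B₂ → f X = 0 := by
    intro X hX
    refine hhole.eq_zero hM hf ?_ hX
    intro x hx hx'
    have h1 : γ₁ (face 1 x) = 0 := by
      by_contra h
      rcases s₁ x h with h | h
      · exact hx (Or.inl h)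
      · exact hx' (Or.inl h)
    have h2 : γ₂ (face 1 x) = 0 := by
      by_contra h
      rcases s₂ x h with h | h
      · exact hx (Or.inr h)
      · exact hx' (Or.inr h)
    have := hb x
    rw [Pi.add_apply, h1, h2, add_zero, CharTwo.add_eq_zero] at this
    exact this
  -- the part of the filling inside `B₁` bounds the path in `B₁`, which is not closed
  set g : Tile M → ZMod 2 := fun X => if X ∈ B₁ then f X else 0 with hg
  have hgb : ∀ x : M.Group, g (face 2 x) + g (face 2 (x * M.simple 2)) = γ₁ (face 1 x) := by
    intro x
    have hout : ∀ X, X ∉ B₁ → X ∉ B₂ → f X = 0 := fun X h1 h2 => hzero (by simp [h1, h2])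
    have hγ₂ : face 2 x ∉ B₂ → face 2 (x * M.simple 2) ∉ B₂ → γ₂ (face 1 x) = 0 := by
      intro h h'
      by_contra hc
      rcases s₂ x hc with hc | hc
      · exact h hc
      · exact h' hc
    have hbx := hb x
    rw [Pi.add_apply] at hbx
    by_cases c1 : face 2 x ∈ B₁
    · have d1 := hcross x c1
      rw [hγ₂ (hdisj _ c1) d1, add_zero] at hbx
      rw [← hbx]
      by_cases c2 : face 2 (x * M.simple 2) ∈ B₁
      · simp only [hg, if_pos c1, if_pos c2]
      · simp only [hg, if_pos c1, if_neg c2, hout _ c2 d1]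
    · by_cases c2 : face 2 (x * M.simple 2) ∈ B₁
      · have d1 := hcross' x c2
        rw [hγ₂ d1 (hdisj _ c2), add_zero] at hbx
        rw [← hbx]
        simp only [hg, if_neg c1, if_pos c2, hout _ c1 d1]
      · simp only [hg, if_neg c1, if_neg c2]
        by_contra h
        rcases s₁ x (fun h' => h (by rw [h', add_zero])) with h | h
        · exact c1 h
        · exact c2 h
  have hsum := hM.boundary_even g y₁
  have hvw : face 0 y₁ ≠ face 0 x₁ := fun h => hne (hx₁v.symm.trans (h.symm.trans hy₁w))
  have e : ∀ i, g (face 2 (y₁ * rotVertex M ^ i)) + g (face 2 (y₁ * rotVertex M ^ i * M.simple 2))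
      = γ₁ (face 1 (y₁ * rotVertex M ^ i)) := fun i => hgb _
  simp only [e] at hsum
  rw [b₁ y₁, point_ne hvw, point_self] at hsum
  exact absurd hsum (by decide)

/-- Attaching a tile to a connected set of tiles without creating a hole: an edge of the new tile
that is not shared cannot have both ends on the old set, as soon as there is another such edge. -/
theorem no_bridging_edge {D : Set (Tile M)} {X : Tile M} (hX : X ∉ D) (hconn : Conn D)
    (hhole : HoleFree (insert X D)) {x z : M.Group} (hx : face 2 x = X)
    (hz : face 2 z = X) (hxz : face 1 x ≠ face 1 z) (hx' : face 2 (x * M.simple 2) ∉ D)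
    (hz' : face 2 (z * M.simple 2) ∉ D) (hv : ∃ Y ∈ D, face 0 x ∈ verts Y)
    (hw : ∃ Y ∈ D, face 0 (x * M.simple 0) ∈ verts Y) : False := by
  classical
  subst hx
  obtain ⟨_, hy₁, y₁, rfl, hv⟩ := hv
  obtain ⟨_, hy₂, y₂, rfl, hw⟩ := hw
  obtain ⟨γ, fγ, sγ, bγ⟩ := hM.joined_of_conn hconn hy₁ hy₂
  obtain ⟨f, hf, hb⟩ := hM.exists_boundary (γ := γ + point (face 1 x))
    ((fγ.union (finite_support_point _)).subset (Function.support_add _ _)) (by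
      intro z
      simp only [Pi.add_apply]
      rw [Finset.sum_add_distrib, bγ z, hM.edge_boundary x z, show face 0 y₁ = face 0 x from hv,
        show face 0 y₂ = face 0 (x * M.simple 0) from hw,
        CharTwo.add_self_eq_zero])
  have hγ : ∀ z : M.Group, face 2 z ∉ D → face 2 (z * M.simple 2) ∉ D → γ (face 1 z) = 0 := by
    intro z h h'
    by_contra hc
    rcases sγ z hc with hc | hc
    · exact h hc
    · exact h' hc
  have hzero : ∀ {Y}, Y ∉ insert (face 2 x) D → f Y = 0 := by
    intro Y hY
    refine hhole.eq_zero hM hf ?_ hY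
    intro y hy hy'
    rw [Set.mem_insert_iff, not_or] at hy hy'
    have h1 : point (face 1 x) (face 1 y) = 0 := by
      refine point_ne fun h => ?_
      rcases hM.mem_edges_iff.mp (show face 1 y ∈ edges (face 2 x) from ⟨x, rfl, h.symm⟩)
        with h | h
      · exact hy.1 h.symm
      · exact hy'.1 h.symm
    have := hb y
    rw [Pi.add_apply, h1, hγ y hy.2 hy'.2, add_zero, CharTwo.add_eq_zero] at this
    exact this
  have hbx := hb x
  rw [Pi.add_apply, hγ x hX hx', zero_add] at hbx
  have h1 : f (face 2 (x * M.simple 2)) = 0 := by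
    refine hzero ?_
    rw [Set.mem_insert_iff, not_or]
    exact ⟨hM.tile_ne x, hx'⟩
  have hbz := hb z
  rw [Pi.add_apply, hγ z (by rwa [hz]) hz', zero_add] at hbz
  have h2 : f (face 2 (z * M.simple 2)) = 0 := by
    refine hzero ?_
    rw [Set.mem_insert_iff, not_or]
    refine ⟨?_, hz'⟩
    rw [← hz]
    exact hM.tile_ne z
  rw [h1, add_zero] at hbx
  rw [h2, add_zero, hz, hbx] at hbz
  rw [point_self, point_ne hxz.symm] at hbz
  exact absurd hbz (by decide)

end IsTess

end Tessellation

/-! ### Peeling off a tile -/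

namespace Tessellation

open CoxeterSystem

variable {M : CoxeterMatrix (Fin 3)} {k : ℕ}

/-- The edges of the tiles of `D`. -/
def edgeSet (D : Set (Tile M)) : Set (Edge M) := {e | ∃ X ∈ D, e ∈ edges X}

theorem conn_singleton (X : Tile M) : Conn ({X} : Set (Tile M)) := by
  intro S hS hne _
  exact (Set.subset_singleton_iff_eq.mp hS).resolve_left hne.ne_empty

theorem Conn.union {A B : Set (Tile M)} (hA : Conn A) (hB : Conn B) {a b : Tile M} (ha : a ∈ A)
    (hb : b ∈ B) (hab : (tileGraph M).Adj a b) : Conn (A ∪ B) := by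
  intro S hS hne hcl
  have hA' : (S ∩ A).Nonempty → A ⊆ S := by
    intro h
    have := hA (S ∩ A) Set.inter_subset_right h
      (fun X hX Y hY hadj => ⟨hcl X hX.1 Y (Or.inl hY) hadj, hY⟩)
    exact Set.inter_eq_right.mp this
  have hB' : (S ∩ B).Nonempty → B ⊆ S := by
    intro h
    have := hB (S ∩ B) Set.inter_subset_right h
      (fun X hX Y hY hadj => ⟨hcl X hX.1 Y (Or.inr hY) hadj, hY⟩)
    exact Set.inter_eq_right.mp this
  refine Set.Subset.antisymm hS ?_
  obtain ⟨X, hX⟩ := hne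
  rcases hS hX with h | h
  · have h1 := hA' ⟨X, hX, h⟩
    have h2 := hB' ⟨b, hcl a (h1 ha) b (Or.inr hb) hab, hb⟩
    exact Set.union_subset h1 h2
  · have h2 := hB' ⟨X, hX, h⟩
    have h1 := hA' ⟨a, hcl b (h2 hb) a (Or.inl ha) hab.symm, ha⟩
    exact Set.union_subset h1 h2

/-- Removing a connected part that touches the complement does not create a hole. -/
theorem HoleFree.diff {D B : Set (Tile M)} (hD : HoleFree D) (hBD : B ⊆ D) (hB : Conn B)
    {X Y : Tile M} (hX : X ∈ B) (hY : Y ∉ D) (hadj : (tileGraph M).Adj X Y) :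
    HoleFree (D \ B) := by
  intro S hfin hS hcl
  have h1 : S \ B = ∅ := by
    refine hD (S \ B) hfin.sdiff (fun T hT hTD => hS T hT.1 ⟨hTD, hT.2⟩) ?_
    intro T hT T' hT' hadj
    exact ⟨hcl T hT.1 T' (fun h => hT' h.1) hadj, fun h => hT' (hBD h)⟩
  rw [Set.sdiff_eq_empty] at h1
  by_contra hne
  have h2 := hB S h1 (Set.nonempty_iff_ne_empty.mpr hne)
    (fun T hT T' hT' hadj => hcl T hT T' (fun h => h.2 hT') hadj)
  have h3 : Y ∈ S := hcl X (h2 ▸ hX) Y (fun h => hY h.1) hadj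
  exact hY (hBD (h1 h3))

/-- All but two edges of a tile are new. -/
theorem exists_old_pair {τ : Tile M → ℕ} {X₀ : Tile M} (R : RootedRank τ X₀) (X : Tile M) :
    ∃ e₁ e₂ : Edge M, ∀ x, face 2 x = X → face 1 x ≠ e₁ → face 1 x ≠ e₂ →
      τ X < τ (face 2 (x * M.simple 2)) := by
  by_cases h : X = X₀
  · obtain ⟨z, -⟩ := QuotientGroup.mk_surjective X
    refine ⟨face 1 z, face 1 z, fun x hx _ _ => ?_⟩
    have h0 := (R.zero_iff X).mpr h
    have := R.ne x
    rw [hx] at this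
    omega
  · obtain ⟨w, hw, -, hold⟩ := R.gate X h
    refine ⟨face 1 w, face 1 (w * M.simple 1), fun x hx h1 h2 => ?_⟩
    have hne := R.ne x
    rw [hx] at hne
    by_contra hlt
    rcases hold x hx (by omega) with rfl | rfl | rfl | rfl
    · exact h1 rfl
    · exact h1 (edge_mul0 w)
    · exact h2 rfl
    · exact h2 (edge_mul0 _)

namespace IsTess

variable (hM : IsTess M k)
include hM

/-- A tile has an edge outside any small set of edges. -/
theorem exists_edge_avoiding (X : Tile M) (F : Finset (Edge M)) (hF : F.card < 2 * k) :
    ∃ z : M.Group, face 2 z = X ∧ face 1 z ∉ F := by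
  by_contra h
  push Not at h
  have hsub : edges X ⊆ (F : Set (Edge M)) := by
    rintro e ⟨z, hz, rfl⟩
    exact h z hz
  have := Set.ncard_le_ncard hsub F.finite_toSet
  rw [hM.ncard_edges, Set.ncard_coe_finset] at this
  omega

/-- A finite set of tiles has a neighbour outside. -/
theorem exists_boundary_flag {S : Set (Tile M)} (hfin : S.Finite) (hne : S.Nonempty) :
    ∃ x : M.Group, face 2 x ∈ S ∧ face 2 (x * M.simple 2) ∉ S := by
  obtain ⟨τ, R⟩ := hM.exists_rootedRank (face 2 1)
  obtain ⟨X, hX, hmax⟩ := hfin.exists_maximalFor τ S hne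
  obtain ⟨e₁, e₂, h⟩ := exists_old_pair R X
  classical
  obtain ⟨z, hz, hzF⟩ := hM.exists_edge_avoiding X {e₁, e₂}
    (lt_of_le_of_lt Finset.card_le_two (by have := hM.hk; omega))
  simp only [Finset.mem_insert, Finset.mem_singleton, not_or] at hzF
  have hlt := h z hz hzF.1 hzF.2
  refine ⟨z, by rwa [hz], fun hmem => ?_⟩
  have := hmax hmem hlt.le
  omega

/-- The edges that a tile `X ∉ D` shares with `D`, through its flags. -/
theorem mem_shared_edges {D : Set (Tile M)} {X : Tile M} (hX : X ∉ D) {e : Edge M} :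
    e ∈ edges X ∩ edgeSet D ↔
      ∃ x : M.Group, face 2 x = X ∧ face 1 x = e ∧ face 2 (x * M.simple 2) ∈ D := by
  constructor
  · rintro ⟨⟨x, rfl, rfl⟩, Y, hY, hmem⟩
    refine ⟨x, rfl, rfl, ?_⟩
    rcases hM.mem_edges_iff.mp hmem with h | h
    · rw [h] at hY
      exact absurd hY hX
    · rwa [← h]
  · rintro ⟨x, rfl, rfl, h⟩
    exact ⟨⟨x, rfl, rfl⟩, _, h, ⟨_, rfl, edge_mul2 x⟩⟩

/-- If a tile meets a connected set of tiles only along two consecutive edges or at their ends, and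
no hole arises, then it shares a path of one or two edges with the set. -/
theorem shared_path {D : Set (Tile M)} {w : M.Group} (hX : face 2 w ∉ D) (hconn : Conn D)
    (hhole : HoleFree (insert (face 2 w) D))
    (hE : ∀ x, face 2 x = face 2 w → face 2 (x * M.simple 2) ∈ D →
      face 1 x = face 1 w ∨ face 1 x = face 1 (w * M.simple 1))
    (hV : ∀ x, face 2 x = face 2 w → face 0 x ∈ vertexSet D →
      face 0 x = face 0 w ∨ face 0 x = face 0 (w * M.simple 0) ∨
        face 0 x = face 0 (w * M.simple 1 * M.simple 0))
    (hne : face 2 (w * M.simple 2) ∈ D ∨ face 2 (w * M.simple 1 * M.simple 2) ∈ D) :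
    (verts (face 2 w) ∩ vertexSet D).ncard = (edges (face 2 w) ∩ edgeSet D).ncard + 1 ∧
      1 ≤ (edges (face 2 w) ∩ edgeSet D).ncard ∧ (edges (face 2 w) ∩ edgeSet D).ncard ≤ 2 := by
  classical
  have hk := hM.hk
  have v01 : face 0 w ≠ face 0 (w * M.simple 0) := (hM.vertex_ne w).symm
  have v02 : face 0 w ≠ face 0 (w * M.simple 1 * M.simple 0) := by
    have := (hM.vertex_ne (w * M.simple 1)).symm
    rwa [vertex_mul1] at this
  have v12 : face 0 (w * M.simple 0) ≠ face 0 (w * M.simple 1 * M.simple 0) := by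
    intro h
    have hp : rotTile M ^ 2 ≠ 1 := by
      intro h
      have := orderOf_dvd_of_pow_eq_one h
      rw [hM.orderOf_rotTile] at this
      exact absurd (Nat.le_of_dvd (by omega) this) (by omega)
    rcases hM.same_vertex_tile h.symm (by simp) with h | h
    · have h1 : M.simple 1 = 1 := by simpa [mul_assoc] using h
      exact (hM.rotTile_pow_ne 0).2 (by rw [h1, pow_zero])
    · apply hp
      have h1 : M.simple 1 * M.simple 0 = M.simple 0 * M.simple 1 := by
        simpa [mul_assoc] using h
      rw [pow_two, rotTile, mul_assoc, ← mul_assoc (M.simple 1), h1]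
      simp [mul_assoc]
  have e01 : face 1 w ≠ face 1 (w * M.simple 1) := by
    intro h
    rcases hM.same_edge_tile h.symm (by simp) with h | h
    · have h1 : M.simple 1 = 1 := by simpa using h
      exact (hM.rotTile_pow_ne 0).2 (by rw [h1, pow_zero])
    · obtain ⟨φ, h0, h1, -⟩ := hM.exists_hom_edge
      have := congrArg φ (mul_left_cancel h)
      rw [h0, h1] at this
      exact absurd this (by decide)
  -- an edge that is not shared and has both ends on `D` would bridge a hole
  obtain ⟨z, hz, hzF⟩ := hM.exists_edge_avoiding (face 2 w) {face 1 w, face 1 (w * M.simple 1)}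
    (lt_of_le_of_lt Finset.card_le_two (by omega))
  simp only [Finset.mem_insert, Finset.mem_singleton, not_or] at hzF
  have hz' : face 2 (z * M.simple 2) ∉ D := fun h => (hE z hz h).elim hzF.1 hzF.2
  have bridge : ∀ x, face 2 x = face 2 w → face 1 x ≠ face 1 z → face 2 (x * M.simple 2) ∉ D →
      face 0 x ∈ vertexSet D → face 0 (x * M.simple 0) ∈ vertexSet D → False :=
    fun x hx h1 h2 h3 h4 => hM.no_bridging_edge hX hconn hhole hx hz h1 h2 hz' h3 h4
  have s0 : ∀ x : M.Group, face 2 (x * M.simple 2) ∈ D →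
      face 0 x ∈ vertexSet D ∧ face 0 (x * M.simple 0) ∈ vertexSet D := by
    intro x hx
    refine ⟨⟨_, hx, _, rfl, vertex_mul2 x⟩, ⟨_, hx, x * M.simple 2 * M.simple 0, by simp, ?_⟩⟩
    rw [← hM.mul_comm02]
    exact vertex_mul2 _
  have t1 : face 2 (w * M.simple 1) = face 2 w := tile_mul1 w
  have in0 : face 2 (w * M.simple 2) ∈ D → face 1 w ∈ edges (face 2 w) ∩ edgeSet D :=
    fun h => (hM.mem_shared_edges hX).mpr ⟨w, rfl, rfl, h⟩
  have in1 : face 2 (w * M.simple 1 * M.simple 2) ∈ D →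
      face 1 (w * M.simple 1) ∈ edges (face 2 w) ∩ edgeSet D :=
    fun h => (hM.mem_shared_edges hX).mpr ⟨_, t1, rfl, h⟩
  have esub : ∀ e ∈ edges (face 2 w) ∩ edgeSet D,
      (e = face 1 w ∧ face 2 (w * M.simple 2) ∈ D) ∨
        (e = face 1 (w * M.simple 1) ∧ face 2 (w * M.simple 1 * M.simple 2) ∈ D) := by
    intro e he
    obtain ⟨x, hx, rfl, hxD⟩ := (hM.mem_shared_edges hX).mp he
    rcases hE x hx hxD with h | h
    · left
      refine ⟨h, ?_⟩
      rcases hM.same_edge_tile h hx with rfl | rfl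
      · exact hxD
      · rwa [hM.mul_comm02, tile_mul0] at hxD
    · right
      refine ⟨h, ?_⟩
      rcases hM.same_edge_tile h (hx.trans t1.symm) with rfl | rfl
      · exact hxD
      · rwa [hM.mul_comm02, tile_mul0] at hxD
  have vsub : ∀ v ∈ verts (face 2 w) ∩ vertexSet D,
      v = face 0 w ∨ v = face 0 (w * M.simple 0) ∨ v = face 0 (w * M.simple 1 * M.simple 0) := by
    rintro v ⟨⟨x, hx, rfl⟩, hv⟩
    exact hV x hx hv
  have m0 : face 0 w ∈ verts (face 2 w) := ⟨w, rfl, rfl⟩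
  have m1 : face 0 (w * M.simple 0) ∈ verts (face 2 w) := ⟨_, tile_mul0 w, rfl⟩
  have m2 : face 0 (w * M.simple 1 * M.simple 0) ∈ verts (face 2 w) :=
    ⟨_, (tile_mul0 _).trans t1, rfl⟩
  by_cases h0 : face 2 (w * M.simple 2) ∈ D
  · have p0 := s0 _ h0
    by_cases h1 : face 2 (w * M.simple 1 * M.simple 2) ∈ D
    · have p1 := s0 _ h1
      have hse : edges (face 2 w) ∩ edgeSet D = {face 1 w, face 1 (w * M.simple 1)} := by
        refine Set.Subset.antisymm (fun e he => ?_) ?_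
        · rcases esub e he with h | h
          · exact Or.inl h.1
          · exact Or.inr h.1
        · rintro e (rfl | rfl)
          · exact in0 h0
          · exact in1 h1
      have hsv : verts (face 2 w) ∩ vertexSet D = {face 0 w, face 0 (w * M.simple 0),
          face 0 (w * M.simple 1 * M.simple 0)} := by
        refine Set.Subset.antisymm (fun v hv => vsub v hv) ?_
        rintro v (rfl | rfl | rfl)
        · exact ⟨m0, p0.1⟩
        · exact ⟨m1, p0.2⟩
        · exact ⟨m2, p1.2⟩
      rw [hse, hsv, Set.ncard_pair e01, Set.ncard_eq_three.mpr ⟨_, _, _, v01, v02, v12, rfl⟩]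
      omega
    · have hse : edges (face 2 w) ∩ edgeSet D = {face 1 w} := by
        refine Set.Subset.antisymm (fun e he => ?_) ?_
        · rcases esub e he with h | h
          · exact h.1
          · exact absurd h.2 h1
        · rintro e rfl
          exact in0 h0
      have hsv : verts (face 2 w) ∩ vertexSet D = {face 0 w, face 0 (w * M.simple 0)} := by
        refine Set.Subset.antisymm (fun v hv => ?_) ?_
        · rcases vsub v hv with h | h | h
          · exact Or.inl h
          · exact Or.inr h
          · rw [h] at hv
            exact (bridge (w * M.simple 1) t1 (fun h => hzF.2 h.symm) h1
              (by rw [vertex_mul1]; exact p0.1) hv.2).elim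
        · rintro v (rfl | rfl)
          · exact ⟨m0, p0.1⟩
          · exact ⟨m1, p0.2⟩
      rw [hse, hsv, Set.ncard_singleton, Set.ncard_pair v01]
      omega
  · have h1 := hne.resolve_left h0
    have p1 := s0 _ h1
    rw [vertex_mul1] at p1
    have hse : edges (face 2 w) ∩ edgeSet D = {face 1 (w * M.simple 1)} := by
      refine Set.Subset.antisymm (fun e he => ?_) ?_
      · rcases esub e he with h | h
        · exact absurd h.2 h0
        · exact h.1
      · rintro e rfl
        exact in1 h1
    have hsv : verts (face 2 w) ∩ vertexSet D =
        {face 0 w, face 0 (w * M.simple 1 * M.simple 0)} := by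
      refine Set.Subset.antisymm (fun v hv => ?_) ?_
      · rcases vsub v hv with h | h | h
        · exact Or.inl h
        · rw [h] at hv
          exact (bridge w rfl (fun h => hzF.1 h.symm) h0 p1.1 hv.2).elim
        · exact Or.inr h
      · rintro v (rfl | rfl)
        · exact ⟨m0, p1.1⟩
        · exact ⟨m2, p1.2⟩
    rw [hse, hsv, Set.ncard_singleton, Set.ncard_pair v02]
    omega

/-- Removing a tile that shares at most two edges with the rest creates no hole. -/
theorem holeFree_diff_singleton {D : Set (Tile M)} (hD : HoleFree D) {X : Tile M} (hX : X ∈ D)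
    (h2 : (edges X ∩ edgeSet (D \ {X})).ncard ≤ 2) : HoleFree (D \ {X}) := by
  classical
  have hfin : (edges X ∩ edgeSet (D \ {X})).Finite := (hM.finite_edges X).inter_of_left _
  obtain ⟨z, hz, hzF⟩ := hM.exists_edge_avoiding X hfin.toFinset (by
    rw [← Set.ncard_eq_toFinset_card _ hfin]
    have := hM.hk
    omega)
  rw [Set.Finite.mem_toFinset, hM.mem_shared_edges (by simp)] at hzF
  refine hD.diff (by simpa using hX) (conn_singleton X) rfl (Y := face 2 (z * M.simple 2)) ?_ ?_
  · intro h
    refine hzF ⟨z, hz, rfl, h, ?_⟩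
    rw [← hz]
    exact hM.tile_ne z
  · rw [← hz]
    exact hM.adj_cross z

/-- A connected set of tiles without holes, with at least two tiles, has a tile other than a given
one that shares a path of one or two edges with the rest, and whose removal leaves a connected set
without holes. -/
theorem exists_peel {D : Set (Tile M)} (hfin : D.Finite) (hconn : Conn D) (hhole : HoleFree D)
    {X₀ : Tile M} (hX₀ : X₀ ∈ D) (hne : ∃ X ∈ D, X ≠ X₀) :
    ∃ X ∈ D, X ≠ X₀ ∧ Conn (D \ {X}) ∧ HoleFree (D \ {X}) ∧
      (verts X ∩ vertexSet (D \ {X})).ncard = (edges X ∩ edgeSet (D \ {X})).ncard + 1 ∧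
      1 ≤ (edges X ∩ edgeSet (D \ {X})).ncard ∧ (edges X ∩ edgeSet (D \ {X})).ncard ≤ 2 := by
  classical
  induction hn : D.ncard using Nat.strong_induction_on generalizing D X₀ with
  | _ n ih =>
  have hk := hM.hk
  obtain ⟨τ, R⟩ := hM.exists_rootedRank X₀
  obtain ⟨X, hXD, hmax'⟩ := hfin.exists_maximalFor τ D ⟨X₀, hX₀⟩
  have hmax : ∀ Y ∈ D, τ Y ≤ τ X := fun Y hY => by
    by_contra h
    have := hmax' hY (by omega)
    omega
  have hXX₀ : X ≠ X₀ := by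
    rintro rfl
    obtain ⟨Y, hY, hYX⟩ := hne
    have h1 := hmax Y hY
    rw [(R.zero_iff X).mpr rfl] at h1
    exact hYX ((R.zero_iff Y).mp (by omega))
  obtain ⟨w, rfl, hw, hold⟩ := R.gate X hXX₀
  have hD' : insert (face 2 w) (D \ {face 2 w}) = D := by
    rw [Set.insert_sdiff_singleton, Set.insert_eq_of_mem hXD]
  have hXD' : face 2 w ∉ D \ {face 2 w} := by simp
  -- edges and vertices shared with the rest are old
  have old : ∀ x, face 2 x = face 2 w → face 2 (x * M.simple 2) ∈ D →
      τ (face 2 (x * M.simple 2)) < τ (face 2 w) := by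
    intro x hx h
    have h1 := hmax _ h
    have h2 := R.ne x
    rw [hx] at h2
    omega
  have oldE : ∀ x, face 2 x = face 2 w → face 2 (x * M.simple 2) ∈ D →
      face 1 x = face 1 w ∨ face 1 x = face 1 (w * M.simple 1) := by
    intro x hx h
    rcases hold x hx (old x hx h) with rfl | rfl | rfl | rfl
    · exact Or.inl rfl
    · exact Or.inl (edge_mul0 w)
    · exact Or.inr rfl
    · exact Or.inr (edge_mul0 _)
  have hE : ∀ x, face 2 x = face 2 w → face 2 (x * M.simple 2) ∈ D \ {face 2 w} →
      face 1 x = face 1 w ∨ face 1 x = face 1 (w * M.simple 1) :=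
    fun x hx h => oldE x hx h.1
  have hV : ∀ x, face 2 x = face 2 w → face 0 x ∈ vertexSet (D \ {face 2 w}) →
      face 0 x = face 0 w ∨ face 0 x = face 0 (w * M.simple 0) ∨
        face 0 x = face 0 (w * M.simple 1 * M.simple 0) := by
    rintro x hx ⟨_, hY, y, rfl, hy⟩
    have hor : τ (face 2 (x * M.simple 2)) < τ (face 2 w) ∨
        τ (face 2 (x * M.simple 1 * M.simple 2)) < τ (face 2 w) := by
      by_contra hcon
      push Not at hcon
      have n1 := R.ne x
      have n2 := R.ne (x * M.simple 1)
      rw [tile_mul1] at n2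
      have hyx : y ≠ x := by
        rintro rfl
        exact hY.2 hx
      have hyx1 : y ≠ x * M.simple 1 := by
        rintro rfl
        exact hY.2 ((tile_mul1 x).trans hx)
      have := R.new_vertex x y (by rw [hx] at *; omega) (by rw [hx] at *; omega) hy hyx hyx1
      have hm : τ (face 2 y) ≤ τ (face 2 w) := hmax _ hY.1
      rw [hx] at this
      omega
    have key : ∀ x, face 2 x = face 2 w → τ (face 2 (x * M.simple 2)) < τ (face 2 w) →
        face 0 x = face 0 w ∨ face 0 x = face 0 (w * M.simple 0) ∨
        face 0 x = face 0 (w * M.simple 1 * M.simple 0) := by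
      intro x hx h
      rcases hold x hx h with rfl | rfl | rfl | rfl
      · exact Or.inl rfl
      · exact Or.inr (Or.inl rfl)
      · exact Or.inl (vertex_mul1 w)
      · exact Or.inr (Or.inr rfl)
    rcases hor with h | h
    · exact key x hx h
    · have := key (x * M.simple 1) (by rw [tile_mul1, hx]) h
      rwa [vertex_mul1] at this
  -- the neighbours of the tile in `D`
  have nbr : ∀ T ∈ D, (tileGraph M).Adj (face 2 w) T →
      T = face 2 (w * M.simple 2) ∨ T = face 2 (w * M.simple 1 * M.simple 2) := by
    intro T hT hadj
    obtain ⟨x, hx, rfl⟩ := hM.adj_iff.mp hadj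
    rcases hold x hx (old x hx hT) with rfl | rfl | rfl | rfl
    · exact Or.inl rfl
    · rw [hM.mul_comm02]; exact Or.inl (tile_mul0 _)
    · exact Or.inr rfl
    · rw [hM.mul_comm02]; exact Or.inr (tile_mul0 _)
  have meets : ∀ T ⊆ D \ {face 2 w}, T.Nonempty →
      (∀ A ∈ T, ∀ B ∈ D \ {face 2 w}, (tileGraph M).Adj A B → B ∈ T) →
      ∃ A ∈ T, (tileGraph M).Adj (face 2 w) A := by
    intro T hT hne hcl
    by_contra h
    push Not at h
    have := hconn T (fun A hA => (hT hA).1) hne (by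
      intro A hA B hB hadj
      by_cases hBw : B = face 2 w
      · subst hBw; exact absurd hadj.symm (h A hA)
      · exact hcl A hA B ⟨hB, hBw⟩ hadj)
    have hmem : face 2 w ∈ T := by rw [this]; exact hXD
    exact hXD' (hT hmem)
  have hX₀' : X₀ ∈ D \ {face 2 w} := ⟨hX₀, Ne.symm hXX₀⟩
  by_cases hcut : Conn (D \ {face 2 w})
  · -- the removal does not disconnect
    have hcount := hM.shared_path hXD' hcut (by rwa [hD']) hE hV (by
      obtain ⟨A, hA, hadj⟩ := meets _ le_rfl ⟨X₀, hX₀'⟩ (fun _ _ B hB _ => hB)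
      rcases nbr A hA.1 hadj with rfl | rfl
      · exact Or.inl hA
      · exact Or.inr hA)
    exact ⟨face 2 w, hXD, hXX₀, hcut, hM.holeFree_diff_singleton hhole hXD hcount.2.2, hcount⟩
  · -- the rest falls into two parts; the part `B₁` contains the root
    have hsplit : ∃ B₁ ⊆ D \ {face 2 w}, X₀ ∈ B₁ ∧ (∃ Y ∈ D \ {face 2 w}, Y ∉ B₁) ∧
        (∀ A ∈ B₁, ∀ B ∈ D \ {face 2 w}, (tileGraph M).Adj A B → B ∈ B₁) := by
      unfold Conn at hcut
      push Not at hcut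
      obtain ⟨S, hS, hSne, hcl, hSD⟩ := hcut
      by_cases h : X₀ ∈ S
      · refine ⟨S, hS, h, ?_, hcl⟩
        by_contra hcon
        push Not at hcon
        exact hSD (Set.Subset.antisymm hS hcon)
      · refine ⟨(D \ {face 2 w}) \ S, Set.sdiff_subset, ⟨hX₀', h⟩, ?_, ?_⟩
        · obtain ⟨Y, hY⟩ := hSne
          exact ⟨Y, hS hY, fun h => h.2 hY⟩
        · intro A hA B hB hadj
          exact ⟨hB, fun hBS => hA.2 (hcl B hBS A hA.1 hadj.symm)⟩
    obtain ⟨B₁, hB₁, hX₀B, ⟨Y₂, hY₂, hY₂B⟩, hcl⟩ := hsplit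
    set B₂ := (D \ {face 2 w}) \ B₁ with hB₂
    have hcl₂ : ∀ A ∈ B₂, ∀ B ∈ D \ {face 2 w}, (tileGraph M).Adj A B → B ∈ B₂ :=
      fun A hA B hB hadj => ⟨hB, fun h => hA.2 (hcl B h A hA.1 hadj.symm)⟩
    have hsub₂ : B₂ ⊆ D \ {face 2 w} := Set.sdiff_subset
    obtain ⟨A₁, hA₁, hadj₁⟩ := meets B₁ hB₁ ⟨X₀, hX₀B⟩ hcl
    obtain ⟨A₂, hA₂, hadj₂⟩ := meets B₂ hsub₂ ⟨Y₂, hY₂, hY₂B⟩ hcl₂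
    have hA12 : A₁ ≠ A₂ := by rintro rfl; exact hA₂.2 hA₁
    have nbr' : ∀ T ∈ D, (tileGraph M).Adj (face 2 w) T → T = A₁ ∨ T = A₂ := by
      intro T hT hadj
      have h1 := nbr A₁ (hB₁ hA₁).1 hadj₁
      have h2 := nbr A₂ (hsub₂ hA₂).1 hadj₂
      have h3 := nbr T hT hadj
      rcases h1 with h1 | h1 <;> rcases h2 with h2 | h2 <;> rcases h3 with h3 | h3 <;>
        first
        | exact absurd (h1.trans h2.symm) hA12
        | exact Or.inl (h3.trans h1.symm)
        | exact Or.inr (h3.trans h2.symm)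
    -- each part contains exactly one neighbour of the tile, hence is connected
    have conn_part : ∀ (B : Set (Tile M)) (A A' : Tile M), B ⊆ D \ {face 2 w} → A' ∉ B →
        (∀ T ∈ D, (tileGraph M).Adj (face 2 w) T → T = A ∨ T = A') →
        (∀ P ∈ B, ∀ Q ∈ D \ {face 2 w}, (tileGraph M).Adj P Q → Q ∈ B) → Conn B := by
      intro B A A' hB hA' hn hclB S hS hSne hSc
      have hSc' : ∀ P ∈ S, ∀ Q ∈ D \ {face 2 w}, (tileGraph M).Adj P Q → Q ∈ S :=
        fun P hP Q hQ hadj => hSc P hP Q (hclB P (hS hP) Q hQ hadj) hadj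
      have hAS : A ∈ S := by
        obtain ⟨P, hP, hadj⟩ := meets S (hS.trans hB) hSne hSc'
        rcases hn P (hB (hS hP)).1 hadj with rfl | rfl
        · exact hP
        · exact absurd (hS hP) hA'
      by_contra hne
      have hne' : (B \ S).Nonempty := by
        rw [Set.nonempty_iff_ne_empty, Ne, Set.sdiff_eq_empty]
        exact fun h => hne (Set.Subset.antisymm hS h)
      obtain ⟨P, hP, hadj⟩ := meets (B \ S) (Set.sdiff_subset.trans hB) hne' (by
        intro P hP Q hQ hadj
        exact ⟨hclB P hP.1 Q hQ hadj, fun h => hP.2 (hSc Q h P hP.1 hadj.symm)⟩)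
      rcases hn P (hB hP.1).1 hadj with rfl | rfl
      · exact hP.2 hAS
      · exact hA' hP.1
    have hconn₁ : Conn B₁ := conn_part B₁ A₁ A₂ hB₁ hA₂.2 nbr' hcl
    have hconn₂ : Conn B₂ := conn_part B₂ A₂ A₁ hsub₂ (fun h => h.2 hA₁)
      (fun T hT h => (nbr' T hT h).symm) hcl₂
    have hU : B₁ ∪ B₂ = D \ {face 2 w} := Set.union_sdiff_cancel hB₁
    have hnadj : ∀ P ∈ B₁, ∀ Q ∈ B₂, ¬ (tileGraph M).Adj P Q :=
      fun P hP Q hQ hadj => hQ.2 (hcl P hP Q hQ.1 hadj)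
    -- some edge of the tile is new, so removing the tile creates no hole
    have hholeD' : HoleFree (D \ {face 2 w}) := by
      obtain ⟨z, hz, hzF⟩ := hM.exists_edge_avoiding (face 2 w)
        {face 1 w, face 1 (w * M.simple 1)} (lt_of_le_of_lt Finset.card_le_two (by omega))
      simp only [Finset.mem_insert, Finset.mem_singleton, not_or] at hzF
      refine hhole.diff (by simpa using hXD) (conn_singleton _) rfl
        (Y := face 2 (z * M.simple 2)) (fun h => (oldE z hz h).elim hzF.1 hzF.2) ?_
      rw [← hz]
      exact hM.adj_cross z
    -- the two parts meet only at a vertex of the tile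
    have hcommon : ∀ v, v ∈ vertexSet B₁ → v ∈ vertexSet B₂ → v ∈ verts (face 2 w) := by
      intro v h1 h2
      have b0 : ∀ A ∈ D, (tileGraph M).Adj (face 2 w) A → face 0 w ∈ verts A := by
        intro A hA hadj
        rcases nbr A hA hadj with rfl | rfl
        · exact ⟨_, rfl, vertex_mul2 w⟩
        · exact ⟨_, rfl, (vertex_mul2 _).trans (vertex_mul1 w)⟩
      have := hM.shared_vertex_unique hconn₁ hconn₂ (by rwa [hU]) (fun T h h' => h'.2 h) hnadj
        h1 h2 ⟨A₁, hA₁, b0 _ (hB₁ hA₁).1 hadj₁⟩ ⟨A₂, hA₂, b0 _ (hsub₂ hA₂).1 hadj₂⟩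
      rw [this]
      exact ⟨w, rfl, rfl⟩
    -- the part `B₁` has a neighbour outside `D`
    have hout : ∃ P ∈ B₁, ∃ Q ∉ D, (tileGraph M).Adj P Q := by
      obtain ⟨T, hT, hTmax⟩ := (hfin.subset fun P hP => (hB₁ hP).1).exists_maximalFor τ B₁
        ⟨X₀, hX₀B⟩
      obtain ⟨e₁, e₂, he⟩ := exists_old_pair R T
      obtain ⟨z, hz, hzF⟩ := hM.exists_edge_avoiding T
        {e₁, e₂, face 1 w, face 1 (w * M.simple 1)}
        (lt_of_le_of_lt Finset.card_le_four (by omega))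
      simp only [Finset.mem_insert, Finset.mem_singleton, not_or] at hzF
      have hlt := he z hz hzF.1 hzF.2.1
      refine ⟨T, hT, face 2 (z * M.simple 2), fun hmem => ?_, by rw [← hz]; exact hM.adj_cross z⟩
      have hadj : (tileGraph M).Adj T (face 2 (z * M.simple 2)) := by
        rw [← hz]; exact hM.adj_cross z
      by_cases hw' : face 2 (z * M.simple 2) = face 2 w
      · have := oldE (z * M.simple 2) hw' (by rw [mul_simple_cancel, hz]; exact (hB₁ hT).1)
        rw [edge_mul2] at this
        exact this.elim hzF.2.2.1 hzF.2.2.2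
      · have hin := hcl T hT _ ⟨hmem, hw'⟩ hadj
        have := hTmax hin hlt.le
        omega
    obtain ⟨P, hP, Q, hQ, hPQ⟩ := hout
    -- recursion on the part that does not contain the root, together with the tile
    have hD₂ : D \ B₁ = B₂ ∪ {face 2 w} := by
      ext T
      constructor
      · rintro ⟨h1, h2⟩
        by_cases h : T = face 2 w
        · exact Or.inr h
        · exact Or.inl ⟨⟨h1, h⟩, h2⟩
      · rintro (h | rfl)
        · exact ⟨h.1.1, h.2⟩
        · exact ⟨hXD, fun h => hXD' (hB₁ h)⟩
    have hB₁D : B₁ ⊆ D := fun T hT => (hB₁ hT).1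
    have hconnD₂ : Conn (D \ B₁) := by
      rw [hD₂]
      exact hconn₂.union (conn_singleton _) hA₂ rfl hadj₂.symm
    obtain ⟨X', hX', hX'w, hc, hh, hcount⟩ := ih _ (by
        rw [← hn]
        exact Set.ncard_lt_ncard ⟨Set.sdiff_subset, fun h => (h hX₀).2 hX₀B⟩ hfin)
      (D := D \ B₁) (X₀ := face 2 w) (hfin.subset Set.sdiff_subset) hconnD₂
      (hhole.diff hB₁D hconn₁ hP hQ hPQ) ⟨hXD, fun h => hXD' (hB₁ h)⟩
      ⟨A₂, ⟨(hsub₂ hA₂).1, hA₂.2⟩, (hsub₂ hA₂).2⟩ rfl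
    have hX'B₂ : X' ∈ B₂ := ⟨⟨hX'.1, hX'w⟩, hX'.2⟩
    have hU' : D \ {X'} = (D \ B₁) \ {X'} ∪ B₁ := by
      ext T
      constructor
      · rintro ⟨h1, h2⟩
        by_cases h : T ∈ B₁
        · exact Or.inr h
        · exact Or.inl ⟨⟨h1, h⟩, h2⟩
      · rintro (h | h)
        · exact ⟨h.1.1, h.2⟩
        · exact ⟨hB₁D h, fun h' => hX'.2 (by rw [← h']; exact h)⟩
    have hwmem : face 2 w ∈ (D \ B₁) \ {X'} :=
      ⟨⟨hXD, fun h => hXD' (hB₁ h)⟩, fun h => hX'w h.symm⟩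
    have hsv : verts X' ∩ vertexSet (D \ {X'}) = verts X' ∩ vertexSet ((D \ B₁) \ {X'}) := by
      rw [hU']
      refine Set.Subset.antisymm ?_ ?_
      · rintro v ⟨hv, T, hT | hT, hvT⟩
        · exact ⟨hv, T, hT, hvT⟩
        · exact ⟨hv, face 2 w, hwmem, hcommon v ⟨T, hT, hvT⟩ ⟨X', hX'B₂, hv⟩⟩
      · rintro v ⟨hv, T, hT, hvT⟩
        exact ⟨hv, T, Or.inl hT, hvT⟩
    have hse : edges X' ∩ edgeSet (D \ {X'}) = edges X' ∩ edgeSet ((D \ B₁) \ {X'}) := by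
      rw [hU']
      refine Set.Subset.antisymm ?_ ?_
      · rintro e ⟨he, T, hT | hT, heT⟩
        · exact ⟨he, T, hT, heT⟩
        · refine absurd ⟨?_, e, heT, he⟩ (hnadj T hT X' hX'B₂)
          rintro rfl
          exact hX'.2 hT
      · rintro e ⟨he, T, hT, heT⟩
        exact ⟨he, T, Or.inl hT, heT⟩
    refine ⟨X', hX'.1, ?_, ?_, ?_, ?_⟩
    · rintro rfl
      exact hX'.2 hX₀B
    · rw [hU']
      exact hc.union hconn₁ hwmem hA₁ hadj₁
    · exact hM.holeFree_diff_singleton hhole hX'.1 (by rw [hse]; exact hcount.2.2)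
    · rw [hsv, hse]
      exact hcount

end IsTess

end Tessellation

/-! ### Filling holes, and counting vertices, edges and tiles -/

namespace Tessellation

open CoxeterSystem

variable {M : CoxeterMatrix (Fin 3)} {k : ℕ}

theorem conn_iff {D : Set (Tile M)} :
    ((tileGraph M).induce D).Connected ↔ Conn D ∧ D.Nonempty := by
  constructor
  · rintro h
    have hne : D.Nonempty := Set.nonempty_coe_sort.mp h.nonempty
    refine ⟨fun S hS hSne hcl => Set.Subset.antisymm hS fun Y hY => ?_, hne⟩
    obtain ⟨X, hX⟩ := hSne
    obtain ⟨p⟩ := h.preconnected ⟨X, hS hX⟩ ⟨Y, hY⟩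
    have key : ∀ (a b : D), ((tileGraph M).induce D).Walk a b → a.1 ∈ S → b.1 ∈ S := by
      intro a b p
      induction p with
      | nil => exact id
      | cons hadj _ ih => exact fun ha => ih (hcl _ ha _ (Subtype.prop _) hadj)
    exact key _ _ p hX
  · rintro ⟨h, X₀, hX₀⟩
    have key : ∀ Y (hY : Y ∈ D), ((tileGraph M).induce D).Reachable ⟨X₀, hX₀⟩ ⟨Y, hY⟩ := by
      have := h {Y | ∃ hY : Y ∈ D, ((tileGraph M).induce D).Reachable ⟨X₀, hX₀⟩ ⟨Y, hY⟩}
        (fun Y hY => hY.1) ⟨X₀, hX₀, .rfl⟩ (by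
          rintro X ⟨hX, hr⟩ Y hY hadj
          exact ⟨hY, hr.trans (SimpleGraph.Adj.reachable (G := (tileGraph M).induce D)
            (u := ⟨X, hX⟩) (v := ⟨Y, hY⟩) hadj)⟩)
      intro Y hY
      rw [← this] at hY
      exact hY.2
    have : Nonempty D := ⟨⟨X₀, hX₀⟩⟩
    exact ⟨fun a b => (key a.1 a.2).symm.trans (key b.1 b.2)⟩

theorem isPolyform_iff {A : Set (Tile M)} :
    IsPolyform A ↔ A.Finite ∧ Conn A ∧ A.Nonempty := by
  rw [IsPolyform, conn_iff]

/-- A finite union of components of the complement of `A`. -/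
structure IsGap (A S : Set (Tile M)) : Prop where
  finite : S.Finite
  notMem : ∀ X ∈ S, X ∉ A
  closed : ∀ X ∈ S, ∀ Y ∉ A, (tileGraph M).Adj X Y → Y ∈ S

theorem HoleFree.gap_eq_empty {A S : Set (Tile M)} (hA : HoleFree A) (hS : IsGap A S) : S = ∅ :=
  hA S hS.finite hS.notMem hS.closed

/-- The tiles of a component of the complement. -/
def componentTiles {A : Set (Tile M)} (C : ComplComponent A) : Set (Tile M) :=
  Subtype.val '' C.supp

theorem mem_componentTiles {A : Set (Tile M)} {Y : (Aᶜ : Set (Tile M))} :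
    Y.1 ∈ componentTiles (((tileGraph M).induce Aᶜ).connectedComponentMk Y) :=
  ⟨Y, rfl, rfl⟩

theorem finite_componentTiles {A : Set (Tile M)} {C : ComplComponent A} :
    (componentTiles C).Finite ↔ C.supp.Finite :=
  Set.finite_image_iff Subtype.val_injective.injOn

theorem componentTiles_injective {A : Set (Tile M)} :
    Function.Injective (componentTiles (A := A)) := by
  intro C C' h
  exact SimpleGraph.ConnectedComponent.supp_injective (Subtype.val_injective.image_injective h)

theorem componentTiles_nonempty {A : Set (Tile M)} (C : ComplComponent A) :
    (componentTiles C).Nonempty := C.nonempty_supp.image _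

theorem componentTiles_isGap {A : Set (Tile M)} {C : ComplComponent A} (hC : C.supp.Finite) :
    IsGap A (componentTiles C) := by
  refine ⟨finite_componentTiles.mpr hC, ?_, ?_⟩
  · rintro _ ⟨X, -, rfl⟩
    exact X.2
  · rintro _ ⟨X, hX, rfl⟩ Y hY hadj
    exact ⟨⟨Y, hY⟩, C.mem_supp_of_adj_mem_supp hX hadj, rfl⟩

theorem componentTiles_subset {A S : Set (Tile M)}
    (hS : ∀ X ∈ S, ∀ Y ∉ A, (tileGraph M).Adj X Y → Y ∈ S) {C : ComplComponent A} {X : Tile M}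
    (hX : X ∈ S) (hXC : X ∈ componentTiles C) : componentTiles C ⊆ S := by
  obtain ⟨X, hXC, rfl⟩ := hXC
  rintro _ ⟨Y, hY, rfl⟩
  obtain ⟨p⟩ := C.reachable_of_mem_supp hXC hY
  clear hXC hY
  induction p with
  | nil => exact hX
  | @cons u v w hadj _ ih => exact ih (hS u.1 hX v.1 v.2 hadj)

/-- The set `A` with its holes filled. -/
def fill (A : Set (Tile M)) : Set (Tile M) := A ∪ {X | ∃ S, IsGap A S ∧ X ∈ S}

theorem subset_fill (A : Set (Tile M)) : A ⊆ fill A := Set.subset_union_left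

theorem fill_closed {A : Set (Tile M)} {X Y : Tile M} (hX : X ∈ fill A) (hXA : X ∉ A)
    (hadj : (tileGraph M).Adj X Y) : Y ∈ fill A := by
  by_cases hY : Y ∈ A
  · exact subset_fill A hY
  · obtain ⟨S, hS, hXS⟩ := hX.resolve_left hXA
    exact Or.inr ⟨S, hS, hS.closed X hXS Y hY hadj⟩

/-- The edges between `D` and its complement. -/
def bdry (D : Set (Tile M)) : Set (Edge M) :=
  {e | (∃ X ∈ D, e ∈ edges X) ∧ ∃ Y, Y ∉ D ∧ e ∈ edges Y}

theorem outerEdges_eq (A : Set (Tile M)) : outerEdges A = bdry (fill A) := by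
  ext e
  constructor
  · rintro ⟨⟨X, hX, he⟩, Y, hYe, hinf⟩
    refine ⟨⟨X, subset_fill A hX, he⟩, Y, ?_, hYe⟩
    rintro (h | ⟨S, hS, hYS⟩)
    · exact Y.2 h
    · refine hinf (finite_componentTiles.mp (hS.finite.subset ?_))
      exact componentTiles_subset hS.closed hYS mem_componentTiles
  · rintro ⟨⟨X, hX, he⟩, Y, hY, hYe⟩
    have hXY : X ≠ Y := by
      rintro rfl
      exact hY hX
    have hYA : Y ∉ A := fun h => hY (subset_fill A h)
    refine ⟨⟨X, ?_, he⟩, ⟨Y, hYA⟩, hYe, fun hfin => ?_⟩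
    · by_contra hXA
      exact hY (fill_closed hX hXA ⟨hXY, e, he, hYe⟩)
    · exact hY (Or.inr ⟨_, componentTiles_isGap hfin, mem_componentTiles (Y := ⟨Y, hYA⟩)⟩)

theorem vertexSet_singleton (X : Tile M) : vertexSet {X} = verts X := by
  ext v
  simp [vertexSet, verts]

theorem edgeSet_singleton (X : Tile M) : edgeSet {X} = edges X := by
  ext v
  simp [edgeSet, edges]

theorem vertexSet_union (A B : Set (Tile M)) : vertexSet (A ∪ B) = vertexSet A ∪ vertexSet B := by
  ext v
  simp [vertexSet, or_and_right, exists_or]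

theorem edgeSet_union (A B : Set (Tile M)) : edgeSet (A ∪ B) = edgeSet A ∪ edgeSet B := by
  ext v
  simp [edgeSet, or_and_right, exists_or]

/-- The tiles at a vertex form a cycle in which consecutive tiles are adjacent. -/
theorem IsTess.mem_of_around (hM : IsTess M k) {T : Set (Tile M)} {v : Vertex M}
    (hcl : ∀ X ∈ T, v ∈ verts X → ∀ Y, v ∈ verts Y → (tileGraph M).Adj X Y → Y ∈ T)
    {X : Tile M} (hX : X ∈ T) (hv : v ∈ verts X) {Y : Tile M} (hY : v ∈ verts Y) : Y ∈ T := by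
  obtain ⟨x, rfl, rfl⟩ := hv
  obtain ⟨n, -, rfl⟩ := hM.mem_verts_iff_rot.mp hY
  clear hY
  induction n with
  | zero => simpa using hX
  | succ n ih =>
    have hadj := hM.adj_cross (x * rotVertex M ^ n * M.simple 1)
    rw [tile_mul1] at hadj
    have e : x * rotVertex M ^ (n + 1) = x * rotVertex M ^ n * M.simple 1 * M.simple 2 := by
      rw [pow_succ, rotVertex, ← mul_assoc, ← mul_assoc]
    rw [e]
    refine hcl _ ih ⟨_, rfl, vertex_rot x n⟩ _ ⟨_, rfl, ?_⟩ hadj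
    rw [← e]
    exact vertex_rot x _

/-- A vertex of a gap that is not a vertex of `A` is surrounded by the gap. -/
theorem IsGap.surrounds (hM : IsTess M k) {A S : Set (Tile M)} (hS : IsGap A S) {X : Tile M}
    (hX : X ∈ S) {v : Vertex M} (hv : v ∈ verts X) (hvA : v ∉ vertexSet A) {Y : Tile M}
    (hY : v ∈ verts Y) : Y ∈ S :=
  hM.mem_of_around (fun X hX _ Y hvY hadj => hS.closed X hX Y (fun hYA => hvA ⟨Y, hYA, hvY⟩) hadj)
    hX hv hY

namespace IsTess

variable (hM : IsTess M k)
include hM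

theorem finite_vertexSet {A : Set (Tile M)} (hA : A.Finite) : (vertexSet A).Finite := by
  have : vertexSet A = ⋃ X ∈ A, verts X := by
    ext v
    simp [vertexSet, verts]
  rw [this]
  exact hA.biUnion fun X _ => hM.finite_verts X

theorem finite_edgeSet {A : Set (Tile M)} (hA : A.Finite) : (edgeSet A).Finite := by
  have : edgeSet A = ⋃ X ∈ A, edges X := by
    ext v
    simp [edgeSet]
  rw [this]
  exact hA.biUnion fun X _ => hM.finite_edges X

/-- The filled set is finite: the tile of maximal rank in a gap has an edge to a tile of larger
rank, which belongs to `A`. -/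
theorem finite_fill {A : Set (Tile M)} (hA : A.Finite) : (fill A).Finite := by
  obtain ⟨τ, R⟩ := hM.exists_rootedRank (face 2 1)
  obtain ⟨n, hn⟩ := (hA.image τ).bddAbove
  have hn : ∀ X ∈ A, τ X ≤ n := fun X hX => hn ⟨X, hX, rfl⟩
  refine (R.finite_le n).subset ?_
  rintro X (hX | ⟨S, hS, hX⟩)
  · exact hn X hX
  · obtain ⟨Y, hY, hmax⟩ := hS.finite.exists_maximalFor τ S ⟨X, hX⟩
    obtain ⟨e₁, e₂, h⟩ := exists_old_pair R Y
    classical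
    obtain ⟨z, rfl, hzF⟩ := hM.exists_edge_avoiding Y {e₁, e₂}
      (lt_of_le_of_lt Finset.card_le_two (by have := hM.hk; omega))
    simp only [Finset.mem_insert, Finset.mem_singleton, not_or] at hzF
    have hlt := h z rfl hzF.1 hzF.2
    have hXY : τ X ≤ τ (face 2 z) := by
      by_contra hc
      exact hc (hmax hX (by omega))
    have hmem : face 2 (z * M.simple 2) ∈ A := by
      by_contra hc
      have := hmax (hS.closed _ hY _ hc (hM.adj_cross z)) hlt.le
      omega
    have := hn _ hmem
    change τ X ≤ n
    omega

theorem not_adj_closed {S : Set (Tile M)} (hfin : S.Finite)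
    (hcl : ∀ X ∈ S, ∀ Y, (tileGraph M).Adj X Y → Y ∈ S) : S = ∅ := by
  by_contra hne
  obtain ⟨x, hx, hx'⟩ := hM.exists_boundary_flag hfin (Set.nonempty_iff_ne_empty.mpr hne)
  exact hx' (hcl _ hx _ (hM.adj_cross x))

theorem holeFree_fill {A : Set (Tile M)} (hA : A.Finite) : HoleFree (fill A) := by
  intro S hfin hS hcl
  have hgap : IsGap A (S ∪ (fill A \ A)) := by
    refine ⟨hfin.union ((hM.finite_fill hA).subset Set.sdiff_subset), ?_, ?_⟩
    · rintro X (hX | hX)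
      · exact fun h => hS X hX (subset_fill A h)
      · exact hX.2
    · rintro X (hX | hX) Y hY hadj
      · by_cases h : Y ∈ fill A
        · exact Or.inr ⟨h, hY⟩
        · exact Or.inl (hcl X hX Y h hadj)
      · exact Or.inr ⟨fill_closed hX.1 hX.2 hadj, hY⟩
  refine Set.eq_empty_of_forall_notMem fun X hX => ?_
  exact hS X hX (Or.inr ⟨_, hgap, Or.inl hX⟩)

theorem conn_fill {A : Set (Tile M)} (hfin : A.Finite) (hA : Conn A) : Conn (fill A) := by
  intro T hT hne hcl
  have hfill := hM.finite_fill hfin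
  have hTA : (T ∩ A).Nonempty := by
    by_contra h
    refine hne.ne_empty (hM.not_adj_closed (hfill.subset hT) fun X hX Y hadj => ?_)
    exact hcl X hX Y (fill_closed (hT hX) (fun hXA => h ⟨X, hX, hXA⟩) hadj) hadj
  have hAT : A ⊆ T := Set.inter_eq_right.mp (hA _ Set.inter_subset_right hTA
    fun X hX Y hY hadj => ⟨hcl X hX.1 Y (subset_fill A hY) hadj, hY⟩)
  have h0 := hM.not_adj_closed (hfill.subset (Set.sdiff_subset (s := fill A) (t := T)))
    fun X hX Y hadj => by
      have hY := fill_closed hX.1 (fun h => hX.2 (hAT h)) hadj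
      exact ⟨hY, fun hYT => hX.2 (hcl Y hYT X hX.1 hadj.symm)⟩
  exact Set.Subset.antisymm hT (Set.sdiff_eq_empty.mp h0)

/-- Euler's formula for a connected set of tiles without holes. -/
theorem euler {D : Set (Tile M)} (hfin : D.Finite) (hconn : Conn D) (hhole : HoleFree D)
    (hne : D.Nonempty) :
    (vertexSet D).ncard + D.ncard = (edgeSet D).ncard + 1 := by
  induction hn : D.ncard using Nat.strong_induction_on generalizing D with
  | _ n ih =>
  obtain ⟨X₀, hX₀⟩ := hne
  by_cases h : ∃ X ∈ D, X ≠ X₀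
  · obtain ⟨X, hX, -, hc, hh, hcount, h1, -⟩ := hM.exists_peel hfin hconn hhole hX₀ h
    have hfin' : (D \ {X}).Finite := hfin.subset Set.sdiff_subset
    have hcard := Set.ncard_sdiff_singleton_add_one hX hfin
    have hne' : (D \ {X}).Nonempty := by
      obtain ⟨e, -, Y, hY, -⟩ := Set.nonempty_of_ncard_ne_zero (Nat.one_le_iff_ne_zero.mp h1)
      exact ⟨Y, hY⟩
    have hD : D = {X} ∪ D \ {X} := by rw [Set.union_sdiff_cancel (by simpa using hX)]
    have hE := ih _ (by omega) hfin' hc hh hne' rfl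
    have hv := Set.ncard_union_add_ncard_inter (verts X) (vertexSet (D \ {X}))
      (hM.finite_verts X) (hM.finite_vertexSet hfin')
    have he := Set.ncard_union_add_ncard_inter (edges X) (edgeSet (D \ {X}))
      (hM.finite_edges X) (hM.finite_edgeSet hfin')
    rw [← vertexSet_singleton, ← vertexSet_union, ← hD, vertexSet_singleton, hM.ncard_verts] at hv
    rw [← edgeSet_singleton, ← edgeSet_union, ← hD, edgeSet_singleton, hM.ncard_edges] at he
    omega
  · push Not at h
    have hD : D = {X₀} := by
      refine Set.Subset.antisymm h ?_
      simpa using hX₀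
    rw [hD, vertexSet_singleton, edgeSet_singleton, hM.ncard_verts, hM.ncard_edges, ← hn, hD,
      Set.ncard_singleton]

/-- Every tile has `2k` edges, and every edge lies on two tiles, of which one or both are in
`D`. -/
theorem two_mul_edges {D : Set (Tile M)} (hfin : D.Finite) :
    2 * (edgeSet D).ncard = 2 * k * D.ncard + (bdry D).ncard := by
  classical
  have hE := hM.finite_edgeSet hfin
  have hsub : bdry D ⊆ edgeSet D := fun e he => he.1
  have hB := hE.subset hsub
  have hdc := Finset.sum_card_bipartiteAbove_eq_sum_card_bipartiteBelow (s := hfin.toFinset)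
    (t := hE.toFinset) (fun X e => e ∈ edges X)
  have h1 : ∀ X ∈ hfin.toFinset,
      (Finset.bipartiteAbove (fun X e => e ∈ edges X) hE.toFinset X).card = 2 * k := by
    intro X hX
    rw [← hM.ncard_edges X, ← Set.ncard_coe_finset]
    congr 1
    ext e
    simp only [Finset.coe_bipartiteAbove, Set.Finite.mem_toFinset, Set.mem_ofPred_eq]
    exact ⟨fun h => h.2, fun h => ⟨⟨X, by simpa using hX, h⟩, h⟩⟩
  have h2 : ∀ e ∈ hE.toFinset,
      (Finset.bipartiteBelow (fun X e => e ∈ edges X) hfin.toFinset e).card +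
        (if e ∈ bdry D then 1 else 0) = 2 := by
    intro e he
    obtain ⟨X, hX, x, rfl, rfl⟩ : e ∈ edgeSet D := by simpa using he
    have hne := hM.tile_ne x
    by_cases h : face 2 (x * M.simple 2) ∈ D
    · have h3 : face 1 x ∉ bdry D := by
        rintro ⟨-, Y, hY, hYe⟩
        rcases hM.mem_edges_iff.mp hYe with rfl | rfl
        · exact hY hX
        · exact hY h
      have h4 : Finset.bipartiteBelow (fun X e => e ∈ edges X) hfin.toFinset (face 1 x) =
          {face 2 x, face 2 (x * M.simple 2)} := by
        ext Y
        simp only [Finset.mem_bipartiteBelow, Set.Finite.mem_toFinset, Finset.mem_insert,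
          Finset.mem_singleton, hM.mem_edges_iff]
        constructor
        · exact fun h => h.2
        · rintro (rfl | rfl)
          · exact ⟨hX, Or.inl rfl⟩
          · exact ⟨h, Or.inr rfl⟩
      rw [if_neg h3, h4, Finset.card_pair hne.symm]
    · have h3 : face 1 x ∈ bdry D := ⟨⟨_, hX, x, rfl, rfl⟩, _, h, _, rfl, edge_mul2 x⟩
      have h4 : Finset.bipartiteBelow (fun X e => e ∈ edges X) hfin.toFinset (face 1 x) =
          {face 2 x} := by
        ext Y
        simp only [Finset.mem_bipartiteBelow, Set.Finite.mem_toFinset,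
          Finset.mem_singleton, hM.mem_edges_iff]
        constructor
        · rintro ⟨hY, rfl | rfl⟩
          · rfl
          · exact absurd hY h
        · rintro rfl
          exact ⟨hX, Or.inl rfl⟩
      rw [if_pos h3, h4, Finset.card_singleton]
  rw [Finset.sum_congr rfl h1, Finset.sum_const, smul_eq_mul] at hdc
  have h3 := Finset.sum_congr rfl h2
  rw [Finset.sum_add_distrib, ← hdc, Finset.sum_const, smul_eq_mul, ← Finset.card_filter] at h3
  rw [Set.ncard_eq_toFinset_card _ hE, Set.ncard_eq_toFinset_card _ hfin,
    Set.ncard_eq_toFinset_card _ hB]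
  have h4 : hE.toFinset.filter (· ∈ bdry D) = hB.toFinset := by
    ext e
    simp only [Finset.mem_filter, Set.Finite.mem_toFinset]
    exact ⟨fun h => h.2, fun h => ⟨hsub h, h⟩⟩
  rw [h4] at h3
  linarith

/-- The number of vertices in terms of the perimeter. -/
theorem two_mul_vertices {D : Set (Tile M)} (hfin : D.Finite) (hconn : Conn D)
    (hhole : HoleFree D) (hne : D.Nonempty) :
    2 * vertexCount D + 2 * D.ncard = 2 * k * D.ncard + (bdry D).ncard + 2 := by
  have h1 := hM.euler hfin hconn hhole hne
  have h2 := hM.two_mul_edges hfin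
  rw [vertexCount]
  omega

/-- Peeling off a tile removes at least `2k - 3` vertices. -/
theorem minVertices_add_le {n : ℕ} (hn : 1 ≤ n) (m : ℕ) {B : Set (Tile M)} (hfin : B.Finite)
    (hconn : Conn B) (hhole : HoleFree B) (hcard : B.ncard = n + m) :
    minVertices M n + 2 * k * m ≤ vertexCount B + 3 * m := by
  induction m generalizing B with
  | zero =>
    have hne : B.Nonempty := Set.nonempty_of_ncard_ne_zero (by omega)
    have h : minVertices M n ≤ vertexCount B :=
      Nat.sInf_le ⟨B, isPolyform_iff.mpr ⟨hfin, hconn, hne⟩, hcard, rfl⟩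
    simpa using h
  | succ m ih =>
    obtain ⟨X₀, hX₀, X, hX, hne⟩ := (Set.one_lt_ncard hfin).mp (show 1 < B.ncard by omega)
    obtain ⟨X, hX, -, hc, hh, hcount, -, h2⟩ :=
      hM.exists_peel hfin hconn hhole hX₀ ⟨X, hX, hne.symm⟩
    have hfin' : (B \ {X}).Finite := hfin.subset Set.sdiff_subset
    have hcard' := Set.ncard_sdiff_singleton_add_one hX hfin
    have hB : B = {X} ∪ B \ {X} := by rw [Set.union_sdiff_cancel (by simpa using hX)]
    have := ih hfin' hc hh (by omega)
    have hv := Set.ncard_union_add_ncard_inter (verts X) (vertexSet (B \ {X}))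
      (hM.finite_verts X) (hM.finite_vertexSet hfin')
    rw [← vertexSet_singleton, ← vertexSet_union, ← hB, vertexSet_singleton, hM.ncard_verts] at hv
    rw [vertexCount] at *
    rw [mul_add, mul_add]
    omega

/-- Adding tiles whose new vertices are surrounded by new tiles adds at most two vertices per
tile, as `k` tiles with `2k` vertices meet at each new vertex. -/
theorem vertexCount_union_le {A S : Set (Tile M)} (hS : S.Finite)
    (h : ∀ X ∈ S, ∀ v ∈ verts X, v ∉ vertexSet A → ∀ Y, v ∈ verts Y → Y ∈ S) :
    vertexCount (A ∪ S) ≤ vertexCount A + 2 * S.ncard := by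
  classical
  have hU : (vertexSet S \ vertexSet A).Finite :=
    (hM.finite_vertexSet hS).subset Set.sdiff_subset
  have hdc := Finset.sum_card_bipartiteAbove_eq_sum_card_bipartiteBelow (s := hS.toFinset)
    (t := hU.toFinset) (fun X v => v ∈ verts X)
  have h1 : ∀ X ∈ hS.toFinset,
      (Finset.bipartiteAbove (fun X v => v ∈ verts X) hU.toFinset X).card ≤ 2 * k := by
    intro X _
    rw [← hM.ncard_verts X, ← Set.ncard_coe_finset]
    refine Set.ncard_le_ncard ?_ (hM.finite_verts X)
    intro v hv
    exact ((Finset.mem_bipartiteAbove _).mp hv).2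
  have h2 : ∀ v ∈ hU.toFinset,
      (Finset.bipartiteBelow (fun X v => v ∈ verts X) hS.toFinset v).card = k := by
    intro v hv
    obtain ⟨⟨X, hX, hXv⟩, hvA⟩ : v ∈ vertexSet S \ vertexSet A := by simpa using hv
    rw [← hM.ncard_tiles_at v, ← Set.ncard_coe_finset]
    congr 1
    ext Y
    simp only [Finset.coe_bipartiteBelow, Set.Finite.mem_toFinset, Set.mem_ofPred_eq]
    exact ⟨fun h => h.2, fun hY => ⟨h X hX v hXv hvA Y hY, hY⟩⟩
  rw [Finset.sum_congr rfl h2, Finset.sum_const, smul_eq_mul] at hdc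
  have h3 := Finset.sum_le_card_nsmul _ _ _ h1
  rw [hdc, smul_eq_mul, ← Set.ncard_eq_toFinset_card _ hU, ← Set.ncard_eq_toFinset_card _ hS] at h3
  have h4 : (vertexSet S \ vertexSet A).ncard ≤ 2 * S.ncard := by
    refine Nat.le_of_mul_le_mul_right ?_ hM.pos
    calc _ ≤ _ := h3
      _ = _ := by ring
  rw [vertexCount, vertexSet_union, ← Set.union_sdiff_self]
  exact (Set.ncard_union_le _ _).trans (Nat.add_le_add_left h4 _)

theorem ncard_fill {A : Set (Tile M)} (hA : A.Finite) :
    (fill A).ncard = A.ncard + (fill A \ A).ncard := by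
  have := Set.ncard_sdiff_add_ncard_of_subset (subset_fill A) (hM.finite_fill hA)
  omega

theorem vertexCount_fill_le {A : Set (Tile M)} (hA : A.Finite) :
    vertexCount (fill A) ≤ vertexCount A + 2 * (fill A \ A).ncard := by
  have h := hM.vertexCount_union_le ((hM.finite_fill hA).subset
    (Set.sdiff_subset (s := fill A) (t := A))) (by
      rintro X ⟨hX, hXA⟩ v hv hvA Y hY
      obtain ⟨S, hS, hXS⟩ := hX.resolve_left hXA
      have hYS := hS.surrounds hM hXS hv hvA hY
      exact ⟨Or.inr ⟨S, hS, hYS⟩, hS.notMem Y hYS⟩)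
  rwa [Set.union_sdiff_cancel (subset_fill A)] at h

/-- `minVertices_add_le` without the assumption on holes. -/
theorem minVertices_add_le_of_polyform {n : ℕ} (hn : 1 ≤ n) (m : ℕ) {B : Set (Tile M)}
    (hB : IsPolyform B) (hcard : B.ncard = n + m) :
    minVertices M n + 2 * k * m ≤ vertexCount B + 3 * m := by
  obtain ⟨hfin, hconn, hne⟩ := isPolyform_iff.mp hB
  have h1 := hM.ncard_fill hfin
  have h2 := hM.vertexCount_fill_le hfin
  have h3 := hM.minVertices_add_le hn (m + (fill B \ B).ncard) (hM.finite_fill hfin)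
    (hM.conn_fill hfin hconn) (hM.holeFree_fill hfin) (by omega)
  have hk := hM.hk
  have h4 : 5 * (fill B \ B).ncard ≤ 2 * k * (fill B \ B).ncard :=
    Nat.mul_le_mul_right _ (by omega)
  rw [mul_add, mul_add] at h3
  omega

theorem exists_polyform {n : ℕ} (hn : 1 ≤ n) :
    ∃ A : Set (Tile M), IsPolyform A ∧ A.ncard = n := by
  induction n, hn using Nat.le_induction with
  | base =>
    exact ⟨{face 2 1}, isPolyform_iff.mpr ⟨Set.finite_singleton _, conn_singleton _,
      Set.singleton_nonempty _⟩, Set.ncard_singleton _⟩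
  | succ n hn ih =>
    obtain ⟨A, hA, hcard⟩ := ih
    obtain ⟨hfin, hconn, hne⟩ := isPolyform_iff.mp hA
    obtain ⟨x, hx, hx'⟩ := hM.exists_boundary_flag hfin hne
    refine ⟨A ∪ {face 2 (x * M.simple 2)}, isPolyform_iff.mpr ⟨hfin.union
      (Set.finite_singleton _), hconn.union (conn_singleton _) hx rfl (hM.adj_cross x),
      hne.inl⟩, ?_⟩
    rw [Set.union_singleton, Set.ncard_insert_of_notMem hx' hfin, hcard]

end IsTess

end Tessellation

/-! ### Polyforms with as few vertices as possible -/

namespace Tessellation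

open CoxeterSystem

variable {M : CoxeterMatrix (Fin 3)} {k : ℕ}

/-- Every vertex of a tile of `S` that is not a vertex of `A` is surrounded by tiles of `S`. -/
def Surrounded (A S : Set (Tile M)) : Prop :=
  ∀ X ∈ S, ∀ v ∈ verts X, v ∉ vertexSet A → ∀ Y, v ∈ verts Y → Y ∈ S

theorem HoleFree.fill_eq {A : Set (Tile M)} (hA : HoleFree A) : fill A = A := by
  refine Set.Subset.antisymm ?_ (subset_fill A)
  rintro X (hX | ⟨S, hS, hX⟩)
  · exact hX
  · rw [hA.gap_eq_empty hS] at hX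
    exact hX.elim

theorem IsExtremal.outerPerimeter_eq {A : Set (Tile M)} (hA : IsExtremal A) :
    outerPerimeter A = minPerimeter M A.ncard := by
  refine le_antisymm ?_ (Nat.sInf_le ⟨A, hA.1, rfl, rfl⟩)
  obtain ⟨B, hB, hcard, hP⟩ := Nat.sInf_mem (s := {m | ∃ B : Set (Tile M), IsPolyform B ∧
    B.ncard = A.ncard ∧ outerPerimeter B = m}) ⟨_, A, hA.1, rfl, rfl⟩
  rw [minPerimeter, ← hP]
  exact hA.2 B hB hcard

namespace IsTess

variable (hM : IsTess M k)
include hM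

/-- A new tile shares the two ends of an edge with its neighbour. -/
theorem vertexCount_insert_le {C : Set (Tile M)} (hC : C.Finite) {X Y : Tile M} (hX : X ∈ C)
    (hadj : (tileGraph M).Adj X Y) :
    vertexCount (C ∪ {Y}) + 2 ≤ vertexCount C + 2 * k := by
  obtain ⟨x, rfl, rfl⟩ := hM.adj_iff.mp hadj
  have h := Set.ncard_union_add_ncard_inter (vertexSet C) (verts (face 2 (x * M.simple 2)))
    (hM.finite_vertexSet hC) (hM.finite_verts _)
  have h2 : ({face 0 x, face 0 (x * M.simple 0)} : Set (Vertex M)) ⊆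
      vertexSet C ∩ verts (face 2 (x * M.simple 2)) := by
    rintro v (rfl | rfl)
    · exact ⟨⟨_, hX, x, rfl, rfl⟩, _, rfl, vertex_mul2 x⟩
    · refine ⟨⟨_, hX, x * M.simple 0, tile_mul0 x, rfl⟩, x * M.simple 2 * M.simple 0,
        tile_mul0 _, ?_⟩
      rw [← hM.mul_comm02]
      exact vertex_mul2 _
  have h3 := Set.ncard_le_ncard h2 ((hM.finite_verts _).inter_of_right _)
  rw [Set.ncard_pair (hM.vertex_ne x).symm] at h3
  rw [vertexCount, vertexCount, vertexSet_union, vertexSet_singleton]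
  rw [hM.ncard_verts] at h
  omega

/-- A minimal surrounded set is connected, and shares a vertex with `A`. -/
theorem exists_conn_surrounded {A S : Set (Tile M)} (hfin : S.Finite) (hne : S.Nonempty)
    (hS : ∀ X ∈ S, X ∉ A) (h : Surrounded A S) :
    ∃ T : Set (Tile M), T.Finite ∧ Conn T ∧ (∀ X ∈ T, X ∉ A) ∧ Surrounded A T ∧
      ∃ X ∈ T, ∃ v ∈ verts X, v ∈ vertexSet A := by
  induction hn : S.ncard using Nat.strong_induction_on generalizing S with
  | _ n ih =>
  by_cases hc : Conn S
  · refine ⟨S, hfin, hc, hS, h, ?_⟩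
    by_contra hno
    push Not at hno
    refine hne.ne_empty (hM.not_adj_closed hfin fun X hX Y hadj => ?_)
    obtain ⟨x, rfl, rfl⟩ := hM.adj_iff.mp hadj
    exact h _ hX (face 0 x) ⟨x, rfl, rfl⟩ (hno _ hX _ ⟨x, rfl, rfl⟩) _ ⟨_, rfl, vertex_mul2 x⟩
  · rw [Conn] at hc
    push Not at hc
    obtain ⟨T, hTS, hTne, hcl, hneq⟩ := hc
    refine ih _ ?_ (hfin.subset hTS) hTne (fun X hX => hS X (hTS hX)) ?_ rfl
    · rw [← hn]
      exact Set.ncard_lt_ncard (hTS.ssubset_of_ne hneq) hfin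
    · intro X hX v hv hvA Y hY
      exact hM.mem_of_around
        (fun Z hZ hvZ W hvW hadj => hcl Z hZ W (h Z (hTS hZ) v hvZ hvA W hvW) hadj) hX hv hY

/-- If a polyform `A` has as few vertices as possible, no finite set outside `A` is surrounded: such
a set, together with at most `k - 2` tiles that connect it to `A` around a common vertex, would add
too few vertices. -/
theorem not_surrounded {A S : Set (Tile M)} (hA : IsPolyform A)
    (hmin : vertexCount A = minVertices M A.ncard) (hfin : S.Finite) (hne : S.Nonempty)
    (hS : ∀ X ∈ S, X ∉ A) (h : Surrounded A S) : False := by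
  obtain ⟨T, hT, hTc, hTA, hTs, X, hX, v, ⟨x, rfl, rfl⟩, hvA⟩ :=
    hM.exists_conn_surrounded hfin hne hS h
  obtain ⟨hAfin, hAc, hAne⟩ := isPolyform_iff.mp hA
  have hex : ∃ i, i < k ∧ face 2 (x * rotVertex M ^ i) ∈ A := by
    obtain ⟨Y, hY, hv⟩ := hvA
    obtain ⟨i, hi, rfl⟩ := hM.mem_verts_iff_rot.mp hv
    exact ⟨i, hi, hY⟩
  classical
  obtain ⟨i, ⟨hik, hiA⟩, hfirst⟩ : ∃ i, (i < k ∧ face 2 (x * rotVertex M ^ i) ∈ A) ∧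
      ∀ j < i, face 2 (x * rotVertex M ^ j) ∉ A :=
    ⟨Nat.find hex, Nat.find_spec hex, fun j hj hmem =>
      Nat.find_min hex hj ⟨lt_trans hj (Nat.find_spec hex).1, hmem⟩⟩
  have hadj : ∀ j, (tileGraph M).Adj (face 2 (x * rotVertex M ^ j))
      (face 2 (x * rotVertex M ^ (j + 1))) := by
    intro j
    have := hM.adj_cross (x * rotVertex M ^ j * M.simple 1)
    rwa [tile_mul1, show x * rotVertex M ^ j * M.simple 1 * M.simple 2 =
      x * rotVertex M ^ (j + 1) by rw [pow_succ, rotVertex, ← mul_assoc, ← mul_assoc]] at this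
  have key : ∀ t < i, ∃ (B : Set (Tile M)) (j : ℕ), j ≤ t ∧ B.Finite ∧ Conn B ∧ (∀ X ∈ B, X ∉ A) ∧
      face 2 (x * rotVertex M ^ t) ∈ B ∧ B.ncard = T.ncard + j ∧
      vertexCount (A ∪ B) + 2 * j ≤ vertexCount A + 2 * T.ncard + 2 * k * j := by
    intro t
    induction t with
    | zero =>
      intro _
      refine ⟨T, 0, le_rfl, hT, hTc, hTA, by simpa using hX, rfl, ?_⟩
      simpa using hM.vertexCount_union_le hT hTs
    | succ t ih =>
      intro ht
      obtain ⟨B, j, hj, hB, hBc, hBA, hmem, hcard, hV⟩ := ih (by omega)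
      by_cases hnew : face 2 (x * rotVertex M ^ (t + 1)) ∈ B
      · exact ⟨B, j, by omega, hB, hBc, hBA, hnew, hcard, hV⟩
      · refine ⟨B ∪ {face 2 (x * rotVertex M ^ (t + 1))}, j + 1, by omega,
          hB.union (Set.finite_singleton _), hBc.union (conn_singleton _) hmem rfl (hadj t), ?_,
          Or.inr rfl, ?_, ?_⟩
        · rintro Z (hZ | rfl)
          · exact hBA Z hZ
          · exact hfirst _ ht
        · rw [Set.union_singleton, Set.ncard_insert_of_notMem hnew hB, hcard, add_assoc]
        · have := hM.vertexCount_insert_le (hAfin.union hB) (Or.inr hmem) (hadj t)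
          rw [← Set.union_assoc, mul_add, mul_add]
          omega
  have hi0 : i ≠ 0 := by
    rintro rfl
    rw [pow_zero, mul_one] at hiA
    exact hTA _ hX hiA
  obtain ⟨B, j, hj, hB, hBc, hBA, hmem, hcard, hV⟩ := key (i - 1) (by omega)
  have hadj' := hadj (i - 1)
  rw [show i - 1 + 1 = i by omega] at hadj'
  have hdisj : Disjoint A B := Set.disjoint_right.mpr hBA
  have hAB : (A ∪ B).ncard = A.ncard + (T.ncard + j) := by
    rw [Set.ncard_union_eq hdisj hAfin hB, hcard]
  have h1 := hM.minVertices_add_le_of_polyform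
    ((Set.ncard_pos hAfin).mpr hAne : 1 ≤ A.ncard) (T.ncard + j)
    (isPolyform_iff.mpr ⟨hAfin.union hB, hAc.union hBc hiA hmem hadj'.symm, hAne.inl⟩) hAB
  have hT1 : 1 ≤ T.ncard := (Set.ncard_pos hT).mpr ⟨_, hX⟩
  have hk := hM.hk
  rw [← hmin, mul_add, mul_add] at h1
  -- the counts give `(2k - 5) |T| ≤ j ≤ k - 2`, which is impossible for `k > 3`
  have h2 : k * 1 + 4 * T.ncard ≤ k * T.ncard + 4 := by nlinarith
  have h3 : 2 * k * T.ncard = 2 * (k * T.ncard) := by ring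
  omega

theorem holeFree_of_minimal {A : Set (Tile M)} (hA : IsPolyform A)
    (hmin : vertexCount A = minVertices M A.ncard) : HoleFree A := by
  intro S hfin hS hcl
  by_contra hne
  refine hM.not_surrounded hA hmin hfin (Set.nonempty_iff_ne_empty.mpr hne) hS ?_
  intro X hX v hv hvA Y hY
  exact IsGap.surrounds hM ⟨hfin, hS, hcl⟩ hX hv hvA hY

theorem outerPerimeter_of_minimal {A : Set (Tile M)} (hA : IsPolyform A)
    (hmin : vertexCount A = minVertices M A.ncard) :
    2 * vertexCount A + 2 * A.ncard = 2 * k * A.ncard + outerPerimeter A + 2 := by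
  obtain ⟨hfin, hconn, hne⟩ := isPolyform_iff.mp hA
  have hhole := hM.holeFree_of_minimal hA hmin
  rw [outerPerimeter, outerEdges_eq, hhole.fill_eq]
  exact hM.two_mul_vertices hfin hconn hhole hne

/-- A polyform with as few vertices as possible is extremal. Filling the holes of a competitor does
not change its outer perimeter. -/
theorem isExtremal_of_minimal {A : Set (Tile M)} (hA : IsPolyform A)
    (hmin : vertexCount A = minVertices M A.ncard) : IsExtremal A := by
  refine ⟨hA, fun B hB hcard => ?_⟩
  obtain ⟨hAfin, -, hAne⟩ := isPolyform_iff.mp hA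
  obtain ⟨hfin, hconn, hne⟩ := isPolyform_iff.mp hB
  have h1 := hM.outerPerimeter_of_minimal hA hmin
  have h2 := hM.two_mul_vertices (hM.finite_fill hfin) (hM.conn_fill hfin hconn)
    (hM.holeFree_fill hfin) (hne.mono (subset_fill B))
  have h3 := hM.ncard_fill hfin
  have h4 := hM.minVertices_add_le ((Set.ncard_pos hAfin).mpr hAne : 1 ≤ A.ncard)
    (fill B \ B).ncard (hM.finite_fill hfin) (hM.conn_fill hfin hconn) (hM.holeFree_fill hfin)
    (by omega)
  rw [← hmin] at h4
  rw [← outerEdges_eq, ← outerPerimeter, h3, hcard, mul_add, mul_add] at h2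
  have hk := hM.hk
  have h5 : 4 * (fill B \ B).ncard ≤ 2 * k * (fill B \ B).ncard :=
    Nat.mul_le_mul_right _ (by omega)
  omega

theorem exists_minimal {n : ℕ} (hn : 1 ≤ n) : ∃ A : Set (Tile M),
    IsPolyform A ∧ A.ncard = n ∧ vertexCount A = minVertices M n := by
  obtain ⟨A, hA, hcard⟩ := hM.exists_polyform hn
  exact Nat.sInf_mem (s := {m | ∃ A : Set (Tile M), IsPolyform A ∧ A.ncard = n ∧
    vertexCount A = m}) ⟨_, A, hA, hcard, rfl⟩

end IsTess

end Tessellation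

/-! ### The centered tessellation is dual to the `{2k,3}`-tessellation -/

namespace Tessellation

open CoxeterSystem

variable {M N : CoxeterMatrix (Fin 3)} {k : ℕ}

/-- A function of flags that does not change when the other faces of the flag change is a function
of the face of dimension `i`. -/
theorem eq_of_face_eq {α : Type*} {i : Fin 3} {f : M.Group → α}
    (hf : ∀ x, ∀ j ≠ i, f (x * M.simple j) = f x) {x y : M.Group} (h : face i x = face i y) :
    f x = f y := by
  have hu : x⁻¹ * y ∈ faceStabilizer M i := QuotientGroup.eq.mp h
  have hy : y = x * (x⁻¹ * y) := by group
  rw [hy]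
  generalize x⁻¹ * y = u at hu
  induction hu using Subgroup.closure_induction_right with
  | one => rw [mul_one]
  | mul_right u hu z hz ih =>
    obtain ⟨j, hj, rfl⟩ := hz
    rw [← mul_assoc, hf _ j hj, ih]
  | mul_inv_cancel u hu z hz ih =>
    obtain ⟨j, hj, rfl⟩ := hz
    rw [simple_inv, ← mul_assoc, hf _ j hj, ih]

/-- The three kinds of flags of the triangulation with the tile centers as new vertices: at the
center of a tile, along the segment that ends there; at a vertex of the tile, along that segment;
and at a vertex of the tile, along an edge of the tile. -/
inductive Corner
  | center
  | spoke
  | rim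

/-- Crossing a flag of the triangulation in one of the three directions: to the other triangle at
its edge, to the other edge at its vertex, to the other end of its edge. The triangle on the center
of a tile and one of its edges has six flags, three for each of the two flags of the original
tessellation that contain the tile and the edge. The vertices, edges and triangles of the
triangulation are the tiles, edges and vertices of the dual tessellation, which explains the
numbering of the directions. -/
def cross : Fin 3 → M.Group × Corner → M.Group × Corner
  | 0, (w, .center) => (w * M.simple 1, .center)
  | 0, (w, .spoke) => (w * M.simple 1, .spoke)
  | 0, (w, .rim) => (w * M.simple 2, .rim)
  | 1, (w, .center) => (w * M.simple 0, .center)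
  | 1, (w, .spoke) => (w, .rim)
  | 1, (w, .rim) => (w, .spoke)
  | 2, (w, .center) => (w, .spoke)
  | 2, (w, .spoke) => (w, .center)
  | 2, (w, .rim) => (w * M.simple 0, .rim)

theorem cross_involutive (i : Fin 3) : Function.Involutive (cross (M := M) i) := by
  rintro ⟨w, c⟩
  fin_cases i <;> cases c <;> simp [cross]

/-- `cross` as permutations. -/
def crossPerm (M : CoxeterMatrix (Fin 3)) (i : Fin 3) : Equiv.Perm (M.Group × Corner) :=
  (cross_involutive i).toPerm

@[simp] theorem crossPerm_apply (i : Fin 3) (p : M.Group × Corner) :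
    crossPerm M i p = cross i p := rfl

/-- The relations of `[2k,3]` hold for the three ways of crossing a flag of the triangulation. -/
theorem IsTess.exists_action (hM : IsTess M k) (h01 : N 0 1 = 2 * k) (h12 : N 1 2 = 3)
    (h02 : N 0 2 = 2) : ∃ Φ : N.Group → M.Group × Corner,
      Φ 1 = (1, .center) ∧ ∀ g i, Φ (g * N.simple i) = cross i (Φ g) := by
  obtain ⟨ρ, hρ⟩ := exists_lift (M := N)
    (crossPerm M) (by
      intro i
      ext1 p
      exact cross_involutive i p) (by
      rw [h01, pow_mul]
      have hc : ∀ n (w : M.Group),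
          (((crossPerm M 0 * crossPerm M 1) ^ 2) ^ n) (w, .center) =
            (w * (M.simple 0 * M.simple 1) ^ (2 * n), .center) := by
        intro n
        induction n with
        | zero => simp
        | succ n ih =>
          intro w
          rw [pow_succ, Equiv.Perm.mul_apply]
          have e : ((crossPerm M 0 * crossPerm M 1) ^ 2) (w, .center) =
              (w * (M.simple 0 * M.simple 1) ^ 2, .center) := by
            simp [pow_two, cross, mul_assoc]
          rw [e, ih, mul_add, pow_add _ (2 * n), mul_assoc]
          congr 2
          rw [← pow_add, ← pow_add, add_comm]
      have hs : ∀ n (w : M.Group),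
          (((crossPerm M 0 * crossPerm M 1) ^ 2) ^ n) (w, .spoke) =
            (w * (M.simple 2 * M.simple 1) ^ n, .spoke) := by
        intro n
        induction n with
        | zero => simp
        | succ n ih =>
          intro w
          rw [pow_succ, Equiv.Perm.mul_apply]
          have e : ((crossPerm M 0 * crossPerm M 1) ^ 2) (w, .spoke) =
              (w * (M.simple 2 * M.simple 1), .spoke) := by
            simp [pow_two, cross, mul_assoc]
          rw [e, ih, pow_succ', mul_assoc]
      have hr : ∀ n (w : M.Group),
          (((crossPerm M 0 * crossPerm M 1) ^ 2) ^ n) (w, .rim) =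
            (w * (M.simple 1 * M.simple 2) ^ n, .rim) := by
        intro n
        induction n with
        | zero => simp
        | succ n ih =>
          intro w
          rw [pow_succ, Equiv.Perm.mul_apply]
          have e : ((crossPerm M 0 * crossPerm M 1) ^ 2) (w, .rim) =
              (w * (M.simple 1 * M.simple 2), .rim) := by
            simp [pow_two, cross, mul_assoc]
          rw [e, ih, pow_succ', mul_assoc]
      have p01 : (M.simple 0 * M.simple 1) ^ (2 * k) = 1 := by
        rw [← hM.m01, ← hM.orderOf_tile, pow_orderOf_eq_one]
      have p12 : (M.simple 1 * M.simple 2) ^ k = 1 := by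
        rw [← hM.m12, ← hM.orderOf_vertex, pow_orderOf_eq_one]
      have p21 : (M.simple 2 * M.simple 1) ^ k = 1 := by
        rw [← inv_inj, ← inv_pow, mul_inv_rev, simple_inv, simple_inv, p12, inv_one]
      ext1 ⟨w, c⟩
      cases c
      · rw [hc, p01, mul_one, Equiv.Perm.one_apply]
      · rw [hs, p21, mul_one, Equiv.Perm.one_apply]
      · rw [hr, p12, mul_one, Equiv.Perm.one_apply]) (by
      rw [h12]
      ext1 ⟨w, c⟩
      cases c <;> simp [pow_succ, cross]) (by
      rw [h02]
      ext1 ⟨w, c⟩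
      cases c
      · simp [pow_succ, cross]
      · simp [pow_succ, cross]
      · simp [pow_succ, cross, hM.mul_comm02])
  -- flags of the dual tessellation are acted on from the right, hence the inverse
  refine ⟨fun g => ρ g⁻¹ (1, .center), by simp, fun g i => ?_⟩
  change ρ (g * N.simple i)⁻¹ _ = cross i (ρ g⁻¹ _)
  rw [mul_inv_rev, simple_inv, map_mul, hρ]
  rfl

/-- The flags of the `{2k,3}`-tessellation are the flags of the triangulation. -/
theorem IsTess.exists_flag_equiv (hM : IsTess M k) (h01 : N 0 1 = 2 * k) (h12 : N 1 2 = 3)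
    (h02 : N 0 2 = 2) : ∃ Φ : N.Group ≃ M.Group × Corner,
      ∀ g i, Φ (g * N.simple i) = cross i (Φ g) := by
  obtain ⟨Φ, hΦ1, hΦ⟩ := hM.exists_action h01 h12 h02
  have p01 : (N.simple 0 * N.simple 1) ^ (2 * k) = 1 := by
    rw [← h01]; exact N.toCoxeterSystem.simple_mul_simple_pow 0 1
  have braid : N.simple 1 * N.simple 2 * N.simple 1 = N.simple 2 * N.simple 1 * N.simple 2 := by
    have h := N.toCoxeterSystem.simple_mul_simple_pow 1 2
    rw [h12] at h
    have h' : N.simple 1 * N.simple 2 * N.simple 1 *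
        (N.simple 2 * N.simple 1 * N.simple 2) = 1 := by
      rw [← h]
      simp only [pow_succ, pow_zero, one_mul, mul_assoc]
      rfl
    rw [mul_eq_one_iff_eq_inv.mp h']
    simp [mul_assoc]
  have comm := simple_comm_of_eq_two h02
  have comm' : ∀ x : N.Group, x * N.simple 0 * N.simple 2 = x * N.simple 2 * N.simple 0 := by
    intro x
    rw [mul_assoc, comm, mul_assoc]
  have braid' : ∀ x : N.Group, x * N.simple 1 * N.simple 2 * N.simple 1 =
      x * N.simple 2 * N.simple 1 * N.simple 2 := by
    intro x
    simpa only [mul_assoc] using congrArg (x * ·) braid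
  -- the symmetries of the original tessellation, as symmetries of the dual one
  set r : N.Group := N.simple 2 * N.simple 1 * N.simple 0 * N.simple 1 * N.simple 2 with hr
  have rr : r * r = 1 := by simp [hr, ← mul_assoc]
  obtain ⟨ψ, hψ⟩ := exists_lift (M := M) (![N.simple 1, N.simple 0, r]) (by
      intro i
      fin_cases i <;> simp [rr]) (by
      rw [hM.m01]
      change (N.simple 1 * N.simple 0) ^ (2 * k) = 1
      rw [← inv_inj, ← inv_pow, mul_inv_rev, simple_inv, simple_inv, p01, inv_one]) (by
      rw [hM.m12]
      change (N.simple 0 * r) ^ k = 1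
      have e : N.simple 0 * r =
          N.simple 2 * (N.simple 0 * N.simple 1) ^ 2 * (N.simple 2)⁻¹ := by
        simp only [hr, pow_two, simple_inv, ← mul_assoc, comm]
      rw [e, conj_pow, ← pow_mul, p01, mul_one, mul_inv_cancel]) (by
      rw [hM.m02]
      change (N.simple 1 * r) ^ 2 = 1
      have e : N.simple 1 * r = r * N.simple 1 := by
        simp only [hr, ← mul_assoc]
        rw [braid, braid', ← comm']
      rw [pow_two]
      nth_rw 2 [e]
      rw [mul_assoc, ← mul_assoc r, rr, one_mul, simple_mul_self])
  have ψ0 : ψ (M.simple 0) = N.simple 1 := hψ 0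
  have ψ1 : ψ (M.simple 1) = N.simple 0 := hψ 1
  have ψ2 : ψ (M.simple 2) = r := hψ 2
  set Ψ : M.Group × Corner → N.Group := fun p => match p with
    | (w, .center) => ψ w
    | (w, .spoke) => ψ w * N.simple 2
    | (w, .rim) => ψ w * N.simple 2 * N.simple 1 with hΨ
  have Ψcross : ∀ i p, Ψ (cross i p) = Ψ p * N.simple i := by
    rintro i ⟨w, c⟩
    fin_cases i <;> cases c
    · simp [hΨ, cross, ψ1]
    · simp [hΨ, cross, ψ1, comm']
    · simp [hΨ, cross, ψ2, hr, ← mul_assoc]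
    · simp [hΨ, cross, ψ0]
    · simp [hΨ, cross]
    · simp [hΨ, cross]
    · simp [hΨ, cross]
    · simp [hΨ, cross]
    · simp [hΨ, cross, ψ0, braid']
  have left : ∀ g, Ψ (Φ g) = g := by
    intro g
    induction g using N.toCoxeterSystem.simple_induction_right with
    | one => rw [hΦ1]; exact map_one ψ
    | mul_simple_right g i ih =>
      change Ψ (Φ (g * N.simple i)) = g * N.simple i
      rw [hΦ, Ψcross, ih]
  have center : ∀ w, Φ (ψ w) = (w, .center) := by
    intro w
    induction w using M.toCoxeterSystem.simple_induction_right with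
    | one => rw [map_one, hΦ1]
    | mul_simple_right w i ih =>
      change Φ (ψ (w * M.simple i)) = (w * M.simple i, .center)
      rw [map_mul]
      fin_cases i
      · change Φ (ψ w * ψ (M.simple 0)) = (w * M.simple 0, .center)
        rw [ψ0, hΦ, ih]; rfl
      · change Φ (ψ w * ψ (M.simple 1)) = (w * M.simple 1, .center)
        rw [ψ1, hΦ, ih]; rfl
      · change Φ (ψ w * ψ (M.simple 2)) = (w * M.simple 2, .center)
        rw [ψ2, hr]
        simp only [← mul_assoc, hΦ, ih]
        rfl
  have right : ∀ p, Φ (Ψ p) = p := by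
    rintro ⟨w, c⟩
    cases c
    · exact center w
    · change Φ (ψ w * N.simple 2) = _
      rw [hΦ, center]; rfl
    · change Φ (ψ w * N.simple 2 * N.simple 1) = _
      rw [hΦ, hΦ, center]; rfl
  exact ⟨⟨Φ, Ψ, left, right⟩, hΦ⟩

/-- The vertex of a flag of the triangulation: a tile center or an old vertex. -/
def corner : M.Group × Corner → Tile M ⊕ Vertex M
  | (w, .center) => .inl (face 2 w)
  | (w, .spoke) => .inr (face 0 w)
  | (w, .rim) => .inr (face 0 w)

theorem centeredGraph_adj_of_cross (hM : IsTess M k) (p : M.Group × Corner) :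
    (centeredGraph M).Adj (corner p) (corner (cross 2 p)) := by
  obtain ⟨w, c⟩ := p
  cases c
  · exact ⟨w, rfl, rfl⟩
  · exact ⟨w, rfl, rfl⟩
  · exact ⟨(hM.vertex_ne w).symm, face 1 w, ⟨w, rfl, rfl⟩, w * M.simple 0, rfl, edge_mul0 w⟩

theorem centeredGraph_adj_iff (hM : IsTess M k) {a b : Tile M ⊕ Vertex M} :
    (centeredGraph M).Adj a b ↔
      ∃ p : M.Group × Corner, corner p = a ∧ corner (cross 2 p) = b := by
  constructor
  · intro h
    rcases a with X | u <;> rcases b with Y | v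
    · exact h.elim
    · obtain ⟨w, rfl, rfl⟩ := h
      exact ⟨(w, .center), rfl, rfl⟩
    · obtain ⟨w, rfl, rfl⟩ := h
      exact ⟨(w, .spoke), rfl, rfl⟩
    · obtain ⟨hne, e, ⟨x, rfl, rfl⟩, y, rfl, hy⟩ := h
      refine ⟨(x, .rim), rfl, ?_⟩
      change Sum.inr (face 0 (x * M.simple 0)) = Sum.inr (face 0 y)
      rcases hM.same_edge hy with rfl | rfl | rfl | rfl
      · exact absurd rfl hne
      · rfl
      · exact absurd (vertex_mul2 x).symm hne
      · rw [vertex_mul2]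
  · rintro ⟨p, rfl, rfl⟩
    exact centeredGraph_adj_of_cross hM p

theorem tileGraph_adj_iff (h02 : N 0 2 = 2) {X Y : Tile N} :
    (tileGraph N).Adj X Y ↔ X ≠ Y ∧ ∃ g : N.Group, face 2 g = X ∧ face 2 (g * N.simple 2) = Y := by
  refine and_congr_right fun hne => ?_
  constructor
  · rintro ⟨e, ⟨x, rfl, rfl⟩, y, rfl, hy⟩
    refine ⟨x, rfl, ?_⟩
    -- the two tiles of an edge, as an unordered pair
    have comm := simple_comm_of_eq_two h02
    have h := eq_of_face_eq
      (f := fun g : N.Group => ({face 2 g, face 2 (g * N.simple 2)} : Set (Tile N))) (by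
        intro g j hj
        fin_cases j
        · change ({face 2 (g * N.simple 0), face 2 (g * N.simple 0 * N.simple 2)} : Set _) = _
          rw [mul_assoc, comm, ← mul_assoc, tile_mul0, tile_mul0]
        · exact absurd rfl hj
        · change ({face 2 (g * N.simple 2), face 2 (g * N.simple 2 * N.simple 2)} : Set _) = _
          rw [mul_simple_cancel, Set.pair_comm]) hy
    have hmem : face 2 y ∈ ({face 2 x, face 2 (x * N.simple 2)} : Set (Tile N)) := by
      rw [← h]; exact Or.inl rfl
    exact (hmem.resolve_left hne.symm).symm
  · rintro ⟨g, rfl, rfl⟩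
    exact ⟨face 1 g, ⟨g, rfl, rfl⟩, g * N.simple 2, rfl, edge_mul2 g⟩

/-- Joining the center of each tile of the `{2k,k}`-tessellation to the vertices of the tile gives
the graph of the tiles of the `{2k,3}`-tessellation. -/
theorem IsTess.exists_duality (hM : IsTess M k) (h01 : N 0 1 = 2 * k) (h12 : N 1 2 = 3)
    (h02 : N 0 2 = 2) : Nonempty (centeredGraph M ≃g tileGraph N) := by
  obtain ⟨Φ, hΦ⟩ := hM.exists_flag_equiv h01 h12 h02
  have hΦ' : ∀ p i, Φ.symm (cross i p) = Φ.symm p * N.simple i := by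
    intro p i
    rw [Equiv.symm_apply_eq, hΦ, Equiv.apply_symm_apply]
  have forward : ∀ {g g' : N.Group}, face 2 g = face 2 g' → corner (Φ g) = corner (Φ g') := by
    intro g g'
    refine eq_of_face_eq (f := fun g => corner (Φ g)) fun g j hj => ?_
    simp only [hΦ]
    generalize Φ g = p
    obtain ⟨w, c⟩ := p
    fin_cases j
    · cases c
      · exact congrArg Sum.inl (tile_mul1 w)
      · exact congrArg Sum.inr (vertex_mul1 w)
      · exact congrArg Sum.inr (vertex_mul2 w)
    · cases c
      · exact congrArg Sum.inl (tile_mul0 w)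
      · rfl
      · rfl
    · exact absurd rfl hj
  have hinl : ∀ {w w' : M.Group}, face 2 w = face 2 w' →
      face 2 (Φ.symm (w, .center)) = face 2 (Φ.symm (w', .center)) := by
    intro w w'
    refine eq_of_face_eq (f := fun w => face 2 (Φ.symm (w, .center))) fun w j hj => ?_
    fin_cases j
    · exact (congrArg (face 2) (hΦ' (w, .center) 1)).trans (tile_mul1 _)
    · exact (congrArg (face 2) (hΦ' (w, .center) 0)).trans (tile_mul0 _)
    · exact absurd rfl hj
  have hrim : ∀ w, face 2 (Φ.symm (w, .rim)) = face 2 (Φ.symm (w, .spoke)) := fun w =>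
    (congrArg (face 2) (hΦ' (w, .spoke) 1)).trans (tile_mul1 _)
  have hinr : ∀ {w w' : M.Group}, face 0 w = face 0 w' →
      face 2 (Φ.symm (w, .spoke)) = face 2 (Φ.symm (w', .spoke)) := by
    intro w w'
    refine eq_of_face_eq (f := fun w => face 2 (Φ.symm (w, .spoke))) fun w j hj => ?_
    fin_cases j
    · exact absurd rfl hj
    · exact (congrArg (face 2) (hΦ' (w, .spoke) 0)).trans (tile_mul0 _)
    · change face 2 (Φ.symm (w * M.simple 2, .spoke)) = face 2 (Φ.symm (w, .spoke))
      rw [← hrim, ← hrim]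
      exact (congrArg (face 2) (hΦ' (w, .rim) 0)).trans (tile_mul0 _)
  have backward : ∀ {p p' : M.Group × Corner}, corner p = corner p' →
      face 2 (Φ.symm p) = face 2 (Φ.symm p') := by
    rintro ⟨w, c⟩ ⟨w', c'⟩ h
    cases c <;> cases c'
    · exact hinl (Sum.inl_injective h)
    · exact absurd h Sum.inl_ne_inr
    · exact absurd h Sum.inl_ne_inr
    · exact absurd h Sum.inr_ne_inl
    · exact hinr (Sum.inr_injective h)
    · rw [hrim]; exact hinr (Sum.inr_injective h)
    · exact absurd h Sum.inr_ne_inl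
    · rw [hrim]; exact hinr (Sum.inr_injective h)
    · rw [hrim, hrim]; exact hinr (Sum.inr_injective h)
  have lift : ∀ X : Tile N, ∃ a, ∀ g, face 2 g = X → corner (Φ g) = a := by
    intro X
    obtain ⟨g, rfl⟩ := QuotientGroup.mk_surjective X
    exact ⟨_, fun g' h => forward h⟩
  choose F hF using lift
  have hF' : ∀ g, F (face 2 g) = corner (Φ g) := fun g => (hF _ g rfl).symm
  have hbij : Function.Bijective F := by
    constructor
    · intro X Y h
      obtain ⟨g, rfl⟩ := QuotientGroup.mk_surjective X
      obtain ⟨g', rfl⟩ := QuotientGroup.mk_surjective Y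
      have h1 : corner (Φ g) = corner (Φ g') := by rw [← hF', ← hF']; exact h
      have := backward h1
      rwa [Equiv.symm_apply_apply, Equiv.symm_apply_apply] at this
    · rintro (X | v)
      · obtain ⟨w, rfl⟩ := QuotientGroup.mk_surjective X
        exact ⟨face 2 (Φ.symm (w, .center)), by rw [hF', Equiv.apply_symm_apply]; rfl⟩
      · obtain ⟨w, rfl⟩ := QuotientGroup.mk_surjective v
        exact ⟨face 2 (Φ.symm (w, .spoke)), by rw [hF', Equiv.apply_symm_apply]; rfl⟩
  refine ⟨(SimpleGraph.Iso.symm ⟨Equiv.ofBijective F hbij, ?_⟩)⟩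
  intro X Y
  change (centeredGraph M).Adj (F X) (F Y) ↔ (tileGraph N).Adj X Y
  constructor
  · intro h
    obtain ⟨p, hX, hY⟩ := (centeredGraph_adj_iff hM).mp h
    rw [tileGraph_adj_iff h02]
    refine ⟨fun hXY => h.ne (congrArg F hXY), Φ.symm p, hbij.1 ?_, hbij.1 ?_⟩
    · rw [hF', Equiv.apply_symm_apply, hX]
    · rw [hF', hΦ, Equiv.apply_symm_apply, hY]
  · intro h
    obtain ⟨-, g, rfl, rfl⟩ := (tileGraph_adj_iff h02).mp h
    rw [hF', hF', hΦ]
    exact centeredGraph_adj_of_cross hM _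

end Tessellation

/-! ### Puncturing -/

namespace Tessellation

open CoxeterSystem

variable {M N : CoxeterMatrix (Fin 3)} {k : ℕ}

section Puncture

variable (φ : centeredGraph M ≃g tileGraph N) {A : Set (Tile M)}

theorem inr_mem_puncture {v : Vertex M} : φ (.inr v) ∈ puncture φ A ↔ v ∈ vertexSet A := by
  constructor
  · rintro ⟨u, hu, h⟩
    rwa [← Sum.inr_injective (φ.injective h)]
  · exact fun h => ⟨v, h, rfl⟩

theorem inl_notMem_puncture (X : Tile M) : φ (.inl X) ∉ puncture φ A := by
  rintro ⟨u, -, h⟩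
  exact Sum.inr_ne_inl (φ.injective h)

theorem ncard_puncture : (puncture φ A).ncard = vertexCount A :=
  Set.InjOn.ncard_image (fun _ _ _ _ h => Sum.inr_injective (φ.injective h))

theorem adj_center {X : Tile M} {Z : Tile N} :
    (tileGraph N).Adj (φ (.inl X)) Z ↔ ∃ v ∈ verts X, φ (.inr v) = Z := by
  constructor
  · intro h
    obtain ⟨a, rfl⟩ := φ.surjective Z
    rw [φ.map_adj_iff] at h
    rcases a with Y | v
    · exact h.elim
    · exact ⟨v, h, rfl⟩
  · rintro ⟨v, hv, rfl⟩
    exact φ.map_adj_iff.mpr hv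

/-- The ends of the edges of the original tessellation correspond to adjacent tiles, so a connected
set of tiles has a connected set of vertices. -/
theorem isPolyform_puncture (hM : IsTess M k) (hA : IsPolyform A) : IsPolyform (puncture φ A) := by
  obtain ⟨hfin, hconn, X₀, hX₀⟩ := isPolyform_iff.mp hA
  obtain ⟨x₀, rfl⟩ := QuotientGroup.mk_surjective X₀
  refine isPolyform_iff.mpr ⟨(hM.finite_vertexSet hfin).image _, ?_,
    φ (.inr (face 0 x₀)), _, ⟨_, hX₀, x₀, rfl, rfl⟩, rfl⟩
  intro S hS hne hcl
  have hstep : ∀ x : M.Group, face 2 x ∈ A → φ (.inr (face 0 x)) ∈ S →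
      φ (.inr (face 0 (x * M.simple 0))) ∈ S := by
    intro x hx h
    refine hcl _ h _ ((inr_mem_puncture φ).mpr ⟨_, hx, x * M.simple 0, tile_mul0 x, rfl⟩) ?_
    exact φ.map_adj_iff.mpr
      ⟨(hM.vertex_ne x).symm, face 1 x, ⟨x, rfl, rfl⟩, _, rfl, edge_mul0 x⟩
  have htile : ∀ x y : M.Group, face 2 x ∈ A → face 2 x = face 2 y →
      φ (.inr (face 0 x)) ∈ S → φ (.inr (face 0 y)) ∈ S := by
    intro x y hx hxy h
    have := eq_of_face_eq
      (f := fun x : M.Group => face 2 x ∈ A → φ (.inr (face 0 x)) ∈ S) (by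
        intro x j hj
        fin_cases j
        · change (face 2 (x * M.simple 0) ∈ A → φ (.inr (face 0 (x * M.simple 0))) ∈ S) = _
          rw [tile_mul0]
          refine propext (forall_congr' fun hx => ⟨fun h => ?_, hstep x hx⟩)
          have := hstep (x * M.simple 0) (by rwa [tile_mul0]) h
          rwa [mul_simple_cancel] at this
        · change (face 2 (x * M.simple 1) ∈ A → φ (.inr (face 0 (x * M.simple 1))) ∈ S) = _
          rw [tile_mul1, vertex_mul1]
        · exact absurd rfl hj) hxy
    exact (this ▸ fun _ => h : face 2 y ∈ A → φ (.inr (face 0 y)) ∈ S) (hxy ▸ hx)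
  have hall := hconn {X | X ∈ A ∧ ∀ v ∈ verts X, φ (.inr v) ∈ S} (fun X hX => hX.1) (by
      obtain ⟨Z, hZ⟩ := hne
      obtain ⟨v, ⟨X, hX, x, rfl, rfl⟩, rfl⟩ := hS hZ
      refine ⟨_, hX, ?_⟩
      rintro v ⟨y, hy, rfl⟩
      exact htile x y hX hy.symm hZ) (by
      rintro X ⟨hX, hXS⟩ Y hY hadj
      obtain ⟨x, rfl, rfl⟩ := hM.adj_iff.mp hadj
      refine ⟨hY, ?_⟩
      rintro v ⟨y, hy, rfl⟩
      refine htile _ y hY hy.symm ?_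
      rw [vertex_mul2]
      exact hXS _ ⟨x, rfl, rfl⟩)
  refine Set.Subset.antisymm hS ?_
  rintro _ ⟨v, ⟨X, hX, hv⟩, rfl⟩
  rw [← hall] at hX
  exact hX.2 v hv

/-- The centers of the tiles of `A` are isolated in the complement of the puncture. -/
theorem componentTiles_center {X : Tile M} (hX : X ∈ A) {C : ComplComponent (puncture φ A)}
    (h : φ (.inl X) ∈ componentTiles C) : componentTiles C = {φ (.inl X)} := by
  refine Set.Subset.antisymm (componentTiles_subset ?_ rfl h) (by simpa using h)
  rintro _ rfl Z hZ hadj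
  obtain ⟨v, hv, rfl⟩ := (adj_center φ).mp hadj
  exact absurd ((inr_mem_puncture φ).mpr ⟨X, hX, hv⟩) hZ

/-- A hole of the puncture without the center of a tile of `A` would correspond to a surrounded
set of tiles. -/
theorem exists_center_of_hole (hM : IsTess M k) (hA : IsPolyform A)
    (hmin : vertexCount A = minVertices M A.ncard) {C : ComplComponent (puncture φ A)}
    (hC : C.supp.Finite) : ∃ X ∈ A, φ (.inl X) ∈ componentTiles C := by
  by_contra hno
  push Not at hno
  have hgap := componentTiles_isGap hC
  have hin : ∀ v X, φ (.inr v) ∈ componentTiles C → v ∈ verts X →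
      φ (.inl X) ∈ componentTiles C := fun v X h hv =>
    hgap.closed _ h _ (inl_notMem_puncture φ X) (φ.map_adj_iff.mpr hv)
  obtain ⟨X, hX⟩ : ∃ X, φ (.inl X) ∈ componentTiles C := by
    obtain ⟨Z, hZ⟩ := componentTiles_nonempty C
    obtain ⟨X | v, rfl⟩ := φ.surjective Z
    · exact ⟨X, hZ⟩
    · obtain ⟨x, rfl⟩ := QuotientGroup.mk_surjective v
      exact ⟨face 2 x, hin _ _ hZ ⟨x, rfl, rfl⟩⟩
  refine hM.not_surrounded hA hmin (S := {X | φ (.inl X) ∈ componentTiles C})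
    (hgap.finite.preimage (f := fun X => φ (.inl X))
      (fun X _ Y _ h => Sum.inl_injective (φ.injective h))) ⟨X, hX⟩ (fun X hX hXA => hno X hXA hX) ?_
  intro X hX v hv hvA Y hY
  refine hin v Y ?_ hY
  exact hgap.closed _ hX _ (fun h => hvA ((inr_mem_puncture φ).mp h))
    ((adj_center φ).mpr ⟨v, hv, rfl⟩)

theorem holeCount_puncture (hM : IsTess M k) (hA : IsPolyform A)
    (hmin : vertexCount A = minVertices M A.ncard) : holeCount (puncture φ A) = A.ncard := by
  set c : Tile M → ComplComponent (puncture φ A) := fun X =>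
    ((tileGraph N).induce (puncture φ A)ᶜ).connectedComponentMk
      ⟨φ (.inl X), inl_notMem_puncture φ X⟩ with hc
  have hmem : ∀ X, φ (.inl X) ∈ componentTiles (c X) := fun X => ⟨_, rfl, rfl⟩
  have himage : holes (puncture φ A) = c '' A := by
    ext C
    constructor
    · intro hC
      obtain ⟨X, hX, h⟩ := exists_center_of_hole φ hM hA hmin hC
      refine ⟨X, hX, componentTiles_injective ?_⟩
      rw [componentTiles_center φ hX h, componentTiles_center φ hX (hmem X)]
    · rintro ⟨X, hX, rfl⟩
      change (c X).supp.Finite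
      rw [← finite_componentTiles, componentTiles_center φ hX (hmem X)]
      exact Set.finite_singleton _
  rw [holeCount, himage]
  refine Set.InjOn.ncard_image fun X hX Y hY h => ?_
  have h1 := componentTiles_center φ hX (hmem X)
  rw [h, componentTiles_center φ hY (hmem Y), Set.singleton_eq_singleton_iff] at h1
  exact (Sum.inl_injective (φ.injective h1)).symm

end Puncture

end Tessellation

end

theorem theorem1p7 (k h : ℕ) (hk : 3 < k) (hh : 1 ≤ h) :
    let M := Tessellation.schlafli (2 * k) k (by omega) (by omega)
    let N := Tessellation.schlafli (2 * k) 3 (by omega) (by omega)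
    ((Tessellation.minTiles N h : ℝ) ≤
        ((Tessellation.minPerimeter M h : ℝ) + (2 * (k : ℝ) - 2) * (h : ℝ)) / 2 + 1) ∧
      (Tessellation.minVertices M h : ℝ) =
        ((Tessellation.minPerimeter M h : ℝ) + (2 * (k : ℝ) - 2) * (h : ℝ)) / 2 + 1 ∧
      Tessellation.minTiles N h ≤ Tessellation.minVertices M h ∧
      ∃ φ : Tessellation.centeredGraph M ≃g Tessellation.tileGraph N,
        ∃ A : Set (Tessellation.Tile M),
          Tessellation.IsExtremal A ∧ A.ncard = h ∧
          Tessellation.vertexCount A = Tessellation.minVertices M h ∧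
          Tessellation.IsPolyform (Tessellation.puncture φ A) ∧
          Tessellation.holeCount (Tessellation.puncture φ A) = h ∧
          (Tessellation.puncture φ A).ncard = Tessellation.minVertices M h := by
  intro M N
  have hM : Tessellation.IsTess M k := Tessellation.isTess_schlafli hk _ _
  obtain ⟨φ⟩ := hM.exists_duality (N := N) rfl rfl rfl
  obtain ⟨A, hA, hn, hmin⟩ := hM.exists_minimal hh
  have hmin' : Tessellation.vertexCount A = Tessellation.minVertices M A.ncard := by rw [hn, hmin]
  have hext := hM.isExtremal_of_minimal hA hmin'
  have hpoly := Tessellation.isPolyform_puncture φ hM hA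
  have hholes := Tessellation.holeCount_puncture φ hM hA hmin'
  have hcard : (Tessellation.puncture φ A).ncard = Tessellation.minVertices M h := by
    rw [Tessellation.ncard_puncture, hmin]
  have hle : Tessellation.minTiles N h ≤ Tessellation.minVertices M h :=
    Nat.sInf_le ⟨_, hpoly, hholes.trans hn, hcard⟩
  have hcount := hM.outerPerimeter_of_minimal hA hmin'
  rw [hext.outerPerimeter_eq, hmin, hn] at hcount
  have heq : (Tessellation.minVertices M h : ℝ) =
      ((Tessellation.minPerimeter M h : ℝ) + (2 * (k : ℝ) - 2) * (h : ℝ)) / 2 + 1 := by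
    have : (2 * Tessellation.minVertices M h + 2 * h : ℝ) =
        2 * k * h + Tessellation.minPerimeter M h + 2 := by exact_mod_cast hcount
    linarith
  refine ⟨?_, heq, hle, φ, A, hext, hn, hmin, hpoly, hholes.trans hn, hcard⟩
  rw [← heq]
  exact_mod_cast hle
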